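/- Let $(M,F)$ be a connected $n$-dimensional Finsler manifold (smooth, Hausdorff, second countable, without boundary), i.e. $F:TM\to[0,\infty)$ is smooth off the zero section and restricts to a Minkowski norm on each $T_xM$; here $F(x,\lambda y)=\lambda F(x,y)$ only for $\lambda>0$, so $F$ need not be reversible. Put $g_y(y,v)=\tfrac12\frac{d}{ds}\big|_{s=0}F^2(y+sv)$. The gradient of $f$ is defined by $df(v)=g_{\nabla f}(\nabla f,v)$. Let $d_F(p,q)$ be the infimum of the $F$-lengths of piecewise smooth curves from $p$ to $q$, and $d_F(A,q)=\inf_{p\in A}d_F(p,q)$. Assume that $F$ is forward and backward complete: every forward Cauchy sequence and every backward Cauchy sequence for $d_F$ converges. Let $f:M\to\mathbb R$ be smooth with $f(M)=[a,b]$ and $F$-transnormal: $F^2(\nabla f)=\mathfrak b(f)$ with $\mathfrak b$ continuous on $[a,b]$. Assume that $f$ has no critical values in $(a,b)$, i.e. $\mathfrak b>0$ on $(a,b)$, and that $f^{-1}(b)$ has empty interior. Write $r_{c,d}=\int_c^d ds/\sqrt{\mathfrak b(s)}$. For a set $A\subset M$, the wavefront at time $t\ge 0$ of the wave starting from $A$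 at time $0$ is $\{q: d_F(A,q)=t\}$; write $\phi_q(s)=\{p:d_F(q,p)=s\}$ for the wavefront started at a point $q$. A wave ray from $A$ is a piecewise smooth curve $\gamma:[0,T]\to M$ with $F(\gamma')=1$ and $\gamma(0)\in A$ which is a shortest path from $A$ to $\gamma(T)$, i.e. has length $d_F(A,\gamma(T))$. A vector $y\ne0$ at $p$ is orthogonal to a set $S$ if $g_y(y,v)=0$ for each velocity $v$ at $p$ of a curve in $S$ through $p$ that is differentiable there (for a submanifold $S$: for each $v\in T_pS$). Two sets are called tangent at a common point $p$ if some $y\neq 0$ at $p$ is orthogonal to both. Consider the wave that starts from $f^{-1}(a)$ at time $0$. Then: a) $1/\sqrt{\mathfrak b}$ is integrable on $[a,b]$, and for every $c\in[a,b]$, $f^{-1}(c)$ is the wavefront at time $r_{a,c}$. b) (Huygens' envelope principle) For all $c<d$ in $[a,b]$, $f^{-1}(d)$ is the envelope, ahead of the front $f^{-1}(c)$, of the wavefronts $\phi_q(r_{c,d})$, $q\in f^{-1}(c)$. That is: $f^{-1}(d)$ is the set of the points $p$ with $d_F(f^{-1}(a),p)>r_{a,c}$ that lie on $\phi_q(r_{c,d})$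 for some $q\in f^{-1}(c)$ and satisfy $d_F(q,p)\ge r_{c,d}$ for all $q\in f^{-1}(c)$; at each of its points $f^{-1}(d)$ is tangent to one of the $\phi_q(r_{c,d})$ passing through that point; and, if $c>a$, each $\phi_q(r_{c,d})$ with $q\in f^{-1}(c)$ is tangent to $f^{-1}(d)$ at some common point. c) Every $q\in M$ is the endpoint $\gamma(T)$ of a wave ray $\gamma:[0,T]\to M$ from $f^{-1}(a)$, with $T=r_{a,f(q)}$. Every wave ray $\gamma:[0,T]\to M$ from $f^{-1}(a)$ with $T>0$ is an $F$-geodesic (smooth on $[0,T]$ and length minimizing between any two of its points); it is on $f^{-1}(c)$ exactly at time $r_{a,c}$ (for $c\in[a,b]$ and times in $[0,T]$); its velocity is orthogonal to every wavefront $f^{-1}(c)$ that it meets, including the ends; and it is the initial part of a wave ray $[0,r_{a,b}]\to M$ that joins $f^{-1}(a)$ to $f^{-1}(b)$. -/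

import Mathlib

open Set Filter MeasureTheory
open scoped Topology Manifold ContDiff ENNReal

noncomputable section

namespace Finsler

variable {n : ℕ} {M : Type*} [TopologicalSpace M] [ChartedSpace (EuclideanSpace ℝ (Fin n)) M]
  [IsManifold (𝓡 n) ∞ M]

/-- The fundamental tensor `g_y(u, v) = (1/2) ∂²/∂t∂s F²(y + t u + s v)` at `t = s = 0`, for a
function `F` on the tangent bundle and `y, u, v` in the tangent space at `x`. -/
def fundamentalTensor (F : TangentBundle (𝓡 n) M → ℝ) (x : M)
    (y u v : TangentSpace (𝓡 n) x) : ℝ :=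
  (1 / 2) * deriv (fun t : ℝ => deriv (fun s : ℝ => F ⟨x, y + t • u + s • v⟩ ^ 2) 0) 0

/-- The velocity `(γ(t), γ'(t))` of a curve, as a point of the tangent bundle. -/
def velocity (γ : ℝ → M) (t : ℝ) : TangentBundle (𝓡 n) M :=
  ⟨γ t, mfderiv 𝓘(ℝ, ℝ) (𝓡 n) γ t (1 : ℝ)⟩

/-- The derivative at `t` of a curve defined on the interval `[0, T]`: one-sided at the ends. -/
def derivOn (γ : ℝ → M) (T t : ℝ) : TangentSpace (𝓡 n) (γ t) :=
  mfderivWithin 𝓘(ℝ, ℝ) (𝓡 n) γ (Icc 0 T) t (1 : ℝ)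

/-- A curve is piecewise smooth on `[s, t]`: it is a concatenation of finitely many curves, each
of them smooth on a closed interval. -/
inductive PiecewiseSmooth (n : ℕ) {M : Type*} [TopologicalSpace M]
    [ChartedSpace (EuclideanSpace ℝ (Fin n)) M] (γ : ℝ → M) : ℝ → ℝ → Prop
  | smooth {s t : ℝ} (hst : s ≤ t) (h : ContMDiffOn 𝓘(ℝ, ℝ) (𝓡 n) ∞ γ (Icc s t)) :
      PiecewiseSmooth n γ s t
  | concat {s t u : ℝ} (h₁ : PiecewiseSmooth n γ s t) (h₂ : PiecewiseSmooth n γ t u) :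
      PiecewiseSmooth n γ s u

/-- The vectors tangent to a set `S` at `p`: velocities of curves in `S` through `p`.
If `S` is a submanifold this is its tangent space at `p`. -/
def tangentVectors (S : Set M) (p : M) : Set (TangentSpace (𝓡 n) p) :=
  {v | ∃ σ : ℝ → M, (∀ᶠ s in 𝓝 (0 : ℝ), σ s ∈ S) ∧ MDifferentiableAt 𝓘(ℝ, ℝ) (𝓡 n) σ 0 ∧
    velocity σ 0 = (⟨p, v⟩ : TangentBundle (𝓡 n) M)}

/-- The time `∫_c^d ds / √𝔟(s)`. -/
def travelTime (𝔟 : ℝ → ℝ) (c d : ℝ) : ℝ := ∫ s in c..d, 1 / √(𝔟 s)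

end Finsler

open Finsler

/-- A Finsler structure on the `n`-dimensional manifold `M`: a nonnegative function on the tangent
bundle, smooth off the zero section, whose restriction to each tangent space is a Minkowski
norm. -/
structure FinslerStructure (n : ℕ) (M : Type*) [TopologicalSpace M]
    [ChartedSpace (EuclideanSpace ℝ (Fin n)) M] [IsManifold (𝓡 n) ∞ M] where
  toFun : TangentBundle (𝓡 n) M → ℝ
  nonneg : ∀ v, 0 ≤ toFun v
  smooth : ContMDiffOn ((𝓡 n).tangent) 𝓘(ℝ, ℝ) ∞ toFun {v | v.2 ≠ 0}
  homogeneous : ∀ (x : M) (y : TangentSpace (𝓡 n) x) (r : ℝ), 0 < r →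
    toFun ⟨x, r • y⟩ = r * toFun ⟨x, y⟩
  posDef : ∀ (x : M) (y u : TangentSpace (𝓡 n) x), y ≠ 0 → u ≠ 0 →
    0 < fundamentalTensor toFun x y u u

namespace FinslerStructure

variable {n : ℕ} {M : Type*} [TopologicalSpace M] [ChartedSpace (EuclideanSpace ℝ (Fin n)) M]
  [IsManifold (𝓡 n) ∞ M]

/-- `g_y(y, v) = (1/2) ∂/∂s F²(y + s v)` at `s = 0`. For `y = 0` this is `0`. -/
def legendre (F : FinslerStructure n M) (x : M) (y v : TangentSpace (𝓡 n) x) : ℝ :=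
  (1 / 2) * deriv (fun s : ℝ => F.toFun ⟨x, y + s • v⟩ ^ 2) 0

/-- `y` is the gradient of `f` at `x`: `df_x(v) = g_y(y, v)` for all `v`. -/
def IsGradientAt (F : FinslerStructure n M) (f : M → ℝ) (x : M) (y : TangentSpace (𝓡 n) x) :
    Prop :=
  ∀ v : TangentSpace (𝓡 n) x, (mfderiv (𝓡 n) 𝓘(ℝ, ℝ) f x v : ℝ) = F.legendre x y v

/-- `f` is `F`-transnormal with `F²(∇f) = 𝔟 ∘ f`. (The gradient exists and is unique at every
point, since `y ↦ g_y(y, ·)` is a bijection of the tangent space onto its dual.) -/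
structure IsTransnormal (F : FinslerStructure n M) (f : M → ℝ) (𝔟 : ℝ → ℝ) : Prop where
  smooth : ContMDiff (𝓡 n) 𝓘(ℝ, ℝ) ∞ f
  continuousOn : ContinuousOn 𝔟 (range f)
  gradient : ∀ x : M, ∃ y : TangentSpace (𝓡 n) x,
    F.IsGradientAt f x y ∧ F.toFun ⟨x, y⟩ ^ 2 = 𝔟 (f x)

/-- A non-zero vector `y` at `p` is orthogonal to the set `S`: `g_y(y, v) = 0` for every `v`
tangent to `S` at `p`. -/
def IsOrthogonal (F : FinslerStructure n M) (p : M) (y : TangentSpace (𝓡 n) p) (S : Set M) :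
    Prop :=
  y ≠ 0 ∧ ∀ v ∈ tangentVectors S p, F.legendre p y v = 0

/-- The length of the curve `γ` over `[s, t]`. -/
def length (F : FinslerStructure n M) (γ : ℝ → M) (s t : ℝ) : ℝ≥0∞ :=
  ∫⁻ u in Icc s t, ENNReal.ofReal (F.toFun (velocity γ u))

/-- The (in general non-symmetric) distance `d_F(p, q)`: the infimum of the lengths of the
piecewise smooth curves from `p` to `q`. -/
def dist (F : FinslerStructure n M) (p q : M) : ℝ≥0∞ :=
  ⨅ (γ : ℝ → M) (s : ℝ) (t : ℝ) (_ : PiecewiseSmooth n γ s t) (_ : γ s = p) (_ : γ t = q),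
    F.length γ s t

/-- The distance `d_F(A, q)` from a set to a point. -/
def distFrom (F : FinslerStructure n M) (A : Set M) (q : M) : ℝ≥0∞ := ⨅ p ∈ A, F.dist p q

/-- Every forward Cauchy sequence converges. -/
def ForwardComplete (F : FinslerStructure n M) : Prop :=
  ∀ x : ℕ → M, (∀ ε : ℝ≥0∞, 0 < ε → ∃ N, ∀ i j, N ≤ i → i ≤ j → F.dist (x i) (x j) < ε) →
    ∃ p, Tendsto x atTop (𝓝 p)

/-- Every backward Cauchy sequence converges. -/
def BackwardComplete (F : FinslerStructure n M) : Prop :=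
  ∀ x : ℕ → M, (∀ ε : ℝ≥0∞, 0 < ε → ∃ N, ∀ i j, N ≤ i → i ≤ j → F.dist (x j) (x i) < ε) →
    ∃ p, Tendsto x atTop (𝓝 p)

/-- The wavefront at time `t` of a wave that starts from the set `A` at time `0` and travels with
unit `F`-speed: the points that the wave first reaches at time `t`. -/
def wavefront (F : FinslerStructure n M) (A : Set M) (t : ℝ) : Set M :=
  {q | F.distFrom A q = ENNReal.ofReal t}

/-- The wavefront that started at the point `q`, after time `s`, passes through `p` and is tangent
there to `E`: the two sets have a common orthogonal vector at `p`. -/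
def TouchesAt (F : FinslerStructure n M) (q : M) (s : ℝ) (E : Set M) (p : M) : Prop :=
  p ∈ F.wavefront {q} s ∧ ∃ y : TangentSpace (𝓡 n) p,
    F.IsOrthogonal p y E ∧ F.IsOrthogonal p y (F.wavefront {q} s)

/-- `E` is the envelope, ahead of the front at time `t`, of the wavefronts after time `s` that
start at the points of the front at time `t` (of the wave that starts from `A`). -/
structure IsHuygensEnvelope (F : FinslerStructure n M) (A : Set M) (t s : ℝ) (E : Set M) :
    Prop where
  /-- The points of `E` are the points not yet swept at time `t` that lie on one of the wavefronts
  and inside none of them. -/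
  mem_iff : ∀ p, p ∈ E ↔ ENNReal.ofReal t < F.distFrom A p ∧
    (∃ q ∈ F.wavefront A t, p ∈ F.wavefront {q} s) ∧
    ∀ q ∈ F.wavefront A t, ENNReal.ofReal s ≤ F.dist q p
  /-- At each of its points, `E` is tangent to one of the wavefronts. -/
  tangent : ∀ p ∈ E, ∃ q ∈ F.wavefront A t, F.TouchesAt q s E p
  /-- Each of the wavefronts is tangent to `E` at some point. (Only for `t > 0`, since
  the source `A` may have interior points.) -/
  touches : 0 < t → ∀ q ∈ F.wavefront A t, ∃ p ∈ E, F.TouchesAt q s E p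

/-- A wave ray of the wave that starts from `A`, parametrized by travel time `t ∈ [0, T]`: a
shortest path from `A` to `γ(T)`. -/
structure IsWaveRay (F : FinslerStructure n M) (A : Set M) (γ : ℝ → M) (T : ℝ) : Prop where
  nonneg : 0 ≤ T
  piecewiseSmooth : PiecewiseSmooth n γ 0 T
  unitSpeed : ∀ t ∈ Ioo 0 T, MDifferentiableAt 𝓘(ℝ, ℝ) (𝓡 n) γ t → F.toFun (velocity γ t) = 1
  source : γ 0 ∈ A
  shortest : F.length γ 0 T = F.distFrom A (γ T)

/-- `γ` is a geodesic on `[0, T]`: a smooth curve that minimizes length between any two of its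
points. -/
def IsGeodesic (F : FinslerStructure n M) (γ : ℝ → M) (T : ℝ) : Prop :=
  ContMDiffOn 𝓘(ℝ, ℝ) (𝓡 n) ∞ γ (Icc 0 T) ∧
    ∀ s t, 0 ≤ s → s ≤ t → t ≤ T → F.length γ s t = F.dist (γ s) (γ t)

end FinslerStructure

end

/-!
By the fundamental inequality `g_y(y, v) ≤ F(y) F(v)`, the arrival time `τ(x) = ∫_a^{f x} ds / √𝔟`
satisfies `dτ(v) ≤ F(v)`, with equality exactly in the direction of the gradient. Hence
`τ(q) - τ(p) ≤ d_F(p, q)` everywhere, and equality holds along the curves on which `τ` grows at unit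
rate; these calibrated curves are the wave rays. Through a regular point they are integral curves of
`∇τ`, and by completeness a maximal one (Zorn) runs from `f ⁻¹' {a}` to `f ⁻¹' {b}`. A point of
`f ⁻¹' {b}` is a limit of regular points, because `f ⁻¹' {b}` has empty interior, and the curves
through those points subconverge to one that ends there.

At the ends, where `τ` need not be differentiable, smoothness comes from the geodesic equation: in
the interior a calibrated curve solves Hamilton's equations, and the momentum stays bounded and away
from zero up to the ends, so the solution extends. Orthogonality is the first variation formula for
the equality case of `τ(q) - τ(p) ≤ d_F(p, q)`.
-/

noncomputable section

open Finsler

/-! ### Minkowski norms -/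

section Minkowski

variable {E : Type*} [NormedAddCommGroup E] [NormedSpace ℝ E]

/-- A Minkowski norm on a normed space, the restriction of a Finsler structure to one tangent space:
positively homogeneous, but not necessarily reversible. The ambient norm only serves to express
smoothness. -/
structure IsMinkowskiNorm (N : E → ℝ) : Prop where
  nonneg : ∀ y, 0 ≤ N y
  smooth : ContDiffOn ℝ ∞ N {0}ᶜ
  homogeneous : ∀ (y : E) (r : ℝ), 0 < r → N (r • y) = r * N y
  posDef : ∀ y u : E, y ≠ 0 → u ≠ 0 →
    0 < (1 / 2) * deriv (fun t : ℝ => deriv (fun s : ℝ => N (y + t • u + s • u) ^ 2) 0) 0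

/-- The Legendre transform `g_y(y, v)` of the vector `y` for the Minkowski norm `N`, evaluated at
`v`: the counterpart of `FinslerStructure.legendre` on a single vector space. -/
def minkowskiLegendre (N : E → ℝ) (y v : E) : ℝ :=
  (1 / 2) * deriv (fun s : ℝ => N (y + s • v) ^ 2) 0

theorem hasDerivAt_add_smul (y v : E) (s : ℝ) : HasDerivAt (fun s : ℝ => y + s • v) v s := by
  simpa using ((hasDerivAt_id s).smul_const v).const_add y

namespace IsMinkowskiNorm

variable {N : E → ℝ} (hN : IsMinkowskiNorm N)

include hN

theorem map_zero : N 0 = 0 := by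
  have := hN.homogeneous 0 2 two_pos
  rw [smul_zero] at this
  linarith

theorem map_smul_of_nonneg (y : E) {r : ℝ} (hr : 0 ≤ r) : N (r • y) = r * N y := by
  rcases hr.eq_or_lt with rfl | hr
  · rw [zero_smul, hN.map_zero, zero_mul]
  · exact hN.homogeneous y r hr

theorem norm_mul_map_normalize (v : E) : ‖v‖ * N (‖v‖⁻¹ • v) = N v := by
  rcases eq_or_ne v 0 with rfl | hv
  · rw [norm_zero, zero_mul, hN.map_zero]
  · rw [hN.homogeneous v _ (inv_pos.2 (norm_pos_iff.2 hv)),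
      mul_inv_cancel_left₀ (norm_ne_zero_iff.2 hv)]

theorem contDiffAt {y : E} (hy : y ≠ 0) : ContDiffAt ℝ ∞ N y :=
  hN.smooth.contDiffAt (isOpen_compl_singleton.mem_nhds hy)

theorem hasFDerivAt_sq {y : E} (hy : y ≠ 0) :
    HasFDerivAt (fun y => N y ^ 2) (fderiv ℝ (fun y => N y ^ 2) y) y :=
  (((hN.contDiffAt hy).pow 2).differentiableAt (by simp)).hasFDerivAt

theorem hasDerivAt_sq_add_smul {y : E} (hy : y ≠ 0) (v : E) :
    HasDerivAt (fun s : ℝ => N (y + s • v) ^ 2) (fderiv ℝ (fun y => N y ^ 2) y v) 0 :=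
  (hN.hasFDerivAt_sq hy).comp_hasDerivAt_of_eq 0 (hasDerivAt_add_smul y v 0) (by simp)

theorem legendre_eq_fderiv {y : E} (hy : y ≠ 0) (v : E) :
    minkowskiLegendre N y v = (1 / 2) * fderiv ℝ (fun y => N y ^ 2) y v :=
  congrArg _ (hN.hasDerivAt_sq_add_smul hy v).deriv

theorem legendre_smul_right {y : E} (hy : y ≠ 0) (r : ℝ) (v : E) :
    minkowskiLegendre N y (r • v) = r * minkowskiLegendre N y v := by
  rw [hN.legendre_eq_fderiv hy, hN.legendre_eq_fderiv hy, map_smul, smul_eq_mul]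
  ring

theorem legendre_smul_left {r : ℝ} (hr : 0 < r) (y v : E) :
    minkowskiLegendre N (r • y) v = r * minkowskiLegendre N y v := by
  have hscale : (fun s : ℝ => N (r • y + s • v) ^ 2) =
      fun s => r ^ 2 * (fun s : ℝ => N (y + s • v) ^ 2) (r⁻¹ * s) := by
    ext s
    have : r • y + s • v = r • (y + (r⁻¹ * s) • v) := by
      rw [smul_add, smul_smul, mul_inv_cancel_left₀ hr.ne']
    rw [this, hN.homogeneous _ _ hr]
    ring
  have hderiv := deriv_comp_mul_left r⁻¹ (fun s : ℝ => N (y + s • v) ^ 2) 0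
  rw [minkowskiLegendre, hscale, deriv_const_mul_field, hderiv, mul_zero, smul_eq_mul,
    minkowskiLegendre]
  field_simp

theorem eventually_sq_add_smul_self (y : E) :
    ∀ᶠ s : ℝ in 𝓝 0, N (y + s • y) ^ 2 = (1 + s) ^ 2 * N y ^ 2 := by
  filter_upwards [lt_mem_nhds (show (-1 : ℝ) < 0 by norm_num)] with s hs
  rw [show y + s • y = (1 + s) • y by module, hN.homogeneous y _ (by linarith), mul_pow]

theorem legendre_self (y : E) : minkowskiLegendre N y y = N y ^ 2 := by
  have h : HasDerivAt (fun s : ℝ => (1 + s) ^ 2 * N y ^ 2) (2 * N y ^ 2) 0 := by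
    simpa using (((hasDerivAt_id (0 : ℝ)).const_add 1).pow 2).mul_const (N y ^ 2)
  rw [minkowskiLegendre, EventuallyEq.deriv_eq (hN.eventually_sq_add_smul_self y), h.deriv]
  ring

theorem deriv_deriv_sq_add_smul_pos {y u : E} {s : ℝ} (hy : y + s • u ≠ 0) (hu : u ≠ 0) :
    0 < deriv (deriv fun s : ℝ => N (y + s • u) ^ 2) s := by
  have h := hN.posDef _ u hy hu
  have hshift : (fun t : ℝ => deriv (fun r : ℝ => N (y + s • u + t • u + r • u) ^ 2) 0) =
      fun t => deriv (fun r : ℝ => N (y + r • u) ^ 2) (s + t) := by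
    ext t
    rw [← add_zero (s + t), ← deriv_comp_const_add]
    simp only [add_smul, ← add_assoc]
  rw [hshift, deriv_comp_const_add, add_zero] at h
  linarith

theorem pos {y : E} (hy : y ≠ 0) : 0 < N y := by
  refine (hN.nonneg y).lt_of_ne fun h0 => ?_
  have hzero : (fun s : ℝ => N (y + s • y) ^ 2) =ᶠ[𝓝 0] fun _ => 0 := by
    filter_upwards [hN.eventually_sq_add_smul_self y] with s hs
    rw [hs, ← h0]
    ring
  have h := hN.deriv_deriv_sq_add_smul_pos (s := 0) (by simpa using hy) hy
  rw [hzero.deriv.deriv_eq] at h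
  simp at h

theorem ne_zero_of_map_eq_one {y : E} (hy : N y = 1) : y ≠ 0 := by
  rintro rfl
  exact zero_ne_one (hN.map_zero.symm.trans hy)

theorem two_mul_legendre_lt_of_segment {y v : E} (hvy : v ≠ y)
    (hseg : ∀ s ∈ Icc (0 : ℝ) 1, y + s • (v - y) ≠ 0) :
    2 * minkowskiLegendre N y v < N y ^ 2 + N v ^ 2 := by
  have hy : y ≠ 0 := by simpa using hseg 0 (by simp)
  have hconvex : StrictConvexOn ℝ (Icc 0 1) fun s : ℝ => N (y + s • (v - y)) ^ 2 := by
    refine strictConvexOn_of_deriv2_pos (convex_Icc 0 1) (fun s hs => ?_) fun s hs =>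
      hN.deriv_deriv_sq_add_smul_pos (hseg s (interior_subset hs)) (sub_ne_zero.2 hvy)
    exact ((hN.contDiffAt (hseg s hs)).continuousAt.comp (f := fun s : ℝ => y + s • (v - y))
      (by fun_prop)).pow 2 |>.continuousWithinAt
  have hslope := hconvex.lt_slope_of_hasDerivAt (by simp) (by simp) one_pos
    (hN.hasDerivAt_sq_add_smul hy (v - y))
  have hsub : fderiv ℝ (fun y => N y ^ 2) y (v - y) =
      2 * minkowskiLegendre N y v - 2 * N y ^ 2 := by
    rw [← hN.legendre_self, hN.legendre_eq_fderiv hy, hN.legendre_eq_fderiv hy, map_sub]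
    ring
  simp only [slope_def_field, one_smul, add_sub_cancel, zero_smul, add_zero, sub_zero, div_one,
    hsub] at hslope
  linarith

theorem two_mul_legendre_lt {y v : E} (hy : y ≠ 0) (hvy : v ≠ y) :
    2 * minkowskiLegendre N y v < N y ^ 2 + N v ^ 2 := by
  by_cases! hseg : ∀ s ∈ Icc (0 : ℝ) 1, y + s • (v - y) ≠ 0
  · exact hN.two_mul_legendre_lt_of_segment hvy hseg
  obtain ⟨s, ⟨hs0, hs1⟩, hs⟩ := hseg
  have hs_pos : 0 < s := hs0.lt_of_ne (by rintro rfl; exact hy (by simpa using hs))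
  have hv : v = -((1 - s) / s) • y := by
    have : s • v = -(1 - s) • y := by
      rw [← sub_eq_zero, ← hs]
      module
    rw [← inv_smul_smul₀ hs_pos.ne' v, this, smul_smul]
    congr 1
    field_simp
  have hneg : minkowskiLegendre N y v ≤ 0 := by
    rw [hv, hN.legendre_smul_right hy, hN.legendre_self, neg_mul, neg_nonpos]
    exact mul_nonneg (div_nonneg (by linarith) hs0) (sq_nonneg _)
  have := pow_pos (hN.pos hy) 2
  linarith [sq_nonneg (N v)]

theorem map_smul_le_abs_mul (v : E) (s : ℝ) : N (s • v) ≤ |s| * (N v + N (-v)) := by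
  rcases le_total 0 s with hs | hs
  · rw [hN.map_smul_of_nonneg v hs, abs_of_nonneg hs]
    exact mul_le_mul_of_nonneg_left (le_add_of_nonneg_right (hN.nonneg _)) hs
  · rw [← neg_smul_neg, hN.map_smul_of_nonneg _ (neg_nonneg.2 hs), abs_of_nonpos hs]
    exact mul_le_mul_of_nonneg_left (le_add_of_nonneg_left (hN.nonneg _)) (neg_nonneg.2 hs)

theorem legendre_zero_left (v : E) : minkowskiLegendre N 0 v = 0 := by
  have hquadratic : (fun s : ℝ => N ((0 : E) + s • v) ^ 2) =O[𝓝 0] fun s : ℝ => s ^ 2 := by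
    refine Asymptotics.IsBigO.of_bound ((N v + N (-v)) ^ 2) (Eventually.of_forall fun s => ?_)
    rw [zero_add, Real.norm_of_nonneg (sq_nonneg _), Real.norm_of_nonneg (sq_nonneg _),
      ← sq_abs s, mul_comm, ← mul_pow]
    exact pow_le_pow_left₀ (hN.nonneg _) (hN.map_smul_le_abs_mul v s) 2
  have hderiv : HasDerivAt (fun s : ℝ => N ((0 : E) + s • v) ^ 2) 0 0 := by
    rw [hasDerivAt_iff_isLittleO]
    simpa [hN.map_zero] using
      hquadratic.trans_isLittleO (Asymptotics.isLittleO_pow_id (𝕜 := ℝ) one_lt_two)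
  rw [minkowskiLegendre, hderiv.deriv, mul_zero]

/-- Fundamental inequality of Finsler geometry. -/
theorem legendre_le (y v : E) : minkowskiLegendre N y v ≤ N y * N v := by
  rcases eq_or_ne y 0 with rfl | hy
  · rw [hN.legendre_zero_left, hN.map_zero, zero_mul]
  rcases eq_or_ne v 0 with rfl | hv
  · rw [hN.legendre_eq_fderiv hy, (fderiv ℝ _ y).map_zero, hN.map_zero, mul_zero, mul_zero]
  have hNv := hN.pos hv
  -- rescale `v` to the length of `y`
  obtain ⟨r, hr, hrv⟩ : ∃ r > 0, r * N v = N y :=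
    ⟨N y / N v, div_pos (hN.pos hy) hNv, div_mul_cancel₀ _ hNv.ne'⟩
  have h : minkowskiLegendre N y (r • v) ≤ N y ^ 2 := by
    rcases eq_or_ne (r • v) y with heq | hne
    · rw [heq, hN.legendre_self]
    · have := hN.two_mul_legendre_lt hy hne
      rw [hN.homogeneous v r hr, hrv] at this
      linarith
  rw [hN.legendre_smul_right hy] at h
  refine le_of_mul_le_mul_left (h.trans_eq ?_) hr
  rw [sq, mul_left_comm, hrv]

theorem exists_supporting_functional (w : E) : ∃ ℓ : E →L[ℝ] ℝ, ℓ w = N w ∧ ∀ v, ℓ v ≤ N v := by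
  rcases eq_or_ne w 0 with rfl | hw
  · exact ⟨0, hN.map_zero.symm, hN.nonneg⟩
  have hpos := hN.pos hw
  refine ⟨(N w)⁻¹ • (1 / 2 : ℝ) • fderiv ℝ (fun y => N y ^ 2) w, ?_, fun v => ?_⟩
  · change (N w)⁻¹ * (1 / 2 * fderiv ℝ (fun y => N y ^ 2) w w) = N w
    rw [← hN.legendre_eq_fderiv hw, hN.legendre_self, sq, inv_mul_cancel_left₀ hpos.ne']
  · change (N w)⁻¹ * (1 / 2 * fderiv ℝ (fun y => N y ^ 2) w v) ≤ N v
    rw [← hN.legendre_eq_fderiv hw, inv_mul_le_iff₀ hpos]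
    exact hN.legendre_le w v

theorem eq_of_one_le_legendre {y v : E} (hy : N y = 1) (hv : N v ≤ 1)
    (h : 1 ≤ minkowskiLegendre N y v) : v = y := by
  by_contra hne
  have := hN.two_mul_legendre_lt (hN.ne_zero_of_map_eq_one hy) hne
  rw [hy] at this
  nlinarith [hN.nonneg v]

theorem legendre_injective : Function.Injective (minkowskiLegendre N) := by
  have hle : ∀ {y z : E}, minkowskiLegendre N y = minkowskiLegendre N z → N y ≤ N z := by
    intro y z h
    have hyz : N y ^ 2 ≤ N z * N y :=
      hN.legendre_self y ▸ congrFun h y ▸ hN.legendre_le z y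
    rcases (hN.nonneg y).eq_or_lt with h0 | hpos
    · exact h0 ▸ hN.nonneg z
    · nlinarith
  intro y z h
  by_contra hne
  have heq : N y = N z := le_antisymm (hle h) (hle h.symm)
  have hy : y ≠ 0 := by
    rintro rfl
    exact (hN.pos (Ne.symm hne)).ne' (by rw [← heq, hN.map_zero])
  have hlt := hN.two_mul_legendre_lt hy (Ne.symm hne)
  rw [h, hN.legendre_self, heq] at hlt
  linarith

theorem legendre_eq_zero_of_forall_le {y v : E} (h : ∀ s : ℝ, N y ≤ N (y + s • v)) :
    minkowskiLegendre N y v = 0 := by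
  have hmin : IsLocalMin (fun s : ℝ => N (y + s • v) ^ 2) 0 := Eventually.of_forall fun s => by
    simpa only [zero_smul, add_zero] using pow_le_pow_left₀ (hN.nonneg y) (h s) 2
  rw [minkowskiLegendre, hmin.deriv_eq_zero, mul_zero]

end IsMinkowskiNorm

/-- A family of Minkowski norms on `E` depending smoothly on a base point in the open set `V`: a
Finsler structure in a chart. -/
structure IsMinkowskiFamily (N : E → E → ℝ) (V : Set E) : Prop where
  isOpen : IsOpen V
  norm : ∀ x ∈ V, IsMinkowskiNorm (N x)
  smooth : ContDiffOn ℝ ∞ (fun z : E × E => N z.1 z.2) (V ×ˢ {0}ᶜ)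

theorem IsMinkowskiNorm.isMinkowskiFamily_const {N : E → ℝ} (hN : IsMinkowskiNorm N) :
    IsMinkowskiFamily (fun _ => N) univ :=
  ⟨isOpen_univ, fun _ _ => hN, hN.smooth.comp contDiffOn_snd fun _ hz => hz.2⟩

namespace IsMinkowskiFamily

variable {N : E → E → ℝ} {V : Set E} (h : IsMinkowskiFamily N V)

include h

theorem mono {V' : Set E} (hV : V' ⊆ V) (ho : IsOpen V') : IsMinkowskiFamily N V' :=
  ⟨ho, fun x hx => h.norm x (hV hx), h.smooth.mono (prod_mono hV subset_rfl)⟩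

theorem continuousOn_prod_sphere {K : Set E} (hKV : K ⊆ V) :
    ContinuousOn (fun z : E × E => N z.1 z.2) (K ×ˢ Metric.sphere 0 1) :=
  h.smooth.continuousOn.mono (prod_mono hKV fun _ hv => Metric.ne_of_mem_sphere hv one_ne_zero)

variable [FiniteDimensional ℝ E]

theorem exists_bounds {K : Set E} (hK : IsCompact K) (hKV : K ⊆ V) :
    ∃ m > 0, ∃ C > 0, ∀ x ∈ K, ∀ v, m * ‖v‖ ≤ N x v ∧ N x v ≤ C * ‖v‖ := by
  have hc := h.continuousOn_prod_sphere hKV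
  have hKS : IsCompact (K ×ˢ Metric.sphere (0 : E) 1) := hK.prod (isCompact_sphere 0 1)
  obtain ⟨m, hm, hmN⟩ := hKS.exists_forall_le' hc fun z hz =>
    (h.norm z.1 (hKV hz.1)).pos (Metric.ne_of_mem_sphere hz.2 one_ne_zero)
  obtain ⟨C, hC⟩ := hKS.exists_bound_of_continuousOn hc
  refine ⟨m, hm, max C 1, by positivity, fun x hx v => ?_⟩
  rcases eq_or_ne v 0 with rfl | hv
  · simp [(h.norm x (hKV hx)).map_zero]
  have hz : (x, ‖v‖⁻¹ • v) ∈ K ×ˢ Metric.sphere (0 : E) 1 :=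
    ⟨hx, by simpa using norm_smul_inv_norm (𝕜 := ℝ) hv⟩
  rw [← (h.norm x (hKV hx)).norm_mul_map_normalize v, mul_comm m, mul_comm (max C 1)]
  exact ⟨mul_le_mul_of_nonneg_left (hmN _ hz) (norm_nonneg v), mul_le_mul_of_nonneg_left
    ((le_abs_self _).trans ((hC _ hz).trans (le_max_left _ _))) (norm_nonneg v)⟩

theorem exists_closedBall_abs_sub_le {x₀ : E} (hx₀ : x₀ ∈ V) {η : ℝ} (hη : 0 < η) :
    ∃ r > 0, Metric.closedBall x₀ r ⊆ V ∧
      ∀ x ∈ Metric.closedBall x₀ r, ∀ v, |N x v - N x₀ v| ≤ η * ‖v‖ := by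
  obtain ⟨r, hr, hrV⟩ := Metric.nhds_basis_closedBall.mem_iff.1 (h.isOpen.mem_nhds hx₀)
  have huniform := ((isCompact_closedBall x₀ r).prod
    (isCompact_sphere (0 : E) 1)).uniformContinuousOn_of_continuous (h.continuousOn_prod_sphere hrV)
  obtain ⟨δ, hδ, huniform⟩ := Metric.uniformContinuousOn_iff.1 huniform η hη
  have hball : Metric.closedBall x₀ (min r (δ / 2)) ⊆ Metric.closedBall x₀ r :=
    Metric.closedBall_subset_closedBall (min_le_left _ _)
  refine ⟨min r (δ / 2), by positivity, hball.trans hrV, fun x hx v => ?_⟩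
  rw [← (h.norm x (hrV (hball hx))).norm_mul_map_normalize v,
    ← (h.norm x₀ hx₀).norm_mul_map_normalize v, ← mul_sub, abs_mul, abs_norm, mul_comm]
  rcases eq_or_ne v 0 with rfl | hv
  · simp
  have hsphere : ‖v‖⁻¹ • v ∈ Metric.sphere (0 : E) 1 := by
    simpa using norm_smul_inv_norm (𝕜 := ℝ) hv
  refine mul_le_mul_of_nonneg_right (huniform (x, _) ⟨hball hx, hsphere⟩ (x₀, _)
    ⟨Metric.mem_closedBall_self hr.le, hsphere⟩ ?_).le (norm_nonneg v)
  have hxx₀ : dist x x₀ ≤ δ / 2 := (Metric.mem_closedBall.1 hx).trans (min_le_right _ _)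
  simp only [Prod.dist_eq, dist_self, max_lt_iff, hδ, and_true]
  linarith

end IsMinkowskiFamily

namespace IsMinkowskiNorm

variable [FiniteDimensional ℝ E] {N : E → ℝ} (hN : IsMinkowskiNorm N)

include hN

theorem exists_bounds : ∃ m > 0, ∃ C > 0, ∀ v, m * ‖v‖ ≤ N v ∧ N v ≤ C * ‖v‖ := by
  simpa using hN.isMinkowskiFamily_const.exists_bounds isCompact_singleton (subset_univ {(0 : E)})

theorem continuous : Continuous N := by
  refine continuous_iff_continuousAt.2 fun v => ?_
  rcases eq_or_ne v 0 with rfl | hv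
  · obtain ⟨_, _, C, _, hC⟩ := hN.exists_bounds
    rw [ContinuousAt, hN.map_zero]
    refine squeeze_zero hN.nonneg (fun v => (hC v).2) ?_
    simpa using (tendsto_norm_zero (E := E)).const_mul C
  · exact (hN.contDiffAt hv).continuousAt

end IsMinkowskiNorm

end Minkowski

/-! ### Tangent vectors in coordinates -/

namespace Finsler

open Bundle

variable {n : ℕ} {M : Type*} [TopologicalSpace M]
  [ChartedSpace (EuclideanSpace ℝ (Fin n)) M] [IsManifold (𝓡 n) ∞ M] {p q : M}

/-- The differential `df_x(v)` of a real function, as a real number. -/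
def differential (f : M → ℝ) (x : M) (v : TangentSpace (𝓡 n) x) : ℝ :=
  mfderiv (𝓡 n) 𝓘(ℝ, ℝ) f x v

/-- The coordinates of a tangent vector in the chart at `p`. They are read off the trivialization
of the tangent bundle, and are meaningful only over the domain of that chart. -/
def vecCoord (p : M) (w : TangentBundle (𝓡 n) M) : EuclideanSpace ℝ (Fin n) :=
  (trivializationAt (EuclideanSpace ℝ (Fin n)) (TangentSpace (𝓡 n)) p w).2

theorem mem_baseSet (hq : q ∈ (extChartAt (𝓡 n) p).source) :
    q ∈ (trivializationAt (EuclideanSpace ℝ (Fin n)) (TangentSpace (𝓡 n)) p).baseSet := by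
  rwa [TangentBundle.trivializationAt_baseSet, ← extChartAt_source (𝓡 n)]

/-- `vecCoord` on the tangent space at a single point `q`, as a linear equivalence. -/
def coordEquiv (hq : q ∈ (extChartAt (𝓡 n) p).source) :
    TangentSpace (𝓡 n) q ≃L[ℝ] EuclideanSpace ℝ (Fin n) :=
  (trivializationAt (EuclideanSpace ℝ (Fin n)) (TangentSpace (𝓡 n)) p).continuousLinearEquivAt ℝ q
    (mem_baseSet hq)

theorem vecCoord_eq_coordEquiv (hq : q ∈ (extChartAt (𝓡 n) p).source)
    (u : TangentSpace (𝓡 n) q) : vecCoord p ⟨q, u⟩ = coordEquiv hq u := rfl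

theorem vecCoord_eq_mfderiv (hq : q ∈ (extChartAt (𝓡 n) p).source) (u : TangentSpace (𝓡 n) q) :
    vecCoord p ⟨q, u⟩ =
      mfderiv (𝓡 n) 𝓘(ℝ, EuclideanSpace ℝ (Fin n)) (extChartAt (𝓡 n) p) q u := by
  have hchart := TangentBundle.continuousLinearMapAt_trivializationAt (I := 𝓡 n) (x₀ := p) (x := q)
    (by rwa [← extChartAt_source (𝓡 n)])
  refine Eq.trans ?_ (DFunLike.congr_fun hchart u)
  rw [Trivialization.continuousLinearMapAt_apply,
    Trivialization.coe_linearMapAt_of_mem _ (mem_baseSet hq)]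
  rfl

theorem mdifferentiableAt_chart (hq : q ∈ (extChartAt (𝓡 n) p).source) :
    MDifferentiableAt (𝓡 n) 𝓘(ℝ, EuclideanSpace ℝ (Fin n)) (extChartAt (𝓡 n) p) q :=
  mdifferentiableAt_extChartAt (by rwa [← extChartAt_source (𝓡 n)])

theorem mdifferentiableAt_chart_symm (hq : q ∈ (extChartAt (𝓡 n) p).source) :
    MDifferentiableAt 𝓘(ℝ, EuclideanSpace ℝ (Fin n)) (𝓡 n) (extChartAt (𝓡 n) p).symm
      (extChartAt (𝓡 n) p q) := by
  have := mdifferentiableWithinAt_extChartAt_symm (I := 𝓡 n) ((extChartAt (𝓡 n) p).map_source hq)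
  rwa [ModelWithCorners.range_eq_univ, mdifferentiableWithinAt_univ] at this

theorem vecCoord_velocity {γ : ℝ → M} {t : ℝ} (hp : γ t ∈ (extChartAt (𝓡 n) p).source)
    (hγ : MDifferentiableAt 𝓘(ℝ, ℝ) (𝓡 n) γ t) :
    vecCoord p (velocity γ t : TangentBundle (𝓡 n) M) =
      deriv (fun s => extChartAt (𝓡 n) p (γ s)) t := by
  have hchain := mfderiv_comp t (mdifferentiableAt_chart hp) hγ
  rw [mfderiv_eq_fderiv] at hchain
  rw [velocity, vecCoord_eq_mfderiv hp]
  exact (DFunLike.congr_fun hchain (1 : ℝ)).symm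

theorem vecCoord_derivOn {γ : ℝ → M} {T t : ℝ} (hp : γ t ∈ (extChartAt (𝓡 n) p).source)
    (hT : 0 < T) (ht : t ∈ Icc 0 T)
    (hγ : MDifferentiableWithinAt 𝓘(ℝ, ℝ) (𝓡 n) γ (Icc 0 T) t) :
    vecCoord p (⟨γ t, derivOn γ T t⟩ : TangentBundle (𝓡 n) M) =
      derivWithin (fun s => extChartAt (𝓡 n) p (γ s)) (Icc 0 T) t := by
  have hchain := mfderiv_comp_mfderivWithin t (mdifferentiableAt_chart hp) hγ
    ((uniqueDiffOn_Icc hT).uniqueMDiffOn t ht)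
  rw [mfderivWithin_eq_fderivWithin] at hchain
  rw [vecCoord_eq_mfderiv hp]
  exact (DFunLike.congr_fun hchain (1 : ℝ)).symm

theorem differential_eq_fderiv_chart {f : M → ℝ} (hq : q ∈ (extChartAt (𝓡 n) p).source)
    (hf : MDifferentiableAt (𝓡 n) 𝓘(ℝ, ℝ) f q) (u : TangentSpace (𝓡 n) q) :
    differential f q u =
      fderiv ℝ (fun x => f ((extChartAt (𝓡 n) p).symm x)) (extChartAt (𝓡 n) p q)
        (vecCoord p ⟨q, u⟩) := by
  rw [vecCoord_eq_mfderiv hq]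
  have hf_symm : MDifferentiableAt 𝓘(ℝ, EuclideanSpace ℝ (Fin n)) 𝓘(ℝ, ℝ)
      (f ∘ (extChartAt (𝓡 n) p).symm) (extChartAt (𝓡 n) p q) :=
    MDifferentiableAt.comp _ (by rwa [(extChartAt (𝓡 n) p).left_inv hq])
      (mdifferentiableAt_chart_symm hq)
  have hchain := mfderiv_comp q hf_symm (mdifferentiableAt_chart hq)
  have hlocal : (f ∘ (extChartAt (𝓡 n) p).symm) ∘ extChartAt (𝓡 n) p =ᶠ[𝓝 q] f := by
    filter_upwards [(isOpen_extChartAt_source (I := 𝓡 n) p).mem_nhds hq] with x hx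
    rw [Function.comp_apply, Function.comp_apply, (extChartAt (𝓡 n) p).left_inv hx]
  rw [hlocal.mfderiv_eq, mfderiv_eq_fderiv] at hchain
  exact DFunLike.congr_fun hchain u

end Finsler

namespace FinslerStructure

open Bundle

variable {n : ℕ} {M : Type*} [TopologicalSpace M]
  [ChartedSpace (EuclideanSpace ℝ (Fin n)) M] [IsManifold (𝓡 n) ∞ M]
  (F : FinslerStructure n M) {p q : M}

/-- The Finsler structure in the coordinates of the chart at `p`, as a function of the base point
`x` and the vector `v`. -/
def locNorm (p : M) (x v : EuclideanSpace ℝ (Fin n)) : ℝ :=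
  F.toFun ((trivializationAt (EuclideanSpace ℝ (Fin n)) (TangentSpace (𝓡 n))
    p).toOpenPartialHomeomorph.symm ((extChartAt (𝓡 n) p).symm x, v))

theorem trivializationAt_symm_eq (hq : q ∈ (extChartAt (𝓡 n) p).source)
    (v : EuclideanSpace ℝ (Fin n)) :
    (trivializationAt (EuclideanSpace ℝ (Fin n)) (TangentSpace (𝓡 n))
      p).toOpenPartialHomeomorph.symm (q, v) =
      (⟨q, (coordEquiv hq).symm v⟩ : TangentBundle (𝓡 n) M) :=
  Trivialization.symm_apply_eq_mk_continuousLinearEquivAt_symm _ _ (mem_baseSet hq) _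

theorem locNorm_eq_coordEquiv (hq : q ∈ (extChartAt (𝓡 n) p).source)
    (v : EuclideanSpace ℝ (Fin n)) :
    F.locNorm p (extChartAt (𝓡 n) p q) v = F.toFun ⟨q, (coordEquiv hq).symm v⟩ := by
  rw [locNorm, (extChartAt (𝓡 n) p).left_inv hq, trivializationAt_symm_eq hq]

theorem locNorm_vecCoord (hq : q ∈ (extChartAt (𝓡 n) p).source) (u : TangentSpace (𝓡 n) q) :
    F.locNorm p (extChartAt (𝓡 n) p q) (vecCoord p ⟨q, u⟩) = F.toFun ⟨q, u⟩ := by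
  rw [F.locNorm_eq_coordEquiv hq, vecCoord_eq_coordEquiv hq,
    ContinuousLinearEquiv.symm_apply_apply]

theorem toFun_velocity {γ : ℝ → M} {t : ℝ} (hp : γ t ∈ (extChartAt (𝓡 n) p).source)
    (hγ : MDifferentiableAt 𝓘(ℝ, ℝ) (𝓡 n) γ t) :
    F.toFun (velocity γ t) = F.locNorm p (extChartAt (𝓡 n) p (γ t))
      (deriv (fun s => extChartAt (𝓡 n) p (γ s)) t) := by
  rw [← vecCoord_velocity hp hγ]
  exact (F.locNorm_vecCoord hp _).symm

theorem legendre_eq_minkowskiLegendre (hq : q ∈ (extChartAt (𝓡 n) p).source)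
    (y v : TangentSpace (𝓡 n) q) :
    F.legendre q y v = minkowskiLegendre (F.locNorm p (extChartAt (𝓡 n) p q))
      (vecCoord p ⟨q, y⟩) (vecCoord p ⟨q, v⟩) := by
  simp only [legendre, minkowskiLegendre, ← F.locNorm_vecCoord hq, vecCoord_eq_coordEquiv hq,
    map_add, map_smul]

theorem contDiffOn_locNorm (p : M) :
    ContDiffOn ℝ ∞ (fun z : EuclideanSpace ℝ (Fin n) × EuclideanSpace ℝ (Fin n) =>
      F.locNorm p z.1 z.2) ((extChartAt (𝓡 n) p).target ×ˢ {0}ᶜ) := by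
  let e := trivializationAt (EuclideanSpace ℝ (Fin n)) (TangentSpace (𝓡 n)) p
  have hpoint := (contMDiffOn_extChartAt_symm (I := 𝓡 n) (n := ∞) p).prodMap
    (contMDiffOn_id (s := ({0}ᶜ : Set (EuclideanSpace ℝ (Fin n))))
      (I := 𝓘(ℝ, EuclideanSpace ℝ (Fin n))))
  rw [← modelWithCornersSelf_prod] at hpoint
  have hvector := (e.contMDiffOn_symm (IB := 𝓡 n) (n := ∞)).comp hpoint fun z hz =>
    e.mem_target.2 (mem_baseSet ((extChartAt (𝓡 n) p).map_target hz.1))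
  have hnorm := F.smooth.comp hvector fun z hz => by
    change (e.toOpenPartialHomeomorph.symm ((extChartAt (𝓡 n) p).symm z.1, z.2)).2 ≠ 0
    rw [trivializationAt_symm_eq ((extChartAt (𝓡 n) p).map_target hz.1)]
    exact EmbeddingLike.map_ne_zero_iff.2 hz.2
  rw [chartedSpaceSelf_prod] at hnorm
  exact hnorm.contDiffOn

theorem isMinkowskiNorm_locNorm (hq : q ∈ (extChartAt (𝓡 n) p).source) :
    IsMinkowskiNorm (F.locNorm p (extChartAt (𝓡 n) p q)) where
  nonneg _ := F.nonneg _
  smooth := (F.contDiffOn_locNorm p).comp (f := fun v => (extChartAt (𝓡 n) p q, v)) (by fun_prop)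
    fun _ hv => ⟨(extChartAt (𝓡 n) p).map_source hq, hv⟩
  homogeneous y r hr := by
    rw [F.locNorm_eq_coordEquiv hq, F.locNorm_eq_coordEquiv hq, map_smul, F.homogeneous _ _ _ hr]
  posDef y u hy hu := by
    simp only [F.locNorm_eq_coordEquiv hq, map_add, map_smul]
    exact F.posDef q _ _ (EmbeddingLike.map_ne_zero_iff.2 hy)
      (EmbeddingLike.map_ne_zero_iff.2 hu)

theorem isMinkowskiFamily_locNorm (p : M) :
    IsMinkowskiFamily (F.locNorm p) (extChartAt (𝓡 n) p).target where
  isOpen := isOpen_extChartAt_target p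
  norm x hx := by
    rw [← (extChartAt (𝓡 n) p).right_inv hx]
    exact F.isMinkowskiNorm_locNorm ((extChartAt (𝓡 n) p).map_target hx)
  smooth := F.contDiffOn_locNorm p

end FinslerStructure

/-! ### Length and distance -/

namespace Finsler

variable {n : ℕ} {M : Type*} [TopologicalSpace M]
  [ChartedSpace (EuclideanSpace ℝ (Fin n)) M]

namespace PiecewiseSmooth

variable {γ γ' : ℝ → M} {s t : ℝ}

theorem le (h : PiecewiseSmooth n γ s t) : s ≤ t := by
  induction h with
  | smooth hst _ => exact hst
  | concat _ _ h₁ h₂ => exact h₁.trans h₂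

theorem continuousOn (h : PiecewiseSmooth n γ s t) : ContinuousOn γ (Icc s t) := by
  induction h with
  | smooth _ h => exact h.continuousOn
  | concat h₁ h₂ cont₁ cont₂ =>
    rw [← Icc_union_Icc_eq_Icc h₁.le h₂.le]
    exact cont₁.union_of_isClosed cont₂ isClosed_Icc isClosed_Icc

theorem restrict (h : PiecewiseSmooth n γ s t) {s' t' : ℝ} (hs : s ≤ s') (hst : s' ≤ t')
    (ht : t' ≤ t) : PiecewiseSmooth n γ s' t' := by
  induction h generalizing s' t' with
  | smooth _ h => exact smooth hst (h.mono (Icc_subset_Icc hs ht))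
  | @concat s m u _ _ restrict₁ restrict₂ =>
    rcases le_total t' m with ht' | ht'
    · exact restrict₁ hs hst ht'
    rcases le_total m s' with hs' | hs'
    · exact restrict₂ hs' hst ht
    · exact concat (restrict₁ hs hs' le_rfl) (restrict₂ le_rfl ht' ht)

theorem congr (h : PiecewiseSmooth n γ s t) (he : EqOn γ' γ (Icc s t)) :
    PiecewiseSmooth n γ' s t := by
  induction h with
  | smooth hst h => exact smooth hst (h.congr he)
  | concat h₁ h₂ congr₁ congr₂ =>
    exact concat (congr₁ (he.mono (Icc_subset_Icc le_rfl h₂.le)))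
      (congr₂ (he.mono (Icc_subset_Icc h₁.le le_rfl)))

theorem comp_add (h : PiecewiseSmooth n γ s t) (c : ℝ) :
    PiecewiseSmooth n (fun u => γ (u + c)) (s - c) (t - c) := by
  induction h with
  | @smooth s t hst h =>
    refine smooth (by linarith) ?_
    have htrans : ContMDiff 𝓘(ℝ, ℝ) 𝓘(ℝ, ℝ) ∞ fun u : ℝ => u + c :=
      contMDiff_iff_contDiff.2 (by fun_prop)
    exact h.comp htrans.contMDiffOn fun u hu => ⟨by linarith [hu.1], by linarith [hu.2]⟩
  | concat _ _ comp₁ comp₂ => exact concat comp₁ comp₂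

theorem ae_mdifferentiableAt (h : PiecewiseSmooth n γ s t) :
    ∀ᵐ u, u ∈ Icc s t → MDifferentiableAt 𝓘(ℝ, ℝ) (𝓡 n) γ u := by
  induction h with
  | @smooth s t _ h =>
    filter_upwards [volume.ae_ne s, volume.ae_ne t] with u hs ht hu
    exact (h.contMDiffAt (Icc_mem_nhds (lt_of_le_of_ne hu.1 hs.symm)
      (lt_of_le_of_ne hu.2 ht))).mdifferentiableAt (by simp)
  | @concat s m u _ _ diff₁ diff₂ =>
    filter_upwards [diff₁, diff₂] with x hx₁ hx₂ hx
    rcases le_total x m with hxm | hxm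
    · exact hx₁ ⟨hx.1, hxm⟩
    · exact hx₂ ⟨hxm, hx.2⟩

end PiecewiseSmooth

theorem velocity_congr {γ γ' : ℝ → M} {t : ℝ} (h : γ =ᶠ[𝓝 t] γ') :
    (velocity γ t : TangentBundle (𝓡 n) M) = velocity γ' t := by
  have hderiv := h.mfderiv_eq (I := 𝓘(ℝ, ℝ)) (I' := 𝓡 n)
  exact Bundle.TotalSpace.ext h.eq_of_nhds (heq_of_eq (DFunLike.congr_fun hderiv (1 : ℝ)))

theorem velocity_comp_add {γ : ℝ → M} {t c : ℝ}
    (h : MDifferentiableAt 𝓘(ℝ, ℝ) (𝓡 n) γ (t + c)) :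
    (velocity (fun u => γ (u + c)) t : TangentBundle (𝓡 n) M) = velocity γ (t + c) := by
  have htrans : HasMFDerivAt 𝓘(ℝ, ℝ) 𝓘(ℝ, ℝ) (fun u : ℝ => u + c) t
      (ContinuousLinearMap.id ℝ ℝ) :=
    ((hasFDerivAt_id t).add_const c).hasMFDerivAt
  have hderiv := (HasMFDerivAt.comp t h.hasMFDerivAt htrans).mfderiv
  exact Bundle.TotalSpace.ext rfl (heq_of_eq (DFunLike.congr_fun hderiv (1 : ℝ)))

end Finsler

namespace FinslerStructure

variable {n : ℕ} {M : Type*} [TopologicalSpace M]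
  [ChartedSpace (EuclideanSpace ℝ (Fin n)) M] [IsManifold (𝓡 n) ∞ M]
  (F : FinslerStructure n M)

theorem length_eq_Ioo (γ : ℝ → M) (s t : ℝ) :
    F.length γ s t = ∫⁻ u in Ioo s t, ENNReal.ofReal (F.toFun (velocity γ u)) :=
  setLIntegral_congr Ioo_ae_eq_Icc.symm

theorem length_congr {γ γ' : ℝ → M} {s t : ℝ} (h : EqOn γ γ' (Icc s t)) :
    F.length γ s t = F.length γ' s t := by
  rw [length_eq_Ioo, length_eq_Ioo]
  refine setLIntegral_congr_fun measurableSet_Ioo fun u hu => ?_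
  simp only [velocity_congr (h.eventuallyEq_of_mem (Icc_mem_nhds hu.1 hu.2))]

theorem length_add (γ : ℝ → M) {s t u : ℝ} (h₁ : s ≤ t) (h₂ : t ≤ u) :
    F.length γ s t + F.length γ t u = F.length γ s u := by
  have hdisj : Disjoint (Ico s t) (Icc t u) :=
    disjoint_left.2 fun _ hx hx' => (hx.2.trans_le hx'.1).false
  rw [length_eq_Ioo F γ s t, setLIntegral_congr Ioo_ae_eq_Ico, length, length,
    ← Ico_union_Icc_eq_Icc h₁ h₂, lintegral_union measurableSet_Icc hdisj]

theorem length_comp_add {γ : ℝ → M} {s t : ℝ} (h : PiecewiseSmooth n γ s t) (c : ℝ) :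
    F.length (fun u => γ (u + c)) (s - c) (t - c) = F.length γ s t := by
  have hshift := measurePreserving_add_right (volume : Measure ℝ) c
  have hcov := hshift.setLIntegral_comp_preimage_emb
    (MeasurableEquiv.addRight c).measurableEmbedding
    (fun u => ENNReal.ofReal (F.toFun (velocity γ u : TangentBundle (𝓡 n) M))) (Icc s t)
  rw [length, length, ← hcov, preimage_add_const_Icc]
  refine setLIntegral_congr_fun_ae measurableSet_Icc ?_
  filter_upwards [hshift.quasiMeasurePreserving.ae h.ae_mdifferentiableAt] with u hu hu'
  rw [velocity_comp_add (hu ⟨by linarith [hu'.1], by linarith [hu'.2]⟩)]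

theorem length_eq_of_unitSpeed {γ : ℝ → M} {T s t : ℝ} (h : PiecewiseSmooth n γ 0 T)
    (hF : ∀ t ∈ Ioo 0 T, MDifferentiableAt 𝓘(ℝ, ℝ) (𝓡 n) γ t → F.toFun (velocity γ t) = 1)
    (hs : 0 ≤ s) (ht : t ≤ T) : F.length γ s t = ENNReal.ofReal (t - s) := by
  have hone : ∫⁻ u in Ioo s t, ENNReal.ofReal (F.toFun (velocity γ u)) = ∫⁻ _ in Ioo s t, 1 := by
    refine setLIntegral_congr_fun_ae measurableSet_Ioo ?_
    filter_upwards [h.ae_mdifferentiableAt] with u hu hu'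
    have hmem : u ∈ Ioo 0 T := ⟨hs.trans_lt hu'.1, hu'.2.trans_le ht⟩
    rw [hF u hmem (hu (Ioo_subset_Icc_self hmem)), ENNReal.ofReal_one]
  rw [length_eq_Ioo, hone, setLIntegral_one, Real.volume_Ioo]

theorem dist_le_length {γ : ℝ → M} {s t : ℝ} (h : PiecewiseSmooth n γ s t) :
    F.dist (γ s) (γ t) ≤ F.length γ s t :=
  iInf_le_of_le γ <| iInf₂_le_of_le s t <| iInf_le_of_le h <| iInf_le_of_le rfl <| iInf_le _ rfl

theorem exists_length_lt {p q : M} {r : ℝ≥0∞} (h : F.dist p q < r) :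
    ∃ (γ : ℝ → M) (s t : ℝ), PiecewiseSmooth n γ s t ∧ γ s = p ∧ γ t = q ∧
      F.length γ s t < r := by
  simpa only [dist, iInf_lt_iff, exists_prop] using h

theorem le_dist {p q : M} {r : ℝ≥0∞} (h : ∀ (γ : ℝ → M) (s t : ℝ), PiecewiseSmooth n γ s t →
    γ s = p → γ t = q → r ≤ F.length γ s t) : r ≤ F.dist p q := by
  simpa only [dist, le_iInf_iff] using h

theorem dist_self (p : M) : F.dist p p = 0 := by
  have hconst : PiecewiseSmooth n (fun _ : ℝ => p) 0 0 := .smooth le_rfl contMDiffOn_const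
  have hle := F.dist_le_length hconst
  rwa [length_eq_Ioo, Ioo_self, setLIntegral_empty, nonpos_iff_eq_zero] at hle

theorem dist_le_length_add_length {γ₁ γ₂ : ℝ → M} {s₁ t₁ s₂ t₂ : ℝ}
    (h₁ : PiecewiseSmooth n γ₁ s₁ t₁) (h₂ : PiecewiseSmooth n γ₂ s₂ t₂) (h : γ₁ t₁ = γ₂ s₂) :
    F.dist (γ₁ s₁) (γ₂ t₂) ≤ F.length γ₁ s₁ t₁ + F.length γ₂ s₂ t₂ := by
  let c := s₂ - t₁
  let γ : ℝ → M := fun u => if u ≤ t₁ then γ₁ u else γ₂ (u + c)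
  have hc : s₂ - c = t₁ := sub_sub_cancel s₂ t₁
  have hshift : PiecewiseSmooth n (fun u => γ₂ (u + c)) t₁ (t₂ - c) := hc ▸ h₂.comp_add c
  have hlength : F.length (fun u => γ₂ (u + c)) t₁ (t₂ - c) = F.length γ₂ s₂ t₂ :=
    hc ▸ F.length_comp_add h₂ c
  have eq₁ : EqOn γ γ₁ (Icc s₁ t₁) := fun u hu => if_pos hu.2
  have eq₂ : EqOn γ (fun u => γ₂ (u + c)) (Icc t₁ (t₂ - c)) := by
    intro u hu
    rcases hu.1.eq_or_lt with rfl | hlt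
    · simp only [γ, le_refl, if_true, h, c, add_sub_cancel]
    · exact if_neg (not_le.2 hlt)
  have hdist := F.dist_le_length (.concat (h₁.congr eq₁) (hshift.congr eq₂))
  have hend : γ (t₂ - c) = γ₂ t₂ := by
    rw [eq₂ (right_mem_Icc.2 hshift.le)]
    exact congrArg γ₂ (sub_add_cancel t₂ c)
  rwa [← F.length_add γ h₁.le hshift.le, F.length_congr eq₁, F.length_congr eq₂, hlength,
    eq₁ (left_mem_Icc.2 h₁.le), hend] at hdist

theorem dist_triangle (p q r : M) : F.dist p r ≤ F.dist p q + F.dist q r := by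
  rw [dist.eq_def F p q, dist.eq_def F q r]
  simp only [ENNReal.iInf_add, ENNReal.add_iInf, le_iInf_iff]
  rintro γ₂ s₂ t₂ h₂ h rfl γ₁ s₁ t₁ h₁ rfl rfl
  exact F.dist_le_length_add_length h₁ h₂ h.symm

end FinslerStructure

namespace Finsler

theorem exists_exit_time {X : Type*} [TopologicalSpace X] {γ : ℝ → X} {s t : ℝ}
    (hγ : ContinuousOn γ (Icc s t)) {O K : Set X} (hO : IsOpen O) (hK : IsClosed K) (hOK : O ⊆ K)
    (hs : γ s ∈ O) (hu : ∃ u ∈ Icc s t, γ u ∉ O) :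
    ∃ t' ∈ Icc s t, γ t' ∉ O ∧ MapsTo γ (Icc s t') K := by
  have hcompact : IsCompact (Icc s t ∩ γ ⁻¹' Oᶜ) :=
    isCompact_Icc.of_isClosed_subset
      (hγ.preimage_isClosed_of_isClosed isClosed_Icc hO.isClosed_compl) inter_subset_left
  obtain ⟨t', ⟨ht', hexit⟩, hleast⟩ := hcompact.exists_isLeast hu
  have hst' : s < t' := lt_of_le_of_ne ht'.1 (by rintro rfl; exact hexit hs)
  have hbefore : MapsTo γ (Ico s t') K := fun u hu => hOK <| by
    by_contra h
    exact (hleast ⟨⟨hu.1, hu.2.le.trans ht'.2⟩, h⟩).not_gt hu.2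
  have hclosure := hbefore.closure_of_continuousOn (by
    rw [closure_Ico hst'.ne]
    exact hγ.mono (Icc_subset_Icc_right ht'.2))
  rw [closure_Ico hst'.ne, hK.closure_eq] at hclosure
  exact ⟨t', ht', hexit, hclosure⟩

theorem exists_entrance_time {X : Type*} [TopologicalSpace X] {γ : ℝ → X} {s t : ℝ}
    (hγ : ContinuousOn γ (Icc s t)) {O K : Set X} (hO : IsOpen O) (hK : IsClosed K) (hOK : O ⊆ K)
    (ht : γ t ∈ O) (hu : ∃ u ∈ Icc s t, γ u ∉ O) :
    ∃ s' ∈ Icc s t, γ s' ∉ O ∧ MapsTo γ (Icc s' t) K := by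
  have hneg : MapsTo Neg.neg (Icc (-t) (-s)) (Icc s t) := fun u hu =>
    ⟨le_neg_of_le_neg hu.2, neg_le_of_neg_le hu.1⟩
  obtain ⟨u, hu, huO⟩ := hu
  obtain ⟨t', ht', hexit, hmaps⟩ := exists_exit_time (γ := γ ∘ Neg.neg)
    (hγ.comp continuous_neg.continuousOn hneg) hO hK hOK (by simpa using ht)
    ⟨-u, ⟨neg_le_neg hu.2, neg_le_neg hu.1⟩, by simpa using huO⟩
  refine ⟨-t', hneg ht', hexit, fun x hx => ?_⟩
  simpa using hmaps (x := -x) ⟨neg_le_neg hx.2, neg_le.1 hx.1⟩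

end Finsler

/-! ### Comparing the distance with the norm of a chart -/

namespace Finsler

theorem ofReal_sub_le_lintegral_deriv {u : ℝ → ℝ} {s t : ℝ} (hst : s ≤ t)
    (hu : ContDiffOn ℝ 1 u (Icc s t)) :
    ENNReal.ofReal (u t - u s) ≤ ∫⁻ x in Ioo s t, ENNReal.ofReal (deriv u x) := by
  rcases hst.eq_or_lt with rfl | hlt
  · simp
  have hint : IntegrableOn (derivWithin u (Icc s t)) (Ioo s t) :=
    (hu.continuousOn_derivWithin (uniqueDiffOn_Icc hlt) le_rfl).integrableOn_Icc.mono_set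
      Ioo_subset_Icc_self
  have hderiv : EqOn (derivWithin u (Icc s t)) (deriv u) (Ioo s t) := fun x hx =>
    derivWithin_of_mem_nhds (Icc_mem_nhds hx.1 hx.2)
  calc ENNReal.ofReal (u t - u s)
      = ENNReal.ofReal (∫ x in Ioo s t, derivWithin u (Icc s t) x) := by
        rw [← intervalIntegral.integral_derivWithin_Icc_of_contDiffOn_Icc hu hst,
          intervalIntegral.integral_of_le hst, setIntegral_congr_set Ioo_ae_eq_Ioc.symm]
    _ ≤ ∫⁻ x in Ioo s t, ENNReal.ofReal (derivWithin u (Icc s t) x) := by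
        rw [integral_eq_lintegral_pos_part_sub_lintegral_neg_part hint]
        exact (ENNReal.ofReal_le_ofReal (sub_le_self _ ENNReal.toReal_nonneg)).trans
          ENNReal.ofReal_toReal_le
    _ = ∫⁻ x in Ioo s t, ENNReal.ofReal (deriv u x) :=
        setLIntegral_congr_fun measurableSet_Ioo fun x hx =>
          congrArg ENNReal.ofReal (hderiv hx)

variable {n : ℕ} {M : Type*} [TopologicalSpace M]
  [ChartedSpace (EuclideanSpace ℝ (Fin n)) M] {p : M}

theorem deriv_comp_eq_differential {h : M → ℝ} {γ : ℝ → M} {t : ℝ}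
    (hh : MDifferentiableAt (𝓡 n) 𝓘(ℝ, ℝ) h (γ t)) (hγ : MDifferentiableAt 𝓘(ℝ, ℝ) (𝓡 n) γ t) :
    deriv (h ∘ γ) t = differential h (γ t) (mfderiv 𝓘(ℝ, ℝ) (𝓡 n) γ t (1 : ℝ)) := by
  have hchain := mfderiv_comp t hh hγ
  rw [mfderiv_eq_fderiv] at hchain
  exact DFunLike.congr_fun hchain (1 : ℝ)

variable [IsManifold (𝓡 n) ∞ M]

theorem differential_comp_chart {q : M} (ℓ : EuclideanSpace ℝ (Fin n) →L[ℝ] ℝ)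
    (hq : q ∈ (extChartAt (𝓡 n) p).source) (u : TangentSpace (𝓡 n) q) :
    differential (ℓ ∘ extChartAt (𝓡 n) p) q u = ℓ (vecCoord p ⟨q, u⟩) := by
  have hchain := mfderiv_comp q ℓ.mdifferentiableAt (mdifferentiableAt_chart hq)
  rw [ℓ.mfderiv_eq] at hchain
  rw [vecCoord_eq_mfderiv hq]
  exact DFunLike.congr_fun hchain u

end Finsler

namespace FinslerStructure

variable {n : ℕ} {M : Type*} [TopologicalSpace M]
  [ChartedSpace (EuclideanSpace ℝ (Fin n)) M] [IsManifold (𝓡 n) ∞ M]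
  (F : FinslerStructure n M) {p q : M}

theorem sub_le_length {h : M → ℝ} {U S : Set M} (hU : IsOpen U)
    (hh : ContMDiffOn (𝓡 n) 𝓘(ℝ, ℝ) 1 h U) (hSU : S ⊆ U)
    (hle : ∀ x ∈ S, ∀ v : TangentSpace (𝓡 n) x, differential h x v ≤ F.toFun ⟨x, v⟩)
    {γ : ℝ → M} {s t : ℝ} (hγ : PiecewiseSmooth n γ s t) (hS : MapsTo γ (Icc s t) S) :
    ENNReal.ofReal (h (γ t) - h (γ s)) ≤ F.length γ s t := by
  induction hγ with
  | @smooth s t hst hγ =>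
    have hcomp : ContDiffOn ℝ 1 (h ∘ γ) (Icc s t) :=
      (hh.comp (hγ.of_le (by norm_cast)) fun x hx => hSU (hS hx)).contDiffOn
    rw [length_eq_Ioo]
    refine (ofReal_sub_le_lintegral_deriv hst hcomp).trans
      (setLIntegral_mono' measurableSet_Ioo fun u hu => ENNReal.ofReal_le_ofReal ?_)
    have hγu := hS (Ioo_subset_Icc_self hu)
    rw [deriv_comp_eq_differential
      ((hh.contMDiffAt (hU.mem_nhds (hSU hγu))).mdifferentiableAt one_ne_zero)
      ((hγ.contMDiffAt (Icc_mem_nhds hu.1 hu.2)).mdifferentiableAt (by simp))]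
    exact hle _ hγu _
  | @concat s m t h₁ h₂ le₁ le₂ =>
    rw [← F.length_add γ h₁.le h₂.le, ← sub_add_sub_cancel' (h (γ m))]
    exact ENNReal.ofReal_add_le.trans (add_le_add
      (le₁ (hS.mono_left (Icc_subset_Icc_right h₂.le)))
      (le₂ (hS.mono_left (Icc_subset_Icc_left h₁.le))))

theorem toFun_velocity_chart_symm {c : ℝ → EuclideanSpace ℝ (Fin n)} {u : ℝ}
    (hc : DifferentiableAt ℝ c u) (hu : c u ∈ (extChartAt (𝓡 n) p).target) :
    F.toFun (velocity (fun s => (extChartAt (𝓡 n) p).symm (c s)) u) =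
      F.locNorm p (c u) (deriv c u) := by
  have hright : (fun s => extChartAt (𝓡 n) p ((extChartAt (𝓡 n) p).symm (c s))) =ᶠ[𝓝 u] c := by
    filter_upwards [hc.continuousAt.preimage_mem_nhds
      ((isOpen_extChartAt_target p).mem_nhds hu)] with s hs
    exact (extChartAt (𝓡 n) p).right_inv hs
  have hsymm := mdifferentiableAt_chart_symm ((extChartAt (𝓡 n) p).map_target hu)
  rw [(extChartAt (𝓡 n) p).right_inv hu] at hsymm
  have hvelocity := F.toFun_velocity ((extChartAt (𝓡 n) p).map_target hu)
    (hsymm.comp u hc.mdifferentiableAt)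
  simp only [Function.comp_apply] at hvelocity
  rwa [hright.deriv_eq, hright.eq_of_nhds] at hvelocity

theorem exists_dist_le_locNorm (hq : q ∈ (extChartAt (𝓡 n) p).source) {η : ℝ} (hη : 0 < η) :
    ∃ r > 0, Metric.closedBall (extChartAt (𝓡 n) p q) r ⊆ (extChartAt (𝓡 n) p).target ∧
      ∀ x ∈ Metric.closedBall (extChartAt (𝓡 n) p q) r,
      ∀ y ∈ Metric.closedBall (extChartAt (𝓡 n) p q) r,
      F.dist ((extChartAt (𝓡 n) p).symm x) ((extChartAt (𝓡 n) p).symm y) ≤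
        ENNReal.ofReal (F.locNorm p (extChartAt (𝓡 n) p q) (y - x) + η * ‖y - x‖) := by
  obtain ⟨r, hr, hrV, hN⟩ := (F.isMinkowskiFamily_locNorm p).exists_closedBall_abs_sub_le
    ((extChartAt (𝓡 n) p).map_source hq) hη
  refine ⟨r, hr, hrV, fun x hx y hy => ?_⟩
  let segment : ℝ → EuclideanSpace ℝ (Fin n) := fun u => x + u • (y - x)
  have hmem : MapsTo segment (Icc 0 1) (Metric.closedBall (extChartAt (𝓡 n) p q) r) := fun u hu =>
    (convex_closedBall _ r).add_smul_sub_mem hx hy hu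
  have hderiv (u : ℝ) : HasDerivAt segment (y - x) u :=
    hasDerivAt_add_smul x (y - x) u
  have hsmooth : ContMDiffOn 𝓘(ℝ, ℝ) (𝓡 n) ∞ (fun u => (extChartAt (𝓡 n) p).symm (segment u))
      (Icc 0 1) := by
    have : ContDiff ℝ ∞ segment := by fun_prop
    exact (contMDiffOn_extChartAt_symm p).comp this.contMDiff.contMDiffOn fun u hu => hrV (hmem hu)
  have hlength : F.length (fun u => (extChartAt (𝓡 n) p).symm (segment u)) 0 1 ≤
      ∫⁻ _ in Ioo (0 : ℝ) 1,
        ENNReal.ofReal (F.locNorm p (extChartAt (𝓡 n) p q) (y - x) + η * ‖y - x‖) := by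
    rw [length_eq_Ioo]
    refine setLIntegral_mono' measurableSet_Ioo fun u hu => ENNReal.ofReal_le_ofReal ?_
    have hu' := hmem (Ioo_subset_Icc_self hu)
    rw [F.toFun_velocity_chart_symm (hderiv u).differentiableAt (hrV hu'), (hderiv u).deriv]
    linarith [(abs_le.1 (hN _ hu' (y - x))).2]
  have hdist := (F.dist_le_length (.smooth zero_le_one hsmooth)).trans hlength
  simpa [segment] using hdist

theorem mul_le_length_of_mapsTo {N : EuclideanSpace ℝ (Fin n) → ℝ} (hN : IsMinkowskiNorm N)
    {k : ℝ} (hk : 0 ≤ k) {S : Set M} (hS : S ⊆ (extChartAt (𝓡 n) p).source)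
    (hle : ∀ x ∈ S, ∀ v, k * N v ≤ F.locNorm p (extChartAt (𝓡 n) p x) v) {γ : ℝ → M} {s t : ℝ}
    (hγ : PiecewiseSmooth n γ s t) (hγS : MapsTo γ (Icc s t) S) :
    ENNReal.ofReal (k * N (extChartAt (𝓡 n) p (γ t) - extChartAt (𝓡 n) p (γ s))) ≤
      F.length γ s t := by
  obtain ⟨ℓ, hℓ, hℓle⟩ :=
    hN.exists_supporting_functional (extChartAt (𝓡 n) p (γ t) - extChartAt (𝓡 n) p (γ s))
  have hchart : ContMDiffOn (𝓡 n) 𝓘(ℝ, EuclideanSpace ℝ (Fin n)) 1 (extChartAt (𝓡 n) p)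
      (extChartAt (𝓡 n) p).source := by
    rw [extChartAt_source]
    exact contMDiffOn_extChartAt
  have hlength := F.sub_le_length (isOpen_extChartAt_source p)
    ((k • ℓ).contMDiff.comp_contMDiffOn hchart) hS (fun x hx v => ?_) hγ hγS
  · rwa [Function.comp_apply, Function.comp_apply, ← map_sub, smul_apply, hℓ,
      smul_eq_mul] at hlength
  · rw [differential_comp_chart _ (hS hx), ← F.locNorm_vecCoord (hS hx)]
    exact (mul_le_mul_of_nonneg_left (hℓle _) hk).trans (hle x hx _)

theorem exists_closedBall_mul_locNorm_le (hq : q ∈ (extChartAt (𝓡 n) p).source) {η : ℝ}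
    (hη : 0 < η) : ∃ r > 0,
      Metric.closedBall (extChartAt (𝓡 n) p q) r ⊆ (extChartAt (𝓡 n) p).target ∧
      ∀ x ∈ Metric.closedBall (extChartAt (𝓡 n) p q) r, ∀ v,
        (1 - η) * F.locNorm p (extChartAt (𝓡 n) p q) v ≤ F.locNorm p x v := by
  obtain ⟨m, hm, _, _, hmN⟩ := (F.isMinkowskiNorm_locNorm hq).exists_bounds
  obtain ⟨r, hr, hrV, hN⟩ := (F.isMinkowskiFamily_locNorm p).exists_closedBall_abs_sub_le
    ((extChartAt (𝓡 n) p).map_source hq) (mul_pos hη hm)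
  refine ⟨r, hr, hrV, fun x hx v => ?_⟩
  have hrelative := mul_le_mul_of_nonneg_left (hmN v).1 hη.le
  linarith [(abs_le.1 (hN x hx v)).1]

theorem mapsTo_of_length_lt {K O O' : Set M} (hO : IsOpen O) (hK : IsClosed K) (hOK : O ⊆ K)
    (hO' : O' ⊆ O) {δ : ℝ≥0∞}
    (hcross : ∀ (γ : ℝ → M) (s t : ℝ), PiecewiseSmooth n γ s t → MapsTo γ (Icc s t) K →
      (γ s ∈ O' ∧ γ t ∉ O ∨ γ t ∈ O' ∧ γ s ∉ O) → δ ≤ F.length γ s t)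
    {γ : ℝ → M} {s t : ℝ} (hγ : PiecewiseSmooth n γ s t) (hend : γ s ∈ O' ∨ γ t ∈ O')
    (hlength : F.length γ s t < δ) : MapsTo γ (Icc s t) K := by
  by_contra hmaps
  have hleaves : ∃ u ∈ Icc s t, γ u ∉ O := by
    by_contra! h
    exact hmaps fun u hu => hOK (h u hu)
  refine hlength.not_ge ?_
  rcases hend with hs | ht
  · obtain ⟨t', ht', hout, hin⟩ := exists_exit_time hγ.continuousOn hO hK hOK (hO' hs) hleaves
    rw [← F.length_add γ ht'.1 ht'.2]
    exact le_add_right (hcross γ s t' (hγ.restrict le_rfl ht'.1 ht'.2) hin (.inl ⟨hs, hout⟩))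
  · obtain ⟨s', hs', hout, hin⟩ := exists_entrance_time hγ.continuousOn hO hK hOK (hO' ht) hleaves
    rw [← F.length_add γ hs'.1 hs'.2]
    exact le_add_left (hcross γ s' t (hγ.restrict hs'.1 hs'.2 le_rfl) hin (.inr ⟨ht, hout⟩))

theorem eventually_dist_lt (q : M) {ε : ℝ≥0∞} (hε : 0 < ε) :
    ∀ᶠ z : M × M in 𝓝 (q, q), F.dist z.1 z.2 < ε := by
  let φ := extChartAt (𝓡 n) q
  have hφ : ContinuousAt φ q := continuousAt_extChartAt q
  obtain ⟨r, hr, -, hdist⟩ := F.exists_dist_le_locNorm (mem_extChartAt_source q) one_pos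
  obtain ⟨_, _, C, _, hC⟩ := (F.isMinkowskiNorm_locNorm (mem_extChartAt_source q)).exists_bounds
  have hbound : ContinuousAt
      (fun z : M × M => ENNReal.ofReal (C * ‖φ z.2 - φ z.1‖ + 1 * ‖φ z.2 - φ z.1‖)) (q, q) := by
    have hdiff : ContinuousAt (fun z : M × M => φ z.2 - φ z.1) (q, q) :=
      (hφ.comp' continuousAt_snd).sub (hφ.comp' continuousAt_fst)
    exact ENNReal.continuous_ofReal.continuousAt.comp
      ((hdiff.norm.const_mul C).add (hdiff.norm.const_mul 1))
  have hball : ∀ᶠ x in 𝓝 q, x ∈ φ.source ∧ φ x ∈ Metric.closedBall (φ q) r :=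
    (eventually_mem_set.2 (extChartAt_source_mem_nhds q)).and
      (hφ.eventually (Metric.closedBall_mem_nhds _ hr))
  filter_upwards [hbound.tendsto.eventually_lt_const (by simpa using hε), hball.prodMk_nhds hball]
    with ⟨x, y⟩ hlt ⟨⟨hxs, hx⟩, hys, hy⟩
  have hxy := hdist _ hx _ hy
  rw [φ.left_inv hxs, φ.left_inv hys] at hxy
  exact hxy.trans_lt ((ENNReal.ofReal_le_ofReal (by gcongr; exact (hC _).2)).trans_lt hlt)

theorem dist_ne_top [ConnectedSpace M] (p q : M) : F.dist p q ≠ ⊤ := by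
  refine PreconnectedSpace.induction₂' (fun x y => F.dist x y ≠ ⊤) (fun x => ?_)
    ⟨fun x y z hxy hyz => ?_⟩ p q
  · have hnear := F.eventually_dist_lt x one_pos
    filter_upwards [(Continuous.prodMk_right (Y := M) x).continuousAt.eventually hnear,
      (Continuous.prodMk_left (X := M) x).continuousAt.eventually hnear] with y hxy hyx
    exact ⟨hxy.ne_top, hyx.ne_top⟩
  · exact ne_top_of_le_ne_top (ENNReal.add_ne_top.2 ⟨hxy, hyz⟩) (F.dist_triangle x y z)

variable [T2Space M]

theorem mapsTo_chart_closedBall_of_length_lt {N : EuclideanSpace ℝ (Fin n) → ℝ}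
    (hN : IsMinkowskiNorm N) {k m r : ℝ} {c : EuclideanSpace ℝ (Fin n)} (hk : 0 ≤ k) (hm : 0 ≤ m)
    (hr : 0 ≤ r) (hmN : ∀ v, m * ‖v‖ ≤ N v)
    (hrV : Metric.closedBall c r ⊆ (extChartAt (𝓡 n) p).target)
    (hle : ∀ x ∈ Metric.closedBall c r, ∀ v, k * N v ≤ F.locNorm p x v) {γ : ℝ → M} {s t : ℝ}
    (hγ : PiecewiseSmooth n γ s t)
    (hend : γ s ∈ (extChartAt (𝓡 n) p).source ∩ extChartAt (𝓡 n) p ⁻¹' Metric.ball c (r / 2) ∨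
      γ t ∈ (extChartAt (𝓡 n) p).source ∩ extChartAt (𝓡 n) p ⁻¹' Metric.ball c (r / 2))
    (hlt : F.length γ s t < ENNReal.ofReal (k * (m * (r / 2)))) :
    MapsTo γ (Icc s t)
      ((extChartAt (𝓡 n) p).source ∩ extChartAt (𝓡 n) p ⁻¹' Metric.closedBall c r) := by
  let φ := extChartAt (𝓡 n) p
  have hclosed : IsClosed (φ.source ∩ φ ⁻¹' Metric.closedBall c r) := by
    rw [← φ.symm_image_eq_source_inter_preimage hrV]
    exact ((isCompact_closedBall c r).image_of_continuousOn
      ((continuousOn_extChartAt_symm p).mono hrV)).isClosed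
  refine F.mapsTo_of_length_lt ((continuousOn_extChartAt p).isOpen_inter_preimage
    (isOpen_extChartAt_source p) Metric.isOpen_ball) hclosed
    (inter_subset_inter_right _ (preimage_mono Metric.ball_subset_closedBall))
    (inter_subset_inter_right _ (preimage_mono (Metric.ball_subset_ball (half_le_self hr))))
    (fun γ s t hγ hγK hcross => ?_) hγ hend hlt
  have hfar {x y : M} (hx : x ∈ φ.source ∩ φ ⁻¹' Metric.ball c (r / 2)) (hys : y ∈ φ.source)
      (hy : y ∉ φ.source ∩ φ ⁻¹' Metric.ball c r) : r / 2 ≤ Dist.dist (φ y) (φ x) := by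
    have hyr : r ≤ Dist.dist (φ y) c := not_lt.1 fun h => hy ⟨hys, h⟩
    have hxr : Dist.dist (φ x) c < r / 2 := hx.2
    linarith [_root_.dist_triangle (φ y) (φ x) c]
  have hdist : r / 2 ≤ ‖φ (γ t) - φ (γ s)‖ := by
    rw [← dist_eq_norm]
    rcases hcross with ⟨hs, ht⟩ | ⟨ht, hs⟩
    · exact hfar hs (hγK (right_mem_Icc.2 hγ.le)).1 ht
    · exact dist_comm (φ (γ s)) _ ▸ hfar ht (hγK (left_mem_Icc.2 hγ.le)).1 hs
  refine (ENNReal.ofReal_le_ofReal (mul_le_mul_of_nonneg_left ?_ hk)).trans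
    (F.mul_le_length_of_mapsTo hN hk inter_subset_left (fun x hx => hle _ hx.2) hγ hγK)
  exact (mul_le_mul_of_nonneg_left hdist hm).trans (hmN _)

theorem exists_mul_locNorm_le_length (hq : q ∈ (extChartAt (𝓡 n) p).source) {η : ℝ}
    (hη : 0 < η) (hη1 : η < 1) {U : Set M} (hU : U ∈ 𝓝 q) :
    ∃ W ∈ 𝓝 q, ∃ δ > 0, ∀ (γ : ℝ → M) (s t : ℝ), PiecewiseSmooth n γ s t →
      (γ s ∈ W ∨ γ t ∈ W) → F.length γ s t < ENNReal.ofReal δ →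
      MapsTo γ (Icc s t) (U ∩ (extChartAt (𝓡 n) p).source) ∧
      ENNReal.ofReal ((1 - η) * F.locNorm p (extChartAt (𝓡 n) p q)
        (extChartAt (𝓡 n) p (γ t) - extChartAt (𝓡 n) p (γ s))) ≤ F.length γ s t := by
  let φ := extChartAt (𝓡 n) p
  have hN := F.isMinkowskiNorm_locNorm hq
  obtain ⟨m, hm, _, _, hmN⟩ := hN.exists_bounds
  obtain ⟨r₁, hr₁, hr₁V, hr₁N⟩ := F.exists_closedBall_mul_locNorm_le hq hη
  obtain ⟨r₂, hr₂, hr₂U⟩ := Metric.nhds_basis_closedBall.mem_iff.1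
    ((continuousAt_extChartAt_symm' hq).preimage_mem_nhds (by rwa [φ.left_inv hq]))
  obtain ⟨r, hr, hrr₁, hrr₂⟩ : ∃ r > 0, r ≤ r₁ ∧ r ≤ r₂ :=
    ⟨min r₁ r₂, lt_min hr₁ hr₂, min_le_left _ _, min_le_right _ _⟩
  have hball := Metric.closedBall_subset_closedBall (x := φ q) hrr₁
  have hη_nonneg : 0 ≤ 1 - η := by linarith
  have hopen : IsOpen (φ.source ∩ φ ⁻¹' Metric.ball (φ q) (r / 2)) :=
    (continuousOn_extChartAt p).isOpen_inter_preimage (isOpen_extChartAt_source p)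
      Metric.isOpen_ball
  refine ⟨_, hopen.mem_nhds ⟨hq, Metric.mem_ball_self (half_pos hr)⟩,
    (1 - η) * (m * (r / 2)), mul_pos (by linarith) (by positivity), fun γ s t hγ hend hlt => ?_⟩
  have hmaps := F.mapsTo_chart_closedBall_of_length_lt hN hη_nonneg hm.le hr.le
    (fun v => (hmN v).1) (hball.trans hr₁V) (fun x hx => hr₁N x (hball hx)) hγ hend hlt
  refine ⟨fun u hu => ⟨?_, (hmaps hu).1⟩, F.mul_le_length_of_mapsTo hN hη_nonneg inter_subset_left
    (fun x hx => hr₁N _ (hball hx.2)) hγ hmaps⟩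
  have huU := hr₂U (Metric.closedBall_subset_closedBall hrr₂ (hmaps hu).2)
  rwa [mem_preimage, (extChartAt (𝓡 n) p).left_inv (hmaps hu).1] at huU

theorem exists_locNorm_le_dist (hq : q ∈ (extChartAt (𝓡 n) p).source) {η : ℝ} (hη : 0 < η)
    (hη1 : η < 1) {U : Set M} (hU : U ∈ 𝓝 q) :
    ∃ W ∈ 𝓝 q, ∃ δ > 0, ∀ x y, (x ∈ W ∨ y ∈ W) → F.dist x y < ENNReal.ofReal δ →
      x ∈ U ∩ (extChartAt (𝓡 n) p).source ∧ y ∈ U ∩ (extChartAt (𝓡 n) p).source ∧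
      ENNReal.ofReal ((1 - η) * F.locNorm p (extChartAt (𝓡 n) p q)
        (extChartAt (𝓡 n) p y - extChartAt (𝓡 n) p x)) ≤ F.dist x y := by
  obtain ⟨W, hW, δ, hδ, h⟩ := F.exists_mul_locNorm_le_length hq hη hη1 hU
  refine ⟨W, hW, δ, hδ, fun x y hxy hdist => ?_⟩
  obtain ⟨γ, s, t, hγ, rfl, rfl, hlength⟩ := F.exists_length_lt hdist
  obtain ⟨hmaps, -⟩ := h γ s t hγ hxy hlength
  refine ⟨hmaps (left_mem_Icc.2 hγ.le), hmaps (right_mem_Icc.2 hγ.le), not_lt.1 fun hlt => ?_⟩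
  obtain ⟨γ', s', t', hγ', hs', ht', hlength'⟩ := F.exists_length_lt (lt_min hdist hlt)
  have hle := (h γ' s' t' hγ' (by rwa [hs', ht']) (hlength'.trans_le (min_le_left _ _))).2
  rw [hs', ht'] at hle
  exact (hlength'.trans_le (min_le_right _ _)).not_ge hle

theorem exists_nhds_of_dist_lt {U : Set M} (hU : U ∈ 𝓝 q) :
    ∃ W ∈ 𝓝 q, ∃ δ > 0, ∀ x y, (x ∈ W ∨ y ∈ W) → F.dist x y < ENNReal.ofReal δ →
      x ∈ U ∧ y ∈ U := by
  obtain ⟨W, hW, δ, hδ, h⟩ := F.exists_locNorm_le_dist (mem_extChartAt_source q)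
    (η := 1 / 2) (by norm_num) (by norm_num) hU
  exact ⟨W, hW, δ, hδ, fun x y hxy hd => ⟨(h x y hxy hd).1.1, (h x y hxy hd).2.1.1⟩⟩

theorem eq_of_dist_eq_zero {x y : M} (h : F.dist x y = 0) : x = y := by
  by_contra hne
  obtain ⟨W, hW, δ, hδ, hclose⟩ := F.exists_nhds_of_dist_lt (isOpen_compl_singleton.mem_nhds hne)
  exact (hclose x y (.inl (mem_of_mem_nhds hW)) (by simpa [h] using hδ)).2 rfl

end FinslerStructure

/-! ### The arrival time -/

namespace Finsler

/-- The arrival time at `x` of the wave that starts from the level set `{f = a}`, as read off from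
the value of the transnormal function `f`. -/
def arrival {M : Type*} (𝔟 : ℝ → ℝ) (a : ℝ) (f : M → ℝ) (x : M) : ℝ := travelTime 𝔟 a (f x)

end Finsler

namespace FinslerStructure

variable {n : ℕ} {M : Type*} [TopologicalSpace M]
  [ChartedSpace (EuclideanSpace ℝ (Fin n)) M] [IsManifold (𝓡 n) ∞ M]

/-- A transnormal function with values in `[a, b]`, `a < b`, without critical values in `(a, b)`. -/
structure IsRegularTransnormal (F : FinslerStructure n M) (f : M → ℝ) (𝔟 : ℝ → ℝ) (a b : ℝ) :
    Prop where
  transnormal : F.IsTransnormal f 𝔟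
  range_eq : range f = Icc a b
  pos : ∀ s ∈ Ioo a b, 0 < 𝔟 s
  lt : a < b

namespace IsRegularTransnormal

variable {F : FinslerStructure n M} {f : M → ℝ} {𝔟 : ℝ → ℝ} {a b : ℝ}
  (h : F.IsRegularTransnormal f 𝔟 a b)

include h

theorem mem_Icc (x : M) : f x ∈ Icc a b := h.range_eq ▸ mem_range_self x

theorem left_mem : a ∈ Icc a b := left_mem_Icc.2 h.lt.le

theorem right_mem : b ∈ Icc a b := right_mem_Icc.2 h.lt.le

theorem exists_eq {c : ℝ} (hc : c ∈ Icc a b) : ∃ x, f x = c := by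
  rwa [← h.range_eq] at hc

theorem speed_nonneg {c : ℝ} (hc : c ∈ Icc a b) : 0 ≤ 𝔟 c := by
  obtain ⟨x, rfl⟩ := h.exists_eq hc
  obtain ⟨y, -, hy⟩ := h.transnormal.gradient x
  exact hy ▸ sq_nonneg _

theorem continuousOn_speed : ContinuousOn 𝔟 (Icc a b) := h.range_eq ▸ h.transnormal.continuousOn

theorem continuous : Continuous f := h.transnormal.smooth.continuous

theorem mdifferentiableAt (x : M) : MDifferentiableAt (𝓡 n) 𝓘(ℝ, ℝ) f x :=
  (h.transnormal.smooth x).mdifferentiableAt (by simp)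

theorem differential_le (x : M) (v : TangentSpace (𝓡 n) x) :
    differential f x v ≤ √(𝔟 (f x)) * F.toFun ⟨x, v⟩ := by
  obtain ⟨y, hy, hy2⟩ := h.transnormal.gradient x
  have hx := mem_extChartAt_source (I := 𝓡 n) x
  have hgrad : differential f x v = F.legendre x y v := hy v
  rw [hgrad, ← hy2, Real.sqrt_sq (F.nonneg _), F.legendre_eq_minkowskiLegendre hx,
    ← F.locNorm_vecCoord hx, ← F.locNorm_vecCoord hx]
  exact (F.isMinkowskiNorm_locNorm hx).legendre_le _ _

theorem ofReal_integral_le_dist {g : ℝ → ℝ} (hg : Continuous g) (hg_nonneg : ∀ s, 0 ≤ g s)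
    (hg_le : ∀ s ∈ Icc a b, √(𝔟 s) * g s ≤ 1) (x y : M) :
    ENNReal.ofReal (∫ s in f x..f y, g s) ≤ F.dist x y := by
  let G : ℝ → ℝ := fun z => ∫ s in a..z, g s
  have hGderiv (z : ℝ) : HasDerivAt G (g z) z := intervalIntegral.integral_hasDerivAt_right
    (hg.intervalIntegrable _ _) hg.stronglyMeasurable.stronglyMeasurableAtFilter hg.continuousAt
  have hG : ContDiff ℝ 1 G := contDiff_one_iff_deriv.2
    ⟨fun z => (hGderiv z).differentiableAt, by rwa [funext fun z => (hGderiv z).deriv]⟩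
  have hGf : ContMDiff (𝓡 n) 𝓘(ℝ, ℝ) 1 (G ∘ f) :=
    hG.contMDiff.comp (h.transnormal.smooth.of_le (by norm_cast))
  have hdiff_le (z : M) (v : TangentSpace (𝓡 n) z) :
      differential (G ∘ f) z v ≤ F.toFun ⟨z, v⟩ := by
    have hchain : differential (G ∘ f) z v = differential f z v * g (f z) :=
      congrArg (fun A => A v) ((hGderiv (f z)).hasFDerivAt.hasMFDerivAt.comp z
        (h.mdifferentiableAt z).hasMFDerivAt).mfderiv
    calc differential (G ∘ f) z v
        ≤ √(𝔟 (f z)) * F.toFun ⟨z, v⟩ * g (f z) :=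
          hchain ▸ mul_le_mul_of_nonneg_right (h.differential_le z v) (hg_nonneg _)
      _ = √(𝔟 (f z)) * g (f z) * F.toFun ⟨z, v⟩ := by ring
      _ ≤ F.toFun ⟨z, v⟩ := mul_le_of_le_one_left (F.nonneg _) (hg_le _ (h.mem_Icc z))
  refine F.le_dist fun γ s t hγ hs ht => ?_
  have hlength := F.sub_le_length isOpen_univ hGf.contMDiffOn subset_rfl
    (fun z _ => hdiff_le z) hγ (mapsTo_univ _ _)
  rwa [hs, ht, Function.comp_apply, Function.comp_apply, intervalIntegral.integral_interval_sub_left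
    (hg.intervalIntegrable _ _) (hg.intervalIntegrable _ _)] at hlength

omit h in
theorem ofReal_intervalIntegral_eq_lintegral {g : ℝ → ℝ} {c d : ℝ} (hcd : c ≤ d)
    (hg : IntegrableOn g (Ioo c d)) (hg_nonneg : ∀ s, 0 ≤ g s) :
    ENNReal.ofReal (∫ s in c..d, g s) = ∫⁻ s in Ioo c d, ENNReal.ofReal (g s) := by
  rw [intervalIntegral.integral_of_le hcd, ← setIntegral_congr_set Ioo_ae_eq_Ioc,
    ofReal_integral_eq_lintegral_ofReal hg (Eventually.of_forall hg_nonneg)]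

-- `1 / √𝔟` is the pointwise limit of the continuous slownesses `1 / √(𝔟 + 1 / (k + 1))`.
theorem lintegral_le_dist (x y : M) :
    ∫⁻ s in Ioo (f x) (f y), ENNReal.ofReal (1 / √(𝔟 s)) ≤ F.dist x y := by
  rcases le_or_gt (f y) (f x) with hle | hlt
  · simp [Ioo_eq_empty (not_lt.2 hle)]
  let β : ℝ → ℝ := IccExtend h.lt.le (𝔟 ∘ Subtype.val)
  have hβ : Continuous β :=
    Continuous.Icc_extend' (continuousOn_iff_continuous_domRestrict.1 h.continuousOn_speed)
  have hβ_eq {s : ℝ} (hs : s ∈ Icc a b) : β s = 𝔟 s := IccExtend_of_mem _ _ hs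
  have hpos (k : ℕ) (s : ℝ) : 0 < β s + 1 / ((k : ℝ) + 1) :=
    add_pos_of_nonneg_of_pos (h.speed_nonneg (projIcc a b h.lt.le s).2) (by positivity)
  let g : ℕ → ℝ → ℝ := fun k s => 1 / √(β s + 1 / ((k : ℝ) + 1))
  have hg (k : ℕ) : Continuous (g k) :=
    continuous_const.div (by fun_prop) fun s => (Real.sqrt_pos.2 (hpos k s)).ne'
  have hg_le (k : ℕ) : ∫⁻ s in Ioo (f x) (f y), ENNReal.ofReal (g k s) ≤ F.dist x y := by
    have hg_nonneg (s : ℝ) : 0 ≤ g k s := by positivity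
    rw [← ofReal_intervalIntegral_eq_lintegral hlt.le
      ((hg k).integrableOn_Icc.mono_set Ioo_subset_Icc_self) hg_nonneg]
    refine h.ofReal_integral_le_dist (hg k) hg_nonneg (fun s hs => ?_) x y
    rw [mul_one_div, div_le_one (Real.sqrt_pos.2 (hpos k s)), hβ_eq hs]
    exact Real.sqrt_le_sqrt (le_add_of_nonneg_right (by positivity))
  have hlim {s : ℝ} (hs : s ∈ Ioo a b) :
      Tendsto (fun k => ENNReal.ofReal (g k s)) atTop (𝓝 (ENNReal.ofReal (1 / √(𝔟 s)))) := by
    have hadd : Tendsto (fun k : ℕ => β s + 1 / ((k : ℝ) + 1)) atTop (𝓝 (𝔟 s)) := by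
      simpa only [hβ_eq (Ioo_subset_Icc_self hs), add_zero] using
        tendsto_one_div_add_atTop_nhds_zero_nat.const_add (𝔟 s)
    exact ENNReal.tendsto_ofReal
      (tendsto_const_nhds.div hadd.sqrt (Real.sqrt_pos.2 (h.pos s hs)).ne')
  calc ∫⁻ s in Ioo (f x) (f y), ENNReal.ofReal (1 / √(𝔟 s))
      = ∫⁻ s in Ioo (f x) (f y), liminf (fun k => ENNReal.ofReal (g k s)) atTop :=
        setLIntegral_congr_fun measurableSet_Ioo fun s hs => (hlim
          (Ioo_subset_Ioo (h.mem_Icc x).1 (h.mem_Icc y).2 hs)).liminf_eq.symm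
    _ ≤ liminf (fun k => ∫⁻ s in Ioo (f x) (f y), ENNReal.ofReal (g k s)) atTop :=
        lintegral_liminf_le fun k => (hg k).measurable.ennreal_ofReal
    _ ≤ F.dist x y := by
        simpa only [liminf_const] using
          liminf_le_liminf (f := atTop) (Eventually.of_forall hg_le)

theorem continuousOn_slowness : ContinuousOn (fun s => 1 / √(𝔟 s)) (Ioo a b) :=
  continuousOn_const.div (h.continuousOn_speed.mono Ioo_subset_Icc_self).sqrt
    fun s hs => (Real.sqrt_pos.2 (h.pos s hs)).ne'

section Connected

variable [ConnectedSpace M]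

theorem integrableOn : IntegrableOn (fun s => 1 / √(𝔟 s)) (Ioo a b) := by
  obtain ⟨x, rfl⟩ := h.exists_eq h.left_mem
  obtain ⟨y, rfl⟩ := h.exists_eq h.right_mem
  refine ⟨h.continuousOn_slowness.aestronglyMeasurable measurableSet_Ioo, ?_⟩
  rw [hasFiniteIntegral_iff_ofReal (Eventually.of_forall fun s => by positivity)]
  exact (h.lintegral_le_dist x y).trans_lt (F.dist_ne_top x y).lt_top

theorem intervalIntegrable {c d : ℝ} (hc : c ∈ Icc a b) (hd : d ∈ Icc a b) :
    IntervalIntegrable (fun s => 1 / √(𝔟 s)) volume c d := by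
  have hab : IntervalIntegrable (fun s => 1 / √(𝔟 s)) volume a b :=
    (intervalIntegrable_iff_integrableOn_Ioo_of_le h.lt.le).2 h.integrableOn
  exact hab.mono_set (uIcc_of_le h.lt.le ▸ uIcc_subset_Icc hc hd)

theorem travelTime_add {c d : ℝ} (hc : c ∈ Icc a b) (hd : d ∈ Icc a b) :
    travelTime 𝔟 a c + travelTime 𝔟 c d = travelTime 𝔟 a d :=
  intervalIntegral.integral_add_adjacent_intervals
    (h.intervalIntegrable h.left_mem hc) (h.intervalIntegrable hc hd)

omit h [ConnectedSpace M] in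
theorem travelTime_self (c : ℝ) : travelTime 𝔟 c c = 0 := intervalIntegral.integral_same

theorem travelTime_pos {c d : ℝ} (hc : c ∈ Icc a b) (hd : d ∈ Icc a b) (hcd : c < d) :
    0 < travelTime 𝔟 c d :=
  intervalIntegral.intervalIntegral_pos_of_pos_on (h.intervalIntegrable hc hd) (fun s hs =>
    one_div_pos.2 (Real.sqrt_pos.2 (h.pos s ⟨hc.1.trans_lt hs.1, hs.2.trans_le hd.2⟩))) hcd

theorem strictMonoOn_travelTime : StrictMonoOn (travelTime 𝔟 a) (Icc a b) :=
  fun c hc d hd hcd => by linarith [h.travelTime_add hc hd, h.travelTime_pos hc hd hcd]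

theorem continuousOn_travelTime : ContinuousOn (travelTime 𝔟 a) (Icc a b) := by
  have hint : IntegrableOn (fun s => 1 / √(𝔟 s)) (uIcc a b) := by
    rw [uIcc_of_le h.lt.le, integrableOn_Icc_iff_integrableOn_Ioo]
    exact h.integrableOn
  exact uIcc_of_le h.lt.le ▸ intervalIntegral.continuousOn_primitive_interval hint

theorem hasDerivAt_travelTime {c : ℝ} (hc : c ∈ Ioo a b) :
    HasDerivAt (travelTime 𝔟 a) (1 / √(𝔟 c)) c :=
  intervalIntegral.integral_hasDerivAt_right
    (h.intervalIntegrable h.left_mem (Ioo_subset_Icc_self hc))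
    (h.continuousOn_slowness.stronglyMeasurableAtFilter isOpen_Ioo c hc)
    (h.continuousOn_slowness.continuousAt (Ioo_mem_nhds hc.1 hc.2))

theorem continuous_arrival : Continuous (arrival 𝔟 a f) :=
  h.continuousOn_travelTime.comp_continuous h.continuous h.mem_Icc

theorem arrival_nonneg (x : M) : 0 ≤ arrival 𝔟 a f x :=
  travelTime_self (𝔟 := 𝔟) a ▸
    h.strictMonoOn_travelTime.monotoneOn h.left_mem (h.mem_Icc x) (h.mem_Icc x).1

theorem arrival_le (x : M) : arrival 𝔟 a f x ≤ travelTime 𝔟 a b :=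
  h.strictMonoOn_travelTime.monotoneOn (h.mem_Icc x) h.right_mem (h.mem_Icc x).2

theorem arrival_eq_iff {x : M} {c : ℝ} (hc : c ∈ Icc a b) :
    arrival 𝔟 a f x = travelTime 𝔟 a c ↔ f x = c :=
  h.strictMonoOn_travelTime.injOn.eq_iff (h.mem_Icc x) hc

theorem mem_Ioo_iff {x : M} :
    f x ∈ Ioo a b ↔ arrival 𝔟 a f x ∈ Ioo 0 (travelTime 𝔟 a b) := by
  rw [mem_Ioo, mem_Ioo, arrival, h.strictMonoOn_travelTime.lt_iff_lt (h.mem_Icc x) h.right_mem,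
    ← h.strictMonoOn_travelTime.lt_iff_lt h.left_mem (h.mem_Icc x), travelTime_self]

theorem ofReal_arrival_sub_le_dist (x y : M) :
    ENNReal.ofReal (arrival 𝔟 a f y - arrival 𝔟 a f x) ≤ F.dist x y := by
  have hsub : arrival 𝔟 a f y - arrival 𝔟 a f x = travelTime 𝔟 (f x) (f y) := by
    rw [sub_eq_iff_eq_add', arrival, arrival, h.travelTime_add (h.mem_Icc x) (h.mem_Icc y)]
  rcases le_total (f y) (f x) with hle | hle
  · have hmono : arrival 𝔟 a f y ≤ arrival 𝔟 a f x :=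
      h.strictMonoOn_travelTime.monotoneOn (h.mem_Icc y) (h.mem_Icc x) hle
    rw [ENNReal.ofReal_of_nonpos (sub_nonpos.2 hmono)]
    exact bot_le
  · have hint := h.integrableOn.mono_set (Ioo_subset_Ioo (h.mem_Icc x).1 (h.mem_Icc y).2)
    rw [hsub, travelTime,
      ofReal_intervalIntegral_eq_lintegral hle hint fun s => by positivity]
    exact h.lintegral_le_dist x y

theorem arrival_sub_le {x y : M} {r : ℝ} (hr : 0 ≤ r) (hd : F.dist x y ≤ ENNReal.ofReal r) :
    arrival 𝔟 a f y - arrival 𝔟 a f x ≤ r :=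
  (ENNReal.ofReal_le_ofReal_iff hr).1 ((h.ofReal_arrival_sub_le_dist x y).trans hd)

end Connected

end IsRegularTransnormal

end FinslerStructure

/-! ### The Euler–Lagrange equation of an eikonal function -/

section LegendreTransform

variable {E : Type*} [NormedAddCommGroup E] [NormedSpace ℝ E]

/-- The energy `N² / 2`, the Lagrangian whose extremals are the geodesics. -/
def finslerEnergy (N : E → E → ℝ) (z : E × E) : ℝ := (1 / 2) * N z.1 z.2 ^ 2

/-- The partial derivative of the energy with respect to the vector: the momentum. -/
def fibreDeriv (N : E → E → ℝ) (z : E × E) : E →L[ℝ] ℝ :=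
  (fderiv ℝ (finslerEnergy N) z).comp (ContinuousLinearMap.inr ℝ E E)

/-- The partial derivative of the energy with respect to the base point: the force. -/
def baseDeriv (N : E → E → ℝ) (z : E × E) : E →L[ℝ] ℝ :=
  (fderiv ℝ (finslerEnergy N) z).comp (ContinuousLinearMap.inl ℝ E E)

/-- The Legendre map `(x, y) ↦ (x, g_y(y, ·))` from vectors to covectors. -/
def legendreMap (N : E → E → ℝ) (z : E × E) : E × (E →L[ℝ] ℝ) := (z.1, fibreDeriv N z)

theorem fderiv_finslerEnergy_apply (N : E → E → ℝ) (z : E × E) (u v : E) :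
    fderiv ℝ (finslerEnergy N) z (u, v) = baseDeriv N z u + fibreDeriv N z v := by
  simp [baseDeriv, fibreDeriv, ← map_add]

namespace IsMinkowskiFamily

variable {N : E → E → ℝ} {V : Set E} (h : IsMinkowskiFamily N V)

include h

theorem isOpen_phase : IsOpen (V ×ˢ ({0}ᶜ : Set E)) := h.isOpen.prod isOpen_compl_singleton

theorem contDiffOn_energy : ContDiffOn ℝ ∞ (finslerEnergy N) (V ×ˢ {0}ᶜ) :=
  contDiffOn_const.mul (h.smooth.pow 2)

theorem contDiffOn_fderiv_energy :
    ContDiffOn ℝ ∞ (fderiv ℝ (finslerEnergy N)) (V ×ˢ {0}ᶜ) :=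
  ((contDiffOn_infty_iff_fderiv_of_isOpen h.isOpen_phase).1 h.contDiffOn_energy).2

theorem contDiffOn_fibreDeriv : ContDiffOn ℝ ∞ (fibreDeriv N) (V ×ˢ {0}ᶜ) :=
  h.contDiffOn_fderiv_energy.clm_comp contDiffOn_const

theorem contDiffOn_baseDeriv : ContDiffOn ℝ ∞ (baseDeriv N) (V ×ˢ {0}ᶜ) :=
  h.contDiffOn_fderiv_energy.clm_comp contDiffOn_const

theorem contDiffOn_legendreMap : ContDiffOn ℝ ∞ (legendreMap N) (V ×ˢ {0}ᶜ) :=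
  contDiffOn_fst.prodMk h.contDiffOn_fibreDeriv

theorem hasFDerivAt_energy {z : E × E} (hz : z ∈ V ×ˢ ({0}ᶜ : Set E)) :
    HasFDerivAt (finslerEnergy N) (fderiv ℝ (finslerEnergy N) z) z :=
  ((h.contDiffOn_energy.contDiffAt (h.isOpen_phase.mem_nhds hz)).differentiableAt
    (by simp)).hasFDerivAt

theorem hasFDerivAt_fibreDeriv {z : E × E} (hz : z ∈ V ×ˢ ({0}ᶜ : Set E)) :
    HasFDerivAt (fibreDeriv N) (fderiv ℝ (fibreDeriv N) z) z :=
  ((h.contDiffOn_fibreDeriv.contDiffAt (h.isOpen_phase.mem_nhds hz)).differentiableAt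
    (by simp)).hasFDerivAt

theorem fibreDeriv_apply {z : E × E} (hz : z ∈ V ×ˢ ({0}ᶜ : Set E)) (v : E) :
    fibreDeriv N z v = minkowskiLegendre (N z.1) z.2 v := by
  have hline : HasDerivAt (fun s : ℝ => (z.1, z.2 + s • v)) ((0, v) : E × E) 0 :=
    (hasDerivAt_const _ _).prodMk (hasDerivAt_add_smul z.2 v 0)
  have henergy := (h.hasFDerivAt_energy hz).comp_hasDerivAt_of_eq 0 hline (by simp)
  rw [minkowskiLegendre, ← deriv_const_mul_field]
  exact henergy.deriv.symm

theorem fderiv_fibreDeriv_ne_zero {z : E × E} (hz : z ∈ V ×ˢ ({0}ᶜ : Set E)) {w : E} (hw : w ≠ 0) :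
    fderiv ℝ (fibreDeriv N) z (0, w) ≠ 0 := by
  intro hzero
  let c : ℝ → E × E := fun s => (z.1, z.2 + s • w)
  have hc0 : c 0 = z := by simp [c]
  have hc : HasDerivAt c (0, w) 0 :=
    (hasDerivAt_const _ _).prodMk (hasDerivAt_add_smul z.2 w 0)
  have hmomentum : HasDerivAt (fun t => fibreDeriv N (c t)) 0 0 :=
    hzero ▸ (h.hasFDerivAt_fibreDeriv hz).comp_hasDerivAt_of_eq 0 hc hc0.symm
  have hfibre : HasDerivAt (fun t => fibreDeriv N (c t) w) 0 0 :=
    (ContinuousLinearMap.apply ℝ ℝ w).hasFDerivAt.comp_hasDerivAt 0 hmomentum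
  have hlegendre :
      (fun t : ℝ => 1 / 2 * deriv (fun s : ℝ => N z.1 (z.2 + t • w + s • w) ^ 2) 0) =ᶠ[𝓝 0]
      fun t => fibreDeriv N (c t) w := by
    filter_upwards [hc.continuousAt (h.isOpen_phase.mem_nhds (hc0.symm ▸ hz))] with t ht
    exact (h.fibreDeriv_apply ht w).symm
  have hposDef := (h.norm z.1 hz.1).posDef z.2 w hz.2 hw
  rw [← deriv_const_mul_field, hlegendre.deriv_eq, hfibre.deriv] at hposDef
  exact lt_irrefl _ hposDef

variable [FiniteDimensional ℝ E]

theorem exists_equiv_hasFDerivAt_legendreMap {z : E × E} (hz : z ∈ V ×ˢ ({0}ᶜ : Set E)) :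
    ∃ A : (E × E) ≃L[ℝ] E × (E →L[ℝ] ℝ),
      HasFDerivAt (legendreMap N) (A : (E × E) →L[ℝ] E × (E →L[ℝ] ℝ)) z := by
  let B : (E × E) →L[ℝ] E × (E →L[ℝ] ℝ) :=
    (ContinuousLinearMap.fst ℝ E E).prod (fderiv ℝ (fibreDeriv N) z)
  have hinj : Function.Injective (B : (E × E) →ₗ[ℝ] E × (E →L[ℝ] ℝ)) := by
    rw [← LinearMap.ker_eq_bot, LinearMap.ker_eq_bot']
    rintro ⟨u, w⟩ huw
    obtain rfl : u = 0 := congrArg Prod.fst huw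
    by_contra hne
    exact h.fderiv_fibreDeriv_ne_zero hz (w := w) (by rintro rfl; exact hne rfl)
      (congrArg Prod.snd huw)
  have hdim : Module.finrank ℝ (E × E) = Module.finrank ℝ (E × (E →L[ℝ] ℝ)) := by
    rw [Module.finrank_prod, Module.finrank_prod,
      ← (LinearMap.toContinuousLinearMap : (E →ₗ[ℝ] ℝ) ≃ₗ[ℝ] E →L[ℝ] ℝ).finrank_eq,
      show Module.finrank ℝ (E →ₗ[ℝ] ℝ) = Module.finrank ℝ E from Subspace.dual_finrank_eq]
  refine ⟨(LinearMap.linearEquivOfInjective _ hinj hdim).toContinuousLinearEquiv, ?_⟩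
  exact (hasFDerivAt_fst.prodMk (h.hasFDerivAt_fibreDeriv hz)).congr_fderiv
    (ContinuousLinearMap.ext fun _ => rfl)

theorem exists_smooth_legendre_inverse {x₀ y₀ : E} (hx₀ : x₀ ∈ V) (hy₀ : y₀ ≠ 0) :
    ∃ (Y : E × (E →L[ℝ] ℝ) → E) (G : Set (E × (E →L[ℝ] ℝ))), IsOpen G ∧
      (x₀, fibreDeriv N (x₀, y₀)) ∈ G ∧ ContDiffOn ℝ ∞ Y G ∧
      ∀ z ∈ G, z.1 ∈ V ∧ Y z ≠ 0 ∧
        ∀ y, (∀ v, minkowskiLegendre (N z.1) y v = z.2 v) → y = Y z := by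
  have : CompleteSpace E := FiniteDimensional.complete ℝ E
  have hsmooth {z : E × E} (hz : z ∈ V ×ˢ ({0}ᶜ : Set E)) : ContDiffAt ℝ ∞ (legendreMap N) z :=
    h.contDiffOn_legendreMap.contDiffAt (h.isOpen_phase.mem_nhds hz)
  have hz₀ : (x₀, y₀) ∈ V ×ˢ ({0}ᶜ : Set E) := ⟨hx₀, hy₀⟩
  obtain ⟨A, hA⟩ := h.exists_equiv_hasFDerivAt_legendreMap hz₀
  let e := (hsmooth hz₀).toOpenPartialHomeomorph _ hA (by simp)
  have hsource : (x₀, y₀) ∈ e.source :=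
    (hsmooth hz₀).mem_toOpenPartialHomeomorph_source hA (by simp)
  refine ⟨fun z => (e.symm z).2, e.target ∩ e.symm ⁻¹' (V ×ˢ {0}ᶜ),
    e.isOpen_inter_preimage_symm h.isOpen_phase, ⟨e.map_source hsource, ?_⟩, fun z hz => ?_,
    fun z hz => ?_⟩
  · rwa [mem_preimage, show (x₀, fibreDeriv N (x₀, y₀)) = e (x₀, y₀) from rfl, e.left_inv hsource]
  · obtain ⟨A, hA⟩ := h.exists_equiv_hasFDerivAt_legendreMap hz.2
    exact (contDiffAt_snd.comp z
      (e.contDiffAt_symm hz.1 hA (hsmooth hz.2))).contDiffWithinAt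
  · have hinv : legendreMap N (e.symm z) = z := e.right_inv hz.1
    have hbase : (e.symm z).1 = z.1 := congrArg Prod.fst hinv
    have hfibre : fibreDeriv N (e.symm z) = z.2 := congrArg Prod.snd hinv
    have hzV : z.1 ∈ V := hbase ▸ hz.2.1
    refine ⟨hzV, hz.2.2, fun y hy => (h.norm z.1 hzV).legendre_injective (funext fun v => ?_)⟩
    rw [hy, ← hfibre, h.fibreDeriv_apply hz.2, hbase]

theorem contDiffOn_of_legendre {α : E → E →L[ℝ] ℝ} (hα : ContDiffOn ℝ ∞ α V) {X : E → E}
    (hX0 : ∀ x ∈ V, X x ≠ 0) (hX : ∀ x ∈ V, ∀ v, minkowskiLegendre (N x) (X x) v = α x v) :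
    ContDiffOn ℝ ∞ X V := by
  intro x₀ hx₀
  obtain ⟨Y, G, hG, hx₀G, hY, hYG⟩ := h.exists_smooth_legendre_inverse hx₀ (hX0 x₀ hx₀)
  have hα₀ : fibreDeriv N (x₀, X x₀) = α x₀ := ContinuousLinearMap.ext fun v =>
    (h.fibreDeriv_apply (z := (x₀, X x₀)) ⟨hx₀, hX0 x₀ hx₀⟩ v).trans (hX x₀ hx₀ v)
  rw [hα₀] at hx₀G
  have hpair : ContDiffAt ℝ ∞ (fun x => (x, α x)) x₀ :=
    contDiffAt_id.prodMk (hα.contDiffAt (h.isOpen.mem_nhds hx₀))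
  have hYα : ContDiffAt ℝ ∞ (fun x => Y (x, α x)) x₀ :=
    (hY.contDiffAt (hG.mem_nhds hx₀G)).comp x₀ hpair
  refine (hYα.congr_of_eventuallyEq ?_).contDiffWithinAt
  filter_upwards [hpair.continuousAt (hG.mem_nhds hx₀G), h.isOpen.mem_nhds hx₀] with x hx hxV
  exact (hYG _ hx).2.2 _ (hX x hxV)

end IsMinkowskiFamily

/-- `ρ` solves the eikonal equation for the Finsler structure `N` on the open set `V`: its Finsler
gradient `X` has norm one. -/
structure IsFinslerEikonal (N : E → E → ℝ) (V : Set E) (ρ : E → ℝ) (X : E → E) : Prop extends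
    IsMinkowskiFamily N V where
  smooth_fun : ContDiffOn ℝ ∞ ρ V
  norm_gradient : ∀ x ∈ V, N x (X x) = 1
  legendre_gradient : ∀ x ∈ V, ∀ v, minkowskiLegendre (N x) (X x) v = fderiv ℝ ρ x v

namespace IsFinslerEikonal

variable {N : E → E → ℝ} {V : Set E} {ρ : E → ℝ} {X : E → E} (h : IsFinslerEikonal N V ρ X)

include h

theorem gradient_ne_zero {x : E} (hx : x ∈ V) : X x ≠ 0 :=
  (h.norm x hx).ne_zero_of_map_eq_one (h.norm_gradient x hx)

theorem contDiffOn_fderiv : ContDiffOn ℝ ∞ (fderiv ℝ ρ) V :=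
  ((contDiffOn_infty_iff_fderiv_of_isOpen h.isOpen).1 h.smooth_fun).2

theorem fderiv_gradient {x : E} (hx : x ∈ V) : fderiv ℝ ρ x (X x) = 1 := by
  rw [← h.legendre_gradient x hx, (h.norm x hx).legendre_self, h.norm_gradient x hx, one_pow]

variable [FiniteDimensional ℝ E]

theorem contDiffOn_gradient : ContDiffOn ℝ ∞ X V :=
  h.contDiffOn_of_legendre h.contDiffOn_fderiv (fun _ => h.gradient_ne_zero) h.legendre_gradient

theorem hasFDerivAt_gradient {x : E} (hx : x ∈ V) : HasFDerivAt X (fderiv ℝ X x) x :=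
  ((h.contDiffOn_gradient.contDiffAt (h.isOpen.mem_nhds hx)).differentiableAt (by simp)).hasFDerivAt

theorem fderiv_energy_gradient {x : E} (hx : x ∈ V) (v : E) :
    baseDeriv N (x, X x) v + fibreDeriv N (x, X x) (fderiv ℝ X x v) = 0 := by
  have hz : (x, X x) ∈ V ×ˢ ({0}ᶜ : Set E) := ⟨hx, h.gradient_ne_zero hx⟩
  have hconst : (fun x => finslerEnergy N (x, X x)) =ᶠ[𝓝 x] fun _ => 1 / 2 := by
    filter_upwards [h.isOpen.mem_nhds hx] with y hy
    simp [finslerEnergy, h.norm_gradient y hy]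
  have hderiv := (HasFDerivAt.comp (f := fun x => (x, X x)) x (h.hasFDerivAt_energy hz)
    ((hasFDerivAt_id x).prodMk (h.hasFDerivAt_gradient hx))).unique
      (hconst.symm.hasFDerivAt_iff.1 (hasFDerivAt_const (1 / 2 : ℝ) x))
  rw [← fderiv_finslerEnergy_apply]
  exact congrArg (fun A => A v) hderiv

-- The Euler–Lagrange equation: the momentum `dρ` along an integral curve of `X` changes at the rate
-- given by the force.
theorem fderiv_fderiv_gradient {x : E} (hx : x ∈ V) :
    fderiv ℝ (fderiv ℝ ρ) x (X x) = baseDeriv N (x, X x) := by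
  ext v
  have hn := h.isOpen.mem_nhds hx
  have hsymm : IsSymmSndFDerivAt ℝ ρ x :=
    (h.smooth_fun.contDiffAt hn).isSymmSndFDerivAt (by
      rw [minSmoothness_of_isRCLikeNormedField]
      exact WithTop.coe_le_coe.2 le_top)
  have hconst : (fun x => fderiv ℝ ρ x (X x)) =ᶠ[𝓝 x] fun _ => 1 := by
    filter_upwards [hn] with y hy using h.fderiv_gradient hy
  have hderiv := ((((h.contDiffOn_fderiv.contDiffAt hn).differentiableAt
    (by simp)).hasFDerivAt.clm_apply (h.hasFDerivAt_gradient hx)).unique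
      (hconst.symm.hasFDerivAt_iff.1 (hasFDerivAt_const (1 : ℝ) x)))
  have hρ : fderiv ℝ ρ x (fderiv ℝ X x v) + fderiv ℝ (fderiv ℝ ρ) x v (X x) = 0 :=
    congrArg (fun A => A v) hderiv
  have henergy := h.fderiv_energy_gradient hx v
  rw [h.fibreDeriv_apply (z := (x, X x)) ⟨hx, h.gradient_ne_zero hx⟩,
    h.legendre_gradient x hx] at henergy
  linarith [hsymm.eq (X x) v]

end IsFinslerEikonal

end LegendreTransform

/-! ### Integral curves of the gradient -/

namespace Finsler

/-- The part of the chart domain at `p` with values of `f` in `(a, b)`, in coordinates. -/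
def regularRegion (n : ℕ) {M : Type*} [TopologicalSpace M]
    [ChartedSpace (EuclideanSpace ℝ (Fin n)) M] (f : M → ℝ) (a b : ℝ) (p : M) :
    Set (EuclideanSpace ℝ (Fin n)) :=
  (extChartAt (𝓡 n) p).target ∩ (fun x => f ((extChartAt (𝓡 n) p).symm x)) ⁻¹' Ioo a b

theorem chart_mem_regularRegion {n : ℕ} {M : Type*} [TopologicalSpace M]
    [ChartedSpace (EuclideanSpace ℝ (Fin n)) M] {f : M → ℝ} {a b : ℝ} {p q : M}
    (hq : q ∈ (extChartAt (𝓡 n) p).source) (hfq : f q ∈ Ioo a b) :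
    extChartAt (𝓡 n) p q ∈ regularRegion n f a b p :=
  ⟨(extChartAt (𝓡 n) p).map_source hq, by rwa [mem_preimage, (extChartAt (𝓡 n) p).left_inv hq]⟩

theorem contDiffAt_of_contDiffAt_comp {E G : Type*} [NormedAddCommGroup E] [NormedSpace ℝ E]
    [NormedAddCommGroup G] [NormedSpace ℝ G] {k : WithTop ℕ∞} (hk : k ≠ 0) {f : E → ℝ} {g : ℝ → G}
    {x : E} (hf : ContDiffAt ℝ k f x) (hf' : fderiv ℝ f x ≠ 0) (hgf : ContDiffAt ℝ k (g ∘ f) x) :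
    ContDiffAt ℝ k g (f x) := by
  obtain ⟨v, hv⟩ : ∃ v, fderiv ℝ f x v ≠ 0 := by
    contrapose! hf'
    exact ContinuousLinearMap.ext hf'
  let line : ℝ → E := fun s => x + s • v
  have hline : ContDiff ℝ k line := by fun_prop
  have hline0 : line 0 = x := by simp [line]
  have hu : ContDiffAt ℝ k (f ∘ line) 0 := ContDiffAt.comp 0 (hline0.symm ▸ hf) hline.contDiffAt
  have hu' : HasDerivAt (f ∘ line) (fderiv ℝ f x v) 0 :=
    (hf.differentiableAt hk).hasFDerivAt.comp_hasDerivAt_of_eq 0 (hasDerivAt_add_smul x v 0)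
      hline0.symm
  let e := hu.toOpenPartialHomeomorph _ (hu'.hasFDerivAt_equiv hv) hk
  have h0 : (0 : ℝ) ∈ e.source := hu.mem_toOpenPartialHomeomorph_source _ hk
  have he0 : e 0 = f x := congrArg f hline0
  have hsymm0 : e.symm (f x) = 0 := he0 ▸ e.left_inv h0
  have htarget : f x ∈ e.target := he0 ▸ e.map_source h0
  have hsection : ContDiffAt ℝ k (line ∘ e.symm) (f x) := hline.contDiffAt.comp (f x)
    (e.contDiffAt_symm htarget (hsymm0.symm ▸ hu'.hasFDerivAt_equiv hv) (hsymm0.symm ▸ hu))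
  have hx : (line ∘ e.symm) (f x) = x := by rw [Function.comp_apply, hsymm0, hline0]
  refine (ContDiffAt.comp (f x) (hx.symm ▸ hgf) hsection).congr_of_eventuallyEq ?_
  filter_upwards [e.open_target.mem_nhds htarget] with s hs
  exact congrArg g (e.right_inv hs).symm

end Finsler

namespace FinslerStructure

variable {n : ℕ} {M : Type*} [TopologicalSpace M]
  [ChartedSpace (EuclideanSpace ℝ (Fin n)) M] [IsManifold (𝓡 n) ∞ M]

namespace IsRegularTransnormal

variable {F : FinslerStructure n M} {f : M → ℝ} {𝔟 : ℝ → ℝ} {a b : ℝ}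
  (h : F.IsRegularTransnormal f 𝔟 a b)

include h

theorem contDiffOn_chart (p : M) :
    ContDiffOn ℝ ∞ (fun x => f ((extChartAt (𝓡 n) p).symm x)) (extChartAt (𝓡 n) p).target := by
  rw [← contMDiffOn_iff_contDiffOn]
  exact h.transnormal.smooth.comp_contMDiffOn (contMDiffOn_extChartAt_symm p)

theorem isOpen_regularRegion (p : M) : IsOpen (regularRegion n f a b p) :=
  (h.contDiffOn_chart p).continuousOn.isOpen_inter_preimage (isOpen_extChartAt_target p) isOpen_Ioo

theorem isMinkowskiFamily_regularRegion (p : M) :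
    IsMinkowskiFamily (F.locNorm p) (regularRegion n f a b p) :=
  (F.isMinkowskiFamily_locNorm p).mono inter_subset_left (h.isOpen_regularRegion p)

theorem contDiffOn_regularRegion (p : M) :
    ContDiffOn ℝ ∞ (fun x => f ((extChartAt (𝓡 n) p).symm x)) (regularRegion n f a b p) :=
  (h.contDiffOn_chart p).mono inter_subset_left

theorem exists_gradient_chart (p : M) : ∃ Y : EuclideanSpace ℝ (Fin n) → EuclideanSpace ℝ (Fin n),
    ∀ x ∈ (extChartAt (𝓡 n) p).target,
      (∀ v, minkowskiLegendre (F.locNorm p x) (Y x) v =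
        fderiv ℝ (fun x => f ((extChartAt (𝓡 n) p).symm x)) x v) ∧
      F.locNorm p x (Y x) ^ 2 = 𝔟 (f ((extChartAt (𝓡 n) p).symm x)) := by
  let φ := extChartAt (𝓡 n) p
  choose y hlegendre hnorm using h.transnormal.gradient
  refine ⟨fun x => vecCoord p ⟨φ.symm x, y (φ.symm x)⟩, fun x hx => ?_⟩
  have hq : φ.symm x ∈ φ.source := φ.map_target hx
  have hx' : φ (φ.symm x) = x := φ.right_inv hx
  refine ⟨fun v => ?_, by rw [← hnorm (φ.symm x), ← F.locNorm_vecCoord hq, hx']⟩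
  have hgrad := hlegendre (φ.symm x) ((coordEquiv hq).symm v)
  have hchart := differential_eq_fderiv_chart hq (h.mdifferentiableAt (φ.symm x))
    ((coordEquiv hq).symm v)
  rw [F.legendre_eq_minkowskiLegendre hq] at hgrad
  rw [vecCoord_eq_coordEquiv hq ((coordEquiv hq).symm v), ContinuousLinearEquiv.apply_symm_apply,
    hx'] at hgrad hchart
  exact hgrad.symm.trans hchart

theorem contDiffAt_speed {c : ℝ} (hc : c ∈ Ioo a b) : ContDiffAt ℝ ∞ 𝔟 c := by
  obtain ⟨p, rfl⟩ := h.exists_eq (Ioo_subset_Icc_self hc)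
  obtain ⟨Y, hY⟩ := h.exists_gradient_chart p
  let fc : EuclideanSpace ℝ (Fin n) → ℝ := fun x => f ((extChartAt (𝓡 n) p).symm x)
  let x₀ := extChartAt (𝓡 n) p p
  have hopen := h.isOpen_regularRegion p
  have hfam := h.isMinkowskiFamily_regularRegion p
  have hfc := h.contDiffOn_regularRegion p
  have hx₀ : x₀ ∈ regularRegion n f a b p := chart_mem_regularRegion (mem_extChartAt_source p) hc
  have hfx₀ : fc x₀ = f p := congrArg f ((extChartAt (𝓡 n) p).left_inv (mem_extChartAt_source p))
  have hpos {x} (hx : x ∈ regularRegion n f a b p) : 0 < F.locNorm p x (Y x) ^ 2 :=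
    (hY x hx.1).2 ▸ h.pos _ hx.2
  have hY_ne_zero : ∀ x ∈ regularRegion n f a b p, Y x ≠ 0 := fun x hx hzero => by
    simpa only [hzero, (hfam.norm x hx).map_zero, zero_pow two_ne_zero, lt_irrefl] using hpos hx
  have hYsmooth : ContDiffOn ℝ ∞ Y (regularRegion n f a b p) := hfam.contDiffOn_of_legendre
    ((contDiffOn_infty_iff_fderiv_of_isOpen hopen).1 hfc).2 hY_ne_zero fun x hx => (hY x hx.1).1
  have hfc' : fderiv ℝ fc x₀ ≠ 0 := fun hzero => (hpos hx₀).ne' <| by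
    rw [← (hfam.norm x₀ hx₀).legendre_self, (hY x₀ hx₀.1).1]
    exact congrArg (fun A => A (Y x₀)) hzero
  have hphase : (x₀, Y x₀) ∈ regularRegion n f a b p ×ˢ ({0}ᶜ : Set (EuclideanSpace ℝ (Fin n))) :=
    ⟨hx₀, hY_ne_zero x₀ hx₀⟩
  have hnorm : ContDiffAt ℝ ∞ (fun x => F.locNorm p x (Y x) ^ 2) x₀ :=
    ((hfam.smooth.contDiffAt (hfam.isOpen_phase.mem_nhds hphase)).comp x₀
      (contDiffAt_id.prodMk (hYsmooth.contDiffAt (hopen.mem_nhds hx₀)))).pow 2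
  rw [← hfx₀]
  refine contDiffAt_of_contDiffAt_comp (by simp) (hfc.contDiffAt (hopen.mem_nhds hx₀)) hfc'
    (hnorm.congr_of_eventuallyEq ?_)
  filter_upwards [hopen.mem_nhds hx₀] with x hx using (hY x hx.1).2.symm

variable [ConnectedSpace M]

theorem contDiffOn_travelTime : ContDiffOn ℝ ∞ (travelTime 𝔟 a) (Ioo a b) := by
  rw [contDiffOn_infty_iff_deriv_of_isOpen isOpen_Ioo]
  refine ⟨fun c hc => (h.hasDerivAt_travelTime hc).differentiableAt.differentiableWithinAt, ?_⟩
  have hslowness : ContDiffOn ℝ ∞ (fun s => 1 / √(𝔟 s)) (Ioo a b) := contDiffOn_const.div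
    (ContDiffOn.sqrt (fun c hc => (h.contDiffAt_speed hc).contDiffWithinAt)
      fun c hc => (h.pos c hc).ne') fun c hc => (Real.sqrt_pos.2 (h.pos c hc)).ne'
  exact hslowness.congr fun c hc => (h.hasDerivAt_travelTime hc).deriv

theorem exists_isFinslerEikonal (p : M) :
    ∃ X, IsFinslerEikonal (F.locNorm p) (regularRegion n f a b p)
      (fun x => arrival 𝔟 a f ((extChartAt (𝓡 n) p).symm x)) X := by
  obtain ⟨Y, hY⟩ := h.exists_gradient_chart p
  let fc : EuclideanSpace ℝ (Fin n) → ℝ := fun x => f ((extChartAt (𝓡 n) p).symm x)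
  have hfam := h.isMinkowskiFamily_regularRegion p
  have hfc := h.contDiffOn_regularRegion p
  have hpos {x} (hx : x ∈ regularRegion n f a b p) : 0 < √(𝔟 (fc x)) :=
    Real.sqrt_pos.2 (h.pos _ hx.2)
  refine ⟨fun x => (√(𝔟 (fc x)))⁻¹ • Y x, hfam,
    h.contDiffOn_travelTime.comp hfc fun x hx => hx.2, fun x hx => ?_, fun x hx v => ?_⟩
  · have hnorm : √(𝔟 (fc x)) = F.locNorm p x (Y x) := by
      rw [← (hY x hx.1).2, Real.sqrt_sq ((hfam.norm x hx).nonneg _)]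
    rw [(hfam.norm x hx).homogeneous _ _ (inv_pos.2 (hpos hx)), ← hnorm,
      inv_mul_cancel₀ (hpos hx).ne']
  · have hfc' : HasFDerivAt fc (fderiv ℝ fc x) x := ((hfc.contDiffAt
      ((h.isOpen_regularRegion p).mem_nhds hx)).differentiableAt (by simp)).hasFDerivAt
    have hchain := ((h.hasDerivAt_travelTime hx.2).comp_hasFDerivAt x hfc').fderiv
    rw [(hfam.norm x hx).legendre_smul_left (inv_pos.2 (hpos hx)), (hY x hx.1).1, ← one_div]
    exact (congrArg (fun A => A v) hchain).symm

end IsRegularTransnormal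

end FinslerStructure

namespace IsFinslerEikonal

variable {E : Type*} [NormedAddCommGroup E] [NormedSpace ℝ E] {N : E → E → ℝ} {V : Set E}
  {ρ : E → ℝ} {X : E → E} (h : IsFinslerEikonal N V ρ X)

include h

theorem sub_eq_of_integralCurve {α : ℝ → E} {s t : ℝ}
    (hα : ∀ u ∈ uIcc s t, HasDerivAt α (X (α u)) u ∧ α u ∈ V) : ρ (α t) - ρ (α s) = t - s := by
  have hderiv : ∀ u ∈ uIcc s t, HasDerivAt (ρ ∘ α) 1 u := fun u hu => by
    have hρ := ((h.smooth_fun.contDiffAt (h.isOpen.mem_nhds (hα u hu).2)).differentiableAt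
      (by simp)).hasFDerivAt.comp_hasDerivAt u (hα u hu).1
    rwa [h.fderiv_gradient (hα u hu).2] at hρ
  simpa using (intervalIntegral.integral_eq_sub_of_hasDerivAt hderiv (by simp)).symm

variable [FiniteDimensional ℝ E]

theorem exists_integralCurve {x : E} (hx : x ∈ V) : ∃ ε > 0, ∃ α : ℝ → E, α 0 = x ∧
    ∀ t ∈ Ioo (-ε) ε, HasDerivAt α (X (α t)) t ∧ α t ∈ V := by
  have : CompleteSpace E := FiniteDimensional.complete ℝ E
  have hX : ContDiffAt ℝ 1 X x :=
    (h.contDiffOn_gradient.contDiffAt (h.isOpen.mem_nhds hx)).of_le (by norm_cast)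
  obtain ⟨α, hα0, ε₁, hε₁, hα⟩ :=
    hX.exists_forall_mem_closedBall_exists_eq_forall_mem_Ioo_hasDerivAt₀ 0
  simp only [zero_sub, zero_add] at hα
  have hα_cont : ContinuousAt α 0 := (hα 0 ⟨by linarith, hε₁⟩).continuousAt
  obtain ⟨ε₂, hε₂, hαV⟩ := Metric.mem_nhds_iff.1
    (hα_cont.preimage_mem_nhds (by rw [hα0]; exact h.isOpen.mem_nhds hx))
  refine ⟨min ε₁ ε₂, lt_min hε₁ hε₂, α, hα0, fun t ht => ?_⟩
  have ht' : |t| < min ε₁ ε₂ := abs_lt.2 ht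
  exact ⟨hα t (abs_lt.1 (ht'.trans_le (min_le_left _ _))),
    hαV (mem_ball_zero_iff.2 (ht'.trans_le (min_le_right _ _)))⟩

theorem contDiffOn_integralCurve {α : ℝ → E} {s t : ℝ}
    (hα : ∀ u ∈ Icc s t, HasDerivAt α (X (α u)) u ∧ α u ∈ V) : ContDiffOn ℝ ∞ α (Icc s t) :=
  ODE.contDiffOn_enat_Icc_of_hasDerivWithinAt (n := ⊤) (f := fun _ => X) (u := V)
    (h.contDiffOn_gradient.comp contDiffOn_snd fun _ hz => hz.2)
    (fun u hu => (hα u hu).1.hasDerivWithinAt) fun u hu => (hα u hu).2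

end IsFinslerEikonal

namespace FinslerStructure

variable {n : ℕ} {M : Type*} [TopologicalSpace M]
  [ChartedSpace (EuclideanSpace ℝ (Fin n)) M] [IsManifold (𝓡 n) ∞ M]

theorem dist_le_of_integralCurve (F : FinslerStructure n M) {p : M}
    {V : Set (EuclideanSpace ℝ (Fin n))} (hV : V ⊆ (extChartAt (𝓡 n) p).target)
    {ρ : EuclideanSpace ℝ (Fin n) → ℝ} {X : EuclideanSpace ℝ (Fin n) → EuclideanSpace ℝ (Fin n)}
    (hX : IsFinslerEikonal (F.locNorm p) V ρ X) {α : ℝ → EuclideanSpace ℝ (Fin n)} {s t : ℝ}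
    (hst : s ≤ t) (hα : ∀ u ∈ Icc s t, HasDerivAt α (X (α u)) u ∧ α u ∈ V) :
    F.dist ((extChartAt (𝓡 n) p).symm (α s)) ((extChartAt (𝓡 n) p).symm (α t)) ≤
      ENNReal.ofReal (t - s) := by
  have hsmooth : ContMDiffOn 𝓘(ℝ, ℝ) (𝓡 n) ∞ (fun u => (extChartAt (𝓡 n) p).symm (α u))
      (Icc s t) := (contMDiffOn_extChartAt_symm p).comp (hX.contDiffOn_integralCurve hα).contMDiffOn
        fun u hu => hV (hα u hu).2
  refine (F.dist_le_length (.smooth hst hsmooth)).trans ?_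
  rw [length_eq_Ioo]
  refine (setLIntegral_mono' (g := fun _ => 1) measurableSet_Ioo fun u hu => ?_).trans (by simp)
  obtain ⟨hderiv, hmem⟩ := hα u (Ioo_subset_Icc_self hu)
  rw [F.toFun_velocity_chart_symm hderiv.differentiableAt (hV hmem), hderiv.deriv,
    hX.norm_gradient _ hmem, ENNReal.ofReal_one]

namespace IsRegularTransnormal

variable [ConnectedSpace M] {F : FinslerStructure n M} {f : M → ℝ} {𝔟 : ℝ → ℝ} {a b : ℝ}

theorem exists_local_curve (h : F.IsRegularTransnormal f 𝔟 a b) {q : M} (hq : f q ∈ Ioo a b) :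
    ∃ ε > 0, ∃ c : ℝ → M, c 0 = q ∧
      (∀ t ∈ Ioo (-ε) ε, arrival 𝔟 a f (c t) = arrival 𝔟 a f q + t) ∧
      ∀ s ∈ Ioo (-ε) ε, ∀ t ∈ Ioo (-ε) ε, s ≤ t → F.dist (c s) (c t) ≤ ENNReal.ofReal (t - s) := by
  obtain ⟨X, hX⟩ := h.exists_isFinslerEikonal q
  obtain ⟨ε, hε, α, hα0, hα⟩ :=
    hX.exists_integralCurve (chart_mem_regularRegion (mem_extChartAt_source q) hq)
  have hc0 : (extChartAt (𝓡 n) q).symm (α 0) = q := by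
    rw [hα0, (extChartAt (𝓡 n) q).left_inv (mem_extChartAt_source q)]
  refine ⟨ε, hε, fun t => (extChartAt (𝓡 n) q).symm (α t), hc0, fun t ht => ?_,
    fun s hs t ht hst => F.dist_le_of_integralCurve inter_subset_left hX hst fun u hu =>
      hα u (ordConnected_Ioo.out hs ht hu)⟩
  have hzero : (0 : ℝ) ∈ Ioo (-ε) ε := ⟨neg_lt_zero.2 hε, hε⟩
  have hsub := hX.sub_eq_of_integralCurve fun u hu =>
    hα u (ordConnected_Ioo.uIcc_subset hzero ht hu)
  rw [hc0] at hsub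
  linarith

end IsRegularTransnormal

end FinslerStructure

/-! ### Maximal calibrated sets -/

section Calibrated

/-- A set on which the distance between any two points is at most the increase of `ρ`, and on which
`ρ` takes all values between any two of its values. For the arrival time `ρ` these are the traces of
the wave rays, described without reference to a parametrization so that Zorn's lemma applies. -/
structure IsCalibrated {X : Type*} (D : X → X → ℝ≥0∞) (ρ : X → ℝ) (C : Set X) : Prop where
  dist_le : ∀ x ∈ C, ∀ y ∈ C, ρ x ≤ ρ y → D x y ≤ ENNReal.ofReal (ρ y - ρ x)
  exists_eq : ∀ x ∈ C, ∀ y ∈ C, ∀ r, ρ x ≤ r → r ≤ ρ y → ∃ z ∈ C, ρ z = r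

namespace IsCalibrated

variable {X : Type*} {D : X → X → ℝ≥0∞} {ρ : X → ℝ} {C : Set X}

theorem singleton {x : X} (hself : D x x = 0) : IsCalibrated D ρ {x} where
  dist_le := by
    rintro y rfl z rfl -
    exact hself.trans_le bot_le
  exists_eq := by
    rintro y rfl z rfl r hyr hrz
    exact ⟨z, rfl, le_antisymm hyr hrz⟩

theorem reverse (h : IsCalibrated D ρ C) : IsCalibrated (fun x y => D y x) (fun x => -ρ x) C where
  dist_le x hx y hy hxy := by
    simpa only [neg_sub_neg] using h.dist_le y hy x hx (neg_le_neg_iff.1 hxy)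
  exists_eq x hx y hy r hxr hry := by
    obtain ⟨z, hz, hzr⟩ := h.exists_eq y hy x hx (-r) (le_neg_of_le_neg hry) (neg_le.1 hxr)
    exact ⟨z, hz, by rw [hzr, neg_neg]⟩

theorem maximal_reverse (h : Maximal (IsCalibrated D ρ) C) :
    Maximal (IsCalibrated (fun x y => D y x) (fun x => -ρ x)) C :=
  ⟨h.prop.reverse, fun _ hC' hle => h.2 (by simpa only [neg_neg] using hC'.reverse) hle⟩

theorem exists_maximal (h : IsCalibrated D ρ C) :
    ∃ C', C ⊆ C' ∧ Maximal (IsCalibrated D ρ) C' := by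
  refine zorn_subset_nonempty {C | IsCalibrated D ρ C} (fun c hc hchain _ => ?_) C h
  have hcommon : ∀ x ∈ ⋃₀ c, ∀ y ∈ ⋃₀ c, ∃ s ∈ c, x ∈ s ∧ y ∈ s := by
    rintro x ⟨s, hs, hxs⟩ y ⟨t, ht, hyt⟩
    rcases hchain.total hs ht with hst | hts
    · exact ⟨t, ht, hst hxs, hyt⟩
    · exact ⟨s, hs, hxs, hts hyt⟩
  refine ⟨⋃₀ c, ⟨fun x hx y hy => ?_, fun x hx y hy r hxr hry => ?_⟩,
    fun s hs => subset_sUnion_of_mem hs⟩ <;> obtain ⟨s, hs, hxs, hys⟩ := hcommon x hx y hy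
  · exact (hc hs).dist_le x hxs y hys
  · obtain ⟨z, hz, hzr⟩ := (hc hs).exists_eq x hxs y hys r hxr hry
    exact ⟨z, ⟨s, hs, hz⟩, hzr⟩

theorem insert_limit (h : IsCalibrated D ρ C) {z : X} (hself : D z z = 0)
    (hlt : ∀ y ∈ C, ρ y < ρ z) (hdist : ∀ y ∈ C, D y z ≤ ENNReal.ofReal (ρ z - ρ y))
    (happrox : ∀ r < ρ z, ∃ y ∈ C, r < ρ y) : IsCalibrated D ρ (insert z C) where
  dist_le := by
    rintro x (rfl | hx) y (rfl | hy) hxy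
    · exact hself.trans_le bot_le
    · exact absurd (hlt y hy) hxy.not_gt
    · exact hdist x hx
    · exact h.dist_le x hx y hy hxy
  exists_eq x hx y hy r hxr hry := by
    have hle : ∀ w ∈ insert z C, ρ w ≤ ρ z :=
      forall_mem_insert.2 ⟨le_rfl, fun w hw => (hlt w hw).le⟩
    rcases (hry.trans (hle y hy)).eq_or_lt with rfl | hr
    · exact ⟨z, mem_insert z C, rfl⟩
    have hxC : x ∈ C := hx.resolve_left fun hxz => (hxz ▸ hxr).not_gt hr
    obtain ⟨w, hw, hrw⟩ := happrox r hr
    obtain ⟨v, hv, hvr⟩ := h.exists_eq x hxC w hw r hxr hrw.le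
    exact ⟨v, mem_insert_of_mem z hv, hvr⟩

theorem union_image (h : IsCalibrated D ρ C) (htri : ∀ x y z, D x z ≤ D x y + D y z) {z : X}
    (hz : z ∈ C) (hle : ∀ y ∈ C, ρ y ≤ ρ z) {ε : ℝ} {c : ℝ → X} (hc0 : c 0 = z)
    (hcρ : ∀ t, 0 ≤ t → t < ε → ρ (c t) = ρ z + t)
    (hcD : ∀ s t, 0 ≤ s → s ≤ t → t < ε → D (c s) (c t) ≤ ENNReal.ofReal (t - s)) :
    IsCalibrated D ρ (C ∪ c '' Ico 0 ε) where
  dist_le := by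
    rintro x (hx | ⟨s, hs, rfl⟩) y (hy | ⟨t, ht, rfl⟩) hxy
    · exact h.dist_le x hx y hy hxy
    · calc D x (c t) ≤ D x z + D (c 0) (c t) := hc0 ▸ htri x z (c t)
        _ ≤ ENNReal.ofReal (ρ z - ρ x) + ENNReal.ofReal (t - 0) :=
            add_le_add (h.dist_le x hx z hz (hle x hx)) (hcD 0 t le_rfl ht.1 ht.2)
        _ = ENNReal.ofReal (ρ (c t) - ρ x) := by
            rw [← ENNReal.ofReal_add (sub_nonneg.2 (hle x hx)) (sub_nonneg.2 ht.1),
              hcρ t ht.1 ht.2]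
            ring_nf
    · have hs0 : s = 0 := by linarith [hcρ s hs.1 hs.2, hle y hy, hs.1]
      rw [hs0, hc0] at hxy ⊢
      exact h.dist_le z hz y hy hxy
    · rw [hcρ s hs.1 hs.2, hcρ t ht.1 ht.2] at hxy ⊢
      rw [add_sub_add_left_eq_sub]
      exact hcD s t hs.1 ((add_le_add_iff_left _).1 hxy) ht.2
  exists_eq x hx y hy r hxr hry := by
    rcases le_or_gt r (ρ z) with hr | hr
    · rcases hx with hx | ⟨s, hs, rfl⟩
      · obtain ⟨w, hw, hwr⟩ := h.exists_eq x hx z hz r hxr hr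
        exact ⟨w, Or.inl hw, hwr⟩
      · exact ⟨z, Or.inl hz, by linarith [hcρ s hs.1 hs.2, hs.1]⟩
    · rcases hy with hy | ⟨t, ht, rfl⟩
      · exact absurd (hry.trans (hle y hy)) hr.not_ge
      · have hrε : r - ρ z < ε := by linarith [hcρ t ht.1 ht.2, ht.2]
        exact ⟨c (r - ρ z), Or.inr ⟨r - ρ z, ⟨(sub_pos.2 hr).le, hrε⟩, rfl⟩,
          by rw [hcρ _ (sub_pos.2 hr).le hrε, add_sub_cancel]⟩

section Topology

variable [TopologicalSpace X] (htri : ∀ x y z, D x z ≤ D x y + D y z)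
  (hnear : ∀ z, ∀ ε > 0, ∀ᶠ x in 𝓝 z, D x z < ε) (hρ : Continuous ρ)
  (hcomplete : ∀ x : ℕ → X,
    (∀ ε : ℝ≥0∞, 0 < ε → ∃ N, ∀ i j, N ≤ i → i ≤ j → D (x i) (x j) < ε) →
    ∃ p, Tendsto x atTop (𝓝 p))

include htri hnear hρ hcomplete

theorem exists_limit (h : IsCalibrated D ρ C) {β : ℝ} (hβ : IsLUB (ρ '' C) β) (hne : C.Nonempty)
    (hlt : ∀ x ∈ C, ρ x < β) :
    ∃ z, ρ z = β ∧ ∀ y ∈ C, D y z ≤ ENNReal.ofReal (β - ρ y) := by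
  obtain ⟨u, hu_mono, hu_le, hu_lim, hu_mem⟩ := hβ.exists_seq_monotone_tendsto (hne.image ρ)
  choose x hxC hxu using hu_mem
  have hcauchy : ∀ ε : ℝ≥0∞, 0 < ε → ∃ N, ∀ i j, N ≤ i → i ≤ j → D (x i) (x j) < ε := by
    intro ε hε
    have hgap : Tendsto (fun i => ENNReal.ofReal (β - u i)) atTop (𝓝 0) := by
      simpa only [sub_self, ENNReal.ofReal_zero] using
        ENNReal.tendsto_ofReal ((tendsto_const_nhds (x := β)).sub hu_lim)
    obtain ⟨N, hN⟩ := (hgap.eventually_lt_const hε).exists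
    refine ⟨N, fun i j hNi hij => lt_of_le_of_lt ?_ hN⟩
    refine (h.dist_le _ (hxC i) _ (hxC j) ?_).trans (ENNReal.ofReal_le_ofReal ?_) <;>
      rw [hxu, hxu]
    · exact hu_mono hij
    · linarith [hu_le j, hu_mono hNi]
  obtain ⟨z, hz⟩ := hcomplete x hcauchy
  have hρz : ρ z = β := by
    refine tendsto_nhds_unique ((hρ.tendsto z).comp hz) ?_
    simpa only [Function.comp_def, hxu] using hu_lim
  refine ⟨z, hρz, fun y hy => le_of_forall_pos_le_add fun ε hε => ?_⟩
  obtain ⟨i, hnear_i, hy_lt⟩ :=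
    ((hz.eventually (hnear z ε hε)).and (hu_lim.eventually_const_lt (hlt y hy))).exists
  refine (htri y (x i) z).trans (add_le_add ((h.dist_le y hy _ (hxC i) ?_).trans ?_) hnear_i.le)
  · exact (hxu i).symm ▸ hy_lt.le
  · exact ENNReal.ofReal_le_ofReal (sub_le_sub_right ((hxu i).symm ▸ hu_le i) _)

variable (hself : ∀ x, D x x = 0)

include hself

theorem exists_eq_of_isLUB (hmax : Maximal (IsCalibrated D ρ) C) {β : ℝ} (hβ : IsLUB (ρ '' C) β)
    (hne : C.Nonempty) : ∃ z ∈ C, ρ z = β := by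
  by_contra! hnot
  have hlt : ∀ x ∈ C, ρ x < β := fun x hx => (hβ.1 ⟨x, hx, rfl⟩).lt_of_ne (hnot x hx)
  obtain ⟨z, rfl, hdist⟩ := exists_limit htri hnear hρ hcomplete hmax.prop hβ hne hlt
  have hinsert : IsCalibrated D ρ (insert z C) :=
    hmax.prop.insert_limit (hself z) hlt hdist fun r hr => by
      obtain ⟨_, ⟨y, hy, rfl⟩, hry⟩ := (lt_isLUB_iff hβ).1 hr
      exact ⟨y, hy, hry⟩
  exact hnot z (hmax.le_of_ge hinsert (subset_insert z C) (mem_insert z C)) rfl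

theorem exists_eq_of_maximal {R : ℝ} (hR : ∀ x, ρ x ≤ R) (hmax : Maximal (IsCalibrated D ρ) C)
    {x₁ : X} (hx₁ : x₁ ∈ C)
    (hext : ∀ z, ρ x₁ ≤ ρ z → ρ z < R → ∃ ε > 0, ∃ c : ℝ → X, c 0 = z ∧
      (∀ t, 0 ≤ t → t < ε → ρ (c t) = ρ z + t) ∧
      ∀ s t, 0 ≤ s → s ≤ t → t < ε → D (c s) (c t) ≤ ENNReal.ofReal (t - s)) :
    ∃ z ∈ C, ρ z = R := by
  have hβ : IsLUB (ρ '' C) (sSup (ρ '' C)) :=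
    isLUB_csSup ⟨_, x₁, hx₁, rfl⟩ ⟨R, forall_mem_image.2 fun x _ => hR x⟩
  obtain ⟨z, hzC, hz⟩ := exists_eq_of_isLUB htri hnear hρ hcomplete hself hmax hβ ⟨x₁, hx₁⟩
  have hle : ∀ x ∈ C, ρ x ≤ ρ z := fun x hx => hz ▸ hβ.1 ⟨x, hx, rfl⟩
  refine ⟨z, hzC, (hR z).eq_of_not_lt fun hlt => ?_⟩
  obtain ⟨ε, hε, c, hc0, hcρ, hcD⟩ := hext z (hle x₁ hx₁) hlt
  have hmem : c (ε / 2) ∈ C :=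
    hmax.le_of_ge (hmax.prop.union_image htri hzC hle hc0 hcρ hcD) subset_union_left
      (Or.inr ⟨ε / 2, ⟨(half_pos hε).le, half_lt_self hε⟩, rfl⟩)
  linarith [hle _ hmem, hcρ (ε / 2) (half_pos hε).le (half_lt_self hε)]

end Topology

end IsCalibrated

end Calibrated

namespace FinslerStructure

variable {n : ℕ} {M : Type*} [TopologicalSpace M]
  [ChartedSpace (EuclideanSpace ℝ (Fin n)) M] [IsManifold (𝓡 n) ∞ M]

/-- A curve on `[α, β]` along which `ρ` is the parameter and the distance is at most the elapsed
time. For the arrival time `ρ` these are, up to regularity, the wave rays. -/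
structure IsCalibratedCurve (F : FinslerStructure n M) (ρ : M → ℝ) (γ : ℝ → M) (α β : ℝ) :
    Prop where
  apply_eq : ∀ t ∈ Icc α β, ρ (γ t) = t
  dist_le : ∀ s t, α ≤ s → s ≤ t → t ≤ β → F.dist (γ s) (γ t) ≤ ENNReal.ofReal (t - s)

section

variable {F : FinslerStructure n M}

variable (F) in
theorem eventually_dist_lt_right (q : M) {ε : ℝ≥0∞} (hε : 0 < ε) : ∀ᶠ x in 𝓝 q, F.dist q x < ε :=
  (Continuous.prodMk_right (Y := M) q).continuousAt.eventually (F.eventually_dist_lt q hε)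

variable (F) in
theorem eventually_dist_lt_left (q : M) {ε : ℝ≥0∞} (hε : 0 < ε) : ∀ᶠ x in 𝓝 q, F.dist x q < ε :=
  (Continuous.prodMk_left (X := M) q).continuousAt.eventually (F.eventually_dist_lt q hε)

theorem dist_le_of_tendsto {ι : Type*} {l : Filter ι} [l.NeBot]
    {u v : ι → M} {x y : M} (hu : Tendsto u l (𝓝 x)) (hv : Tendsto v l (𝓝 y)) {r : ℝ≥0∞}
    (huv : ∀ᶠ i in l, F.dist (u i) (v i) ≤ r) : F.dist x y ≤ r := by
  refine le_of_forall_pos_le_add fun ε hε => ?_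
  have hε2 : 0 < ε / 2 := ENNReal.half_pos hε.ne'
  obtain ⟨i, ⟨hxu, hvy⟩, hi⟩ := (((hu.eventually (F.eventually_dist_lt_right x hε2)).and
    (hv.eventually (F.eventually_dist_lt_left y hε2))).and huv).exists
  calc F.dist x y ≤ F.dist x (u i) + F.dist (u i) y := F.dist_triangle _ _ _
    _ ≤ F.dist x (u i) + (F.dist (u i) (v i) + F.dist (v i) y) := by
        gcongr; exact F.dist_triangle _ _ _
    _ ≤ ε / 2 + (r + ε / 2) := by gcongr
    _ = r + ε := by rw [add_left_comm, ENNReal.add_halves]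

theorem tendsto_of_tendsto_dist [T2Space M] {ι : Type*} {l : Filter ι} {u v : ι → M} {q : M}
    (hu : Tendsto u l (𝓝 q)) (huv : Tendsto (fun i => F.dist (u i) (v i)) l (𝓝 0)) :
    Tendsto v l (𝓝 q) := by
  refine tendsto_def.2 fun U hU => ?_
  obtain ⟨W, hW, δ, hδ, hWδ⟩ := F.exists_nhds_of_dist_lt hU
  filter_upwards [hu.eventually_mem hW, huv.eventually_lt_const (ENNReal.ofReal_pos.2 hδ)]
    with i hi hdist using (hWδ _ _ (Or.inl hi) hdist).2

namespace IsCalibratedCurve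

variable {ρ : M → ℝ} {γ : ℝ → M} {α β : ℝ}

theorem mono (hγ : F.IsCalibratedCurve ρ γ α β) {α' β' : ℝ} (hα : α ≤ α') (hβ : β' ≤ β) :
    F.IsCalibratedCurve ρ γ α' β' where
  apply_eq t ht := hγ.apply_eq t ⟨hα.trans ht.1, ht.2.trans hβ⟩
  dist_le s t hs hst ht := hγ.dist_le s t (hα.trans hs) hst (ht.trans hβ)

theorem isCalibrated_image (hγ : F.IsCalibratedCurve ρ γ α β) :
    IsCalibrated F.dist ρ (γ '' Icc α β) where
  dist_le := by
    rintro _ ⟨s, hs, rfl⟩ _ ⟨t, ht, rfl⟩ hst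
    rw [hγ.apply_eq s hs, hγ.apply_eq t ht] at hst ⊢
    exact hγ.dist_le s t hs.1 hst ht.2
  exists_eq := by
    rintro _ ⟨s, hs, rfl⟩ _ ⟨t, ht, rfl⟩ r hsr hrt
    rw [hγ.apply_eq s hs] at hsr
    rw [hγ.apply_eq t ht] at hrt
    have hr : r ∈ Icc α β := ⟨hs.1.trans hsr, hrt.trans ht.2⟩
    exact ⟨γ r, ⟨r, hr, rfl⟩, hγ.apply_eq r hr⟩

theorem of_isCalibrated [T2Space M] {C : Set M} (hC : IsCalibrated F.dist ρ C) {x y : M}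
    (hx : x ∈ C) (hy : y ∈ C) : ∃ γ, F.IsCalibratedCurve ρ γ (ρ x) (ρ y) ∧
      ∀ z ∈ C, ρ z ∈ Icc (ρ x) (ρ y) → γ (ρ z) = z := by
  have : Nonempty M := ⟨x⟩
  have hexists : ∀ t ∈ Icc (ρ x) (ρ y), ∃ z, z ∈ C ∧ ρ z = t :=
    fun t ht => hC.exists_eq x hx y hy t ht.1 ht.2
  choose! γ hγC hγρ using hexists
  refine ⟨γ, ⟨hγρ, fun s t hs hst ht => ?_⟩, fun z hz hzρ => ?_⟩
  · have hs' : s ∈ Icc (ρ x) (ρ y) := ⟨hs, hst.trans ht⟩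
    have ht' : t ∈ Icc (ρ x) (ρ y) := ⟨hs.trans hst, ht⟩
    have hdist := hC.dist_le _ (hγC s hs') _ (hγC t ht')
    rw [hγρ s hs', hγρ t ht'] at hdist
    exact hdist hst
  · have hdist := hC.dist_le _ (hγC _ hzρ) _ hz (hγρ _ hzρ).le
    rw [hγρ _ hzρ, sub_self, ENNReal.ofReal_zero] at hdist
    exact F.eq_of_dist_eq_zero (nonpos_iff_eq_zero.1 hdist)

theorem of_tendsto {ι : Type*} {l : Filter ι} [l.NeBot] (hρ : Continuous ρ) {G : ι → ℝ → M}
    (hG : ∀ᶠ i in l, F.IsCalibratedCurve ρ (G i) α β)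
    (hlim : ∀ t ∈ Icc α β, Tendsto (fun i => G i t) l (𝓝 (γ t))) :
    F.IsCalibratedCurve ρ γ α β where
  apply_eq t ht := by
    refine tendsto_nhds_unique ((hρ.tendsto _).comp (hlim t ht)) (tendsto_const_nhds.congr' ?_)
    filter_upwards [hG] with i hi using (hi.apply_eq t ht).symm
  dist_le s t hs hst ht := by
    refine dist_le_of_tendsto (hlim s ⟨hs, hst.trans ht⟩) (hlim t ⟨hs.trans hst, ht⟩) ?_
    filter_upwards [hG] with i hi using hi.dist_le s t hs hst ht

theorem exists_of_tendsto_right [T2Space M] {ι : Type*} {𝒰 : Ultrafilter ι} (hρ : Continuous ρ)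
    (hαβ : α < β) {G : ι → ℝ → M} (hG : ∀ᶠ i in 𝒰, F.IsCalibratedCurve ρ (G i) α β) {q : M}
    (hq : Tendsto (fun i => G i β) 𝒰 (𝓝 q)) :
    ∃ s ∈ Ioo α β, ∃ γ, F.IsCalibratedCurve ρ γ s β ∧ γ β = q := by
  have : Nonempty M := ⟨q⟩
  have : LocallyCompactSpace M := Manifold.locallyCompact_of_finiteDimensional (𝓡 n)
  obtain ⟨K, hK, hKq⟩ := exists_compact_mem_nhds q
  obtain ⟨W, hW, δ, hδ, hWδ⟩ := F.exists_nhds_of_dist_lt hKq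
  obtain ⟨s, hs, hsβ⟩ := exists_between (max_lt hαβ (sub_lt_self β hδ))
  have hmemK : ∀ t ∈ Icc s β, ∀ᶠ i in 𝒰, G i t ∈ K := fun t ht => by
    filter_upwards [hG, hq.eventually_mem hW] with i hi hiW
    refine (hWδ (G i t) (G i β) (Or.inr hiW) ((hi.dist_le t β ?_ ht.2 le_rfl).trans_lt ?_)).1
    · exact ((le_max_left _ _).trans_lt hs).le.trans ht.1
    · exact (ENNReal.ofReal_lt_ofReal_iff hδ).2 (by linarith [le_max_right α (β - δ), ht.1])
  have hlim : ∀ t ∈ Icc s β, ∃ z, Tendsto (fun i => G i t) 𝒰 (𝓝 z) := fun t ht => by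
    obtain ⟨z, -, hz⟩ := hK.ultrafilter_le_nhds (𝒰.map fun i => G i t : Ultrafilter M)
      (le_principal_iff.2 (hmemK t ht))
    exact ⟨z, hz⟩
  choose! γ hγ using hlim
  have hαs : α < s := (le_max_left _ _).trans_lt hs
  exact ⟨s, ⟨hαs, hsβ⟩, γ, of_tendsto hρ (hG.mono fun i hi => hi.mono hαs.le le_rfl) hγ,
    tendsto_nhds_unique (hγ β (right_mem_Icc.2 hsβ.le)) hq⟩

end IsCalibratedCurve

end

namespace IsRegularTransnormal

variable {F : FinslerStructure n M} {f : M → ℝ} {𝔟 : ℝ → ℝ} {a b : ℝ}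
  (h : F.IsRegularTransnormal f 𝔟 a b)

include h

theorem mem_closure_preimage_Ioo (hb : interior (f ⁻¹' {b}) = ∅) {q : M} (hq : f q = b) :
    q ∈ closure (f ⁻¹' Ioo a b) := by
  by_contra hq_far
  have hlevel : (closure (f ⁻¹' Ioo a b))ᶜ ∩ f ⁻¹' Ioi a ⊆ f ⁻¹' {b} := fun x ⟨hx, hax⟩ =>
    (h.mem_Icc x).2.eq_of_not_lt fun hxb => hx (subset_closure ⟨hax, hxb⟩)
  have hinterior := interior_maximal hlevel
    (isClosed_closure.isOpen_compl.inter (isOpen_Ioi.preimage h.continuous))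
  rw [hb] at hinterior
  exact hinterior ⟨hq_far, show a < f q from hq ▸ h.lt⟩

variable [ConnectedSpace M] {C : Set M}
  (hmax : Maximal (IsCalibrated F.dist (arrival 𝔟 a f)) C) {x : M}
  (hx : x ∈ C) (hreg : f x ∈ Ioo a b)

include hmax hx hreg

theorem exists_mem_arrival_eq_travelTime (hforward : F.ForwardComplete) :
    ∃ z ∈ C, arrival 𝔟 a f z = travelTime 𝔟 a b := by
  refine IsCalibrated.exists_eq_of_maximal F.dist_triangle
    (fun z _ hε => F.eventually_dist_lt_left z hε) h.continuous_arrival hforward F.dist_self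
    h.arrival_le hmax hx fun z hxz hz => ?_
  obtain ⟨ε, hε, c, hc0, hcρ, hcD⟩ := h.exists_local_curve
    (h.mem_Ioo_iff.2 ⟨(h.mem_Ioo_iff.1 hreg).1.trans_le hxz, hz⟩)
  exact ⟨ε, hε, c, hc0, fun t ht htε => hcρ t ⟨by linarith, htε⟩, fun s t hs hst ht =>
    hcD s ⟨by linarith, by linarith⟩ t ⟨by linarith, ht⟩ hst⟩

theorem exists_mem_arrival_eq_zero (hbackward : F.BackwardComplete) :
    ∃ z ∈ C, arrival 𝔟 a f z = 0 := by
  suffices ∃ z ∈ C, -arrival 𝔟 a f z = 0 by simpa only [neg_eq_zero] using this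
  refine IsCalibrated.exists_eq_of_maximal (D := fun x y => F.dist y x)
    (ρ := fun x => -arrival 𝔟 a f x)
    (fun x y z => (F.dist_triangle z y x).trans_eq (add_comm _ _))
    (fun z _ hε => F.eventually_dist_lt_right z hε) h.continuous_arrival.neg hbackward
    F.dist_self (fun x => neg_nonpos.2 (h.arrival_nonneg x)) (IsCalibrated.maximal_reverse hmax) hx
    fun z hxz hz => ?_
  obtain ⟨ε, hε, c, hc0, hcρ, hcD⟩ := h.exists_local_curve (q := z)
    (h.mem_Ioo_iff.2 ⟨neg_lt_zero.1 hz, (neg_le_neg_iff.1 hxz).trans_lt (h.mem_Ioo_iff.1 hreg).2⟩)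
  refine ⟨ε, hε, fun t => c (-t), by simpa only [neg_zero], fun t ht htε => ?_,
    fun s t hs hst ht => ?_⟩
  · simp only [hcρ (-t) ⟨by linarith, by linarith⟩, neg_add, neg_neg]
  · simpa only [neg_sub_neg] using
      hcD (-t) ⟨by linarith, by linarith⟩ (-s) ⟨by linarith, by linarith⟩ (neg_le_neg hst)

omit hmax

variable [T2Space M] (hforward : F.ForwardComplete) (hbackward : F.BackwardComplete)

include hforward hbackward

theorem exists_calibratedCurve (hC : IsCalibrated F.dist (arrival 𝔟 a f) C) :
    ∃ γ : ℝ → M, F.IsCalibratedCurve (arrival 𝔟 a f) γ 0 (travelTime 𝔟 a b) ∧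
      ∀ y ∈ C, γ (arrival 𝔟 a f y) = y := by
  obtain ⟨C', hCC', hmax⟩ := hC.exists_maximal
  obtain ⟨z₁, hz₁, hz₁_arrival⟩ := h.exists_mem_arrival_eq_travelTime hmax (hCC' hx) hreg hforward
  obtain ⟨z₀, hz₀, hz₀_arrival⟩ := h.exists_mem_arrival_eq_zero hmax (hCC' hx) hreg hbackward
  obtain ⟨γ, hγ, hγ_eq⟩ := IsCalibratedCurve.of_isCalibrated hmax.prop hz₀ hz₁
  rw [hz₀_arrival, hz₁_arrival] at hγ hγ_eq
  exact ⟨γ, hγ, fun y hy => hγ_eq y (hCC' hy) ⟨h.arrival_nonneg y, h.arrival_le y⟩⟩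

omit hx in
theorem exists_calibratedCurve_through :
    ∃ γ : ℝ → M, F.IsCalibratedCurve (arrival 𝔟 a f) γ 0 (travelTime 𝔟 a b) ∧
      γ (arrival 𝔟 a f x) = x := by
  obtain ⟨γ, hγ, hγ_eq⟩ := h.exists_calibratedCurve (mem_singleton x) hreg hforward hbackward
    (IsCalibrated.singleton (F.dist_self x))
  exact ⟨γ, hγ, hγ_eq x rfl⟩

omit hx hreg in
/- The extension argument needs a regular point, so a point of the last level set is reached by a
limit of the curves through nearby regular points; these are only controlled near their ends. -/
theorem exists_calibratedCurve_last (hb : interior (f ⁻¹' {b}) = ∅) {q : M} (hq : f q = b) :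
    ∃ γ : ℝ → M, F.IsCalibratedCurve (arrival 𝔟 a f) γ 0 (travelTime 𝔟 a b) ∧
      γ (travelTime 𝔟 a b) = q := by
  have : Nonempty M := ⟨q⟩
  have hρq : arrival 𝔟 a f q = travelTime 𝔟 a b := by rw [arrival, hq]
  have : (𝓝[f ⁻¹' Ioo a b] q).NeBot :=
    mem_closure_iff_nhdsWithin_neBot.1 (h.mem_closure_preimage_Ioo hb hq)
  let 𝒰 : Ultrafilter M := Ultrafilter.of (𝓝[f ⁻¹' Ioo a b] q)
  have h𝒰 : (𝒰 : Filter M) ≤ 𝓝[f ⁻¹' Ioo a b] q := Ultrafilter.of_le _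
  have h𝒰q : Tendsto id (𝒰 : Filter M) (𝓝 q) := h𝒰.trans nhdsWithin_le_nhds
  have h𝒰reg : ∀ᶠ x in (𝒰 : Filter M), f x ∈ Ioo a b := h𝒰 self_mem_nhdsWithin
  choose! G hG hGx using fun x (hx : f x ∈ Ioo a b) =>
    h.exists_calibratedCurve_through hx hforward hbackward
  have hgap : Tendsto (fun x => ENNReal.ofReal (travelTime 𝔟 a b - arrival 𝔟 a f x))
      (𝒰 : Filter M) (𝓝 0) := by
    simpa only [hρq, sub_self, ENNReal.ofReal_zero, Function.comp_def, id] using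
      ENNReal.tendsto_ofReal ((tendsto_const_nhds (x := travelTime 𝔟 a b)).sub
        ((h.continuous_arrival.tendsto q).comp h𝒰q))
  have hdist : Tendsto (fun x => F.dist x (G x (travelTime 𝔟 a b))) (𝒰 : Filter M) (𝓝 0) := by
    refine tendsto_of_tendsto_of_tendsto_of_le_of_le' tendsto_const_nhds hgap
      (Eventually.of_forall fun _ => bot_le) (h𝒰reg.mono fun x hx => ?_)
    simpa only [hGx x hx] using
      (hG x hx).dist_le _ _ (h.arrival_nonneg x) (h.arrival_le x) le_rfl
  obtain ⟨s, hs, γ, hγ, hγq⟩ := IsCalibratedCurve.exists_of_tendsto_right h.continuous_arrival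
    (h.travelTime_pos h.left_mem h.right_mem h.lt) (h𝒰reg.mono hG)
    (tendsto_of_tendsto_dist h𝒰q hdist)
  have hγs : arrival 𝔟 a f (γ s) = s := hγ.apply_eq s (left_mem_Icc.2 hs.2.le)
  obtain ⟨γ', hγ', hγ'_eq⟩ := h.exists_calibratedCurve (mem_image_of_mem γ (left_mem_Icc.2 hs.2.le))
    (h.mem_Ioo_iff.2 (hγs.symm ▸ hs)) hforward hbackward hγ.isCalibrated_image
  exact ⟨γ', hγ', hρq ▸ hγ'_eq q ⟨_, right_mem_Icc.2 hs.2.le, hγq⟩⟩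

end IsRegularTransnormal

end FinslerStructure

/-! ### Smoothness up to the end points -/

namespace Finsler

theorem le_of_forall_one_sub_mul_le {A B : ℝ} (h : ∀ η ∈ Ioo (0 : ℝ) 1, (1 - η) * A ≤ B) :
    A ≤ B := by
  have hlim : Tendsto (fun η : ℝ => (1 - η) * A) (𝓝[>] 0) (𝓝 ((1 - 0) * A)) :=
    (((continuous_const.sub continuous_id).mul continuous_const).tendsto 0).mono_left
      nhdsWithin_le_nhds
  rw [sub_zero, one_mul] at hlim
  exact le_of_tendsto hlim (eventually_of_mem (Ioo_mem_nhdsGT one_pos) h)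

theorem exists_Icc_mem_nhdsWithin_Icc {α β t : ℝ} (hαβ : α < β) (ht : t ∈ Icc α β) {s : Set ℝ}
    (hs : s ∈ 𝓝[Icc α β] t) :
    ∃ α' β', α ≤ α' ∧ α' < β' ∧ β' ≤ β ∧ t ∈ Icc α' β' ∧ Icc α' β' ⊆ s ∧
      Icc α' β' ∈ 𝓝[Icc α β] t := by
  obtain ⟨ε, hε, hεs⟩ := (nhdsWithin_hasBasis Metric.nhds_basis_closedBall _).mem_iff.1 hs
  rw [Real.closedBall_eq_Icc, inter_comm, Icc_inter_Icc] at hεs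
  refine ⟨max α (t - ε), min β (t + ε), le_max_left _ _,
    max_lt (lt_min hαβ (by linarith [ht.1])) (lt_min (by linarith [ht.2]) (by linarith)),
    min_le_left _ _, ⟨max_le ht.1 (by linarith), le_min ht.2 (by linarith)⟩, hεs, ?_⟩
  rw [← Icc_inter_Icc]
  exact inter_mem self_mem_nhdsWithin
    (nhdsWithin_le_nhds (Icc_mem_nhds (by linarith) (by linarith)))

variable {E : Type*} [NormedAddCommGroup E] [NormedSpace ℝ E]

theorem tendsto_fderiv_slope {ρ : E → ℝ} {c : ℝ → E} {t₀ r B : ℝ} {A : E →L[ℝ] ℝ}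
    (hA : HasFDerivAt ρ A (c t₀)) (hc : ContinuousAt c t₀)
    (hbound : ∀ᶠ t in 𝓝[≠] t₀, ‖slope c t₀ t‖ ≤ B) (hρ : HasDerivAt (fun t => ρ (c t)) r t₀) :
    Tendsto (fun t => A (slope c t₀ t)) (𝓝[≠] t₀) (𝓝 r) := by
  have hO : (fun t => c t - c t₀) =O[𝓝[≠] t₀] fun t => t - t₀ := by
    refine Asymptotics.IsBigO.of_bound B ?_
    filter_upwards [hbound] with t ht
    rw [← vsub_eq_sub (c t), ← sub_smul_slope c t₀ t, norm_smul, mul_comm]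
    exact mul_le_mul_of_nonneg_right ht (norm_nonneg _)
  have ho : (fun t => ρ (c t) - ρ (c t₀) - A (c t - c t₀)) =o[𝓝[≠] t₀] fun t => t - t₀ :=
    (hA.isLittleO.comp_tendsto (hc.tendsto.mono_left nhdsWithin_le_nhds)).trans_isBigO hO
  have hlim := (hasDerivAt_iff_tendsto_slope.1 hρ).sub ho.tendsto_div_nhds_zero
  rw [sub_zero] at hlim
  refine hlim.congr fun t => ?_
  rw [slope_def_module, slope_def_module, map_smul, smul_eq_mul, smul_eq_mul]
  ring

theorem hasDerivWithinAt_Icc_of_Ioo {c v : ℝ → E} {α β : ℝ} (hαβ : α < β)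
    (hc : ContinuousOn c (Icc α β)) (hv : ContinuousOn v (Icc α β))
    (hderiv : ∀ t ∈ Ioo α β, HasDerivAt c (v t) t) {t : ℝ} (ht : t ∈ Icc α β) :
    HasDerivWithinAt c (v t) (Icc α β) t := by
  have hlim : Tendsto (fun s => fderiv ℝ c s) (𝓝[Ioo α β] t)
      (𝓝 (ContinuousLinearMap.toSpanSingleton ℝ (v t))) := by
    have hv' := ((ContinuousLinearMap.toSpanSingletonCLE (𝕜 := ℝ) (E := E)).continuous.tendsto
      (v t)).comp ((hv t ht).mono Ioo_subset_Icc_self)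
    refine hv'.congr' ?_
    filter_upwards [self_mem_nhdsWithin] with s hs using (hderiv s hs).hasFDerivAt.fderiv.symm
  have hclosure := hasFDerivWithinAt_closure_of_tendsto_fderiv
    (fun s hs => (hderiv s hs).differentiableAt.differentiableWithinAt) (convex_Ioo α β) isOpen_Ioo
    (fun s hs => (hc s (closure_Ioo hαβ.ne ▸ hs)).mono Ioo_subset_Icc_self) hlim
  simpa only [closure_Ioo hαβ.ne, ContinuousLinearMap.toSpanSingleton_apply, one_smul] using
    hclosure.hasDerivWithinAt

theorem contDiffOn_Icc_of_hasDerivAt_Ioo [CompleteSpace E] {c : ℝ → E} {Z : E → E} {G : Set E}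
    (hZ : ContDiffOn ℝ ∞ Z G) {α β : ℝ} (hαβ : α < β) (hc : ContinuousOn c (Icc α β))
    (hcG : MapsTo c (Icc α β) G) (hderiv : ∀ t ∈ Ioo α β, HasDerivAt c (Z (c t)) t) :
    ContDiffOn ℝ ∞ c (Icc α β) :=
  ODE.contDiffOn_enat_Icc_of_hasDerivWithinAt (n := ⊤) (f := fun _ => Z) (u := G)
    (hZ.comp contDiffOn_snd fun _ hw => hw.2)
    (fun _ ht => hasDerivWithinAt_Icc_of_Ioo hαβ hc (hZ.continuousOn.comp hc hcG) hderiv ht) hcG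

theorem contDiffWithinAt_Icc_of_hasDerivAt_Ioo [CompleteSpace E] {c : ℝ → E} {Z : E → E}
    {G : Set E} (hZ : ContDiffOn ℝ ∞ Z G) (hG : IsOpen G) {α β : ℝ} (hαβ : α < β)
    (hc : ContinuousOn c (Icc α β)) (hderiv : ∀ t ∈ Ioo α β, c t ∈ G → HasDerivAt c (Z (c t)) t)
    {t₀ : ℝ} (ht₀ : t₀ ∈ Icc α β) (hct₀ : c t₀ ∈ G) : ContDiffWithinAt ℝ ∞ c (Icc α β) t₀ := by
  obtain ⟨α', β', hαα', hαβ', hββ', ht₀', hmaps, hnhds⟩ := exists_Icc_mem_nhdsWithin_Icc hαβ ht₀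
    ((hc t₀ ht₀).preimage_mem_nhdsWithin (hG.mem_nhds hct₀))
  have hsmooth := contDiffOn_Icc_of_hasDerivAt_Ioo hZ hαβ' (hc.mono (Icc_subset_Icc hαα' hββ'))
    hmaps fun t ht => hderiv t (Ioo_subset_Ioo hαα' hββ' ht) (hmaps (Ioo_subset_Icc_self ht))
  exact (hsmooth t₀ ht₀').mono_of_mem_nhdsWithin hnhds

end Finsler

variable {E : Type*} [NormedAddCommGroup E] [NormedSpace ℝ E] [FiniteDimensional ℝ E]

theorem IsMinkowskiFamily.isCompact_unitBundle {N : E → E → ℝ} {V K : Set E}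
    (h : IsMinkowskiFamily N V) (hK : IsCompact K) (hKV : K ⊆ V) :
    IsCompact {z : E × E | z.1 ∈ K ∧ N z.1 z.2 = 1} := by
  obtain ⟨m, hm, C, hC, hbounds⟩ := h.exists_bounds hK hKV
  let Q : Set (E × E) := K ×ˢ (Metric.closedBall (0 : E) (1 / m) ∩ {y | 1 / C ≤ ‖y‖})
  have hQ : IsCompact Q := hK.prod
    ((isCompact_closedBall _ _).inter_right (isClosed_le continuous_const continuous_norm))
  have hcont : ContinuousOn (fun z : E × E => N z.1 z.2) Q :=
    h.smooth.continuousOn.mono <| prod_mono hKV fun y hy =>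
      norm_pos_iff.1 ((one_div_pos.2 hC).trans_le hy.2)
  have hunit : IsCompact (Q ∩ (fun z : E × E => N z.1 z.2) ⁻¹' {1}) := hQ.of_isClosed_subset
    (hcont.preimage_isClosed_of_isClosed hQ.isClosed isClosed_singleton) inter_subset_left
  convert hunit using 1
  refine Set.ext fun z => ⟨fun hz => ⟨⟨hz.1, ?_, ?_⟩, hz.2⟩, fun hz => ⟨hz.1.1, hz.2⟩⟩
  · rw [mem_closedBall_zero_iff, le_div_iff₀ hm, mul_comm]
    exact hz.2 ▸ (hbounds z.1 hz.1 z.2).1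
  · refine (div_le_iff₀ hC).2 ?_
    rw [mul_comm]
    exact hz.2 ▸ (hbounds z.1 hz.1 z.2).2

namespace IsFinslerEikonal

variable {N : E → E → ℝ} {V : Set E} {ρ : E → ℝ} {X : E → E} (h : IsFinslerEikonal N V ρ X)

include h

omit [FiniteDimensional ℝ E] in
theorem hasFDerivAt {x : E} (hx : x ∈ V) : HasFDerivAt ρ (fderiv ℝ ρ x) x :=
  ((h.smooth_fun.contDiffAt (h.isOpen.mem_nhds hx)).differentiableAt (by simp)).hasFDerivAt

/- The difference quotients of `c` are bounded, and in the unit ball of `N (c t₀)` only the gradient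
has derivative `1` in the direction of `ρ`, so it is their only limit point. -/
theorem hasDerivAt_of_calibrated {c : ℝ → E} {t₀ : ℝ} (hct₀ : c t₀ ∈ V) (hc : ContinuousAt c t₀)
    (hρ : HasDerivAt (fun t => ρ (c t)) 1 t₀)
    (hslope : ∀ η ∈ Ioo (0 : ℝ) 1, ∀ᶠ t in 𝓝[≠] t₀, (1 - η) * N (c t₀) (slope c t₀ t) ≤ 1) :
    HasDerivAt c (X (c t₀)) t₀ := by
  have hN := h.norm _ hct₀
  obtain ⟨m, hm, _, _, hmN⟩ := hN.exists_bounds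
  have hbound : ∀ᶠ t in 𝓝[≠] t₀, ‖slope c t₀ t‖ ≤ 2 / m := by
    filter_upwards [hslope (1 / 2) (by norm_num)] with t ht
    rw [le_div_iff₀ hm]
    linarith [(hmN (slope c t₀ t)).1]
  have hunit := tendsto_fderiv_slope (h.hasFDerivAt hct₀) hc hbound hρ
  rw [hasDerivAt_iff_tendsto_slope, tendsto_iff_ultrafilter]
  intro 𝒰 h𝒰
  have hball : ∀ᶠ t in (𝒰 : Filter ℝ), slope c t₀ t ∈ Metric.closedBall (0 : E) (2 / m) :=
    h𝒰 (hbound.mono fun t ht => mem_closedBall_zero_iff.2 ht)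
  obtain ⟨w, -, hw : Tendsto (slope c t₀) (𝒰 : Filter ℝ) (𝓝 w)⟩ :=
    (isCompact_closedBall (0 : E) (2 / m)).ultrafilter_le_nhds (𝒰.map (slope c t₀))
      (le_principal_iff.2 hball)
  have hNw : N (c t₀) w ≤ 1 := le_of_forall_one_sub_mul_le fun η hη =>
    le_of_tendsto (((hN.continuous.tendsto w).comp hw).const_mul (1 - η)) (h𝒰 (hslope η hη))
  have hρw : fderiv ℝ ρ (c t₀) w = 1 :=
    tendsto_nhds_unique (((fderiv ℝ ρ (c t₀)).continuous.tendsto w).comp hw) (hunit.mono_left h𝒰)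
  have hwX : w = X (c t₀) := hN.eq_of_one_le_legendre (h.norm_gradient _ hct₀) hNw
    (by rw [h.legendre_gradient _ hct₀, hρw])
  exact hwX ▸ hw

omit [FiniteDimensional ℝ E] in
theorem fibreDeriv_gradient {x : E} (hx : x ∈ V) : fibreDeriv N (x, X x) = fderiv ℝ ρ x := by
  ext v
  rw [h.fibreDeriv_apply (z := (x, X x)) ⟨hx, h.gradient_ne_zero hx⟩, h.legendre_gradient x hx]

theorem hasDerivAt_fderiv_comp {c : ℝ → E} {t : ℝ} (hct : c t ∈ V)
    (hc : HasDerivAt c (X (c t)) t) :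
    HasDerivAt (fun s => fderiv ℝ ρ (c s)) (baseDeriv N (c t, X (c t))) t := by
  have hderiv := ((h.contDiffOn_fderiv.contDiffAt (h.isOpen.mem_nhds hct)).differentiableAt
    (by simp)).hasFDerivAt.comp_hasDerivAt t hc
  rwa [h.fderiv_fderiv_gradient hct] at hderiv

variable {V₀ : Set E} (h₀ : IsMinkowskiFamily N V₀) {c : ℝ → E} {α β : ℝ}
  (hc : ContinuousOn c (Icc α β)) (hcV₀ : MapsTo c (Icc α β) V₀) (hcV : MapsTo c (Ioo α β) V)

include h₀ hc hcV₀ hcV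

theorem exists_lipschitz_momentum (hcd : ∀ t ∈ Ioo α β, HasDerivAt c (X (c t)) t) :
    ∃ P : ℝ → E →L[ℝ] ℝ, Continuous P ∧ EqOn (fun t => fderiv ℝ ρ (c t)) P (Ioo α β) := by
  have hQ := h₀.isCompact_unitBundle (isCompact_Icc.image_of_continuousOn hc) hcV₀.image_subset
  obtain ⟨B, hB⟩ := hQ.exists_bound_of_continuousOn <| h₀.contDiffOn_baseDeriv.continuousOn.mono
    fun z hz => ⟨hcV₀.image_subset hz.1,
      (h₀.norm z.1 (hcV₀.image_subset hz.1)).ne_zero_of_map_eq_one hz.2⟩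
  have hlipschitz : LipschitzOnWith (Real.toNNReal B) (fun t => fderiv ℝ ρ (c t)) (Ioo α β) := by
    refine (convex_Ioo α β).lipschitzOnWith_of_nnnorm_hasDerivWithin_le
      (fun t ht => (h.hasDerivAt_fderiv_comp (hcV ht) (hcd t ht)).hasDerivWithinAt) fun t ht => ?_
    rw [← NNReal.coe_le_coe, coe_nnnorm]
    exact (hB (c t, X (c t)) ⟨mem_image_of_mem c (Ioo_subset_Icc_self ht),
      h.norm_gradient _ (hcV ht)⟩).trans (Real.le_coe_toNNReal B)
  obtain ⟨P, hP, hPeq⟩ := hlipschitz.extend_finite_dimension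
  exact ⟨P, hP.continuous, hPeq⟩

theorem exists_limit_velocity (hαβ : α < β) {P : ℝ → E →L[ℝ] ℝ} (hP : Continuous P)
    (hPeq : EqOn (fun t => fderiv ℝ ρ (c t)) P (Ioo α β)) {t₀ : ℝ} (ht₀ : t₀ ∈ Icc α β) :
    ∃ y, y ≠ 0 ∧ fibreDeriv N (c t₀, y) = P t₀ := by
  have hQ := h₀.isCompact_unitBundle (isCompact_Icc.image_of_continuousOn hc) hcV₀.image_subset
  have : (𝓝[Ioo α β] t₀).NeBot :=
    mem_closure_iff_nhdsWithin_neBot.1 (closure_Ioo hαβ.ne ▸ ht₀)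
  let 𝒰 : Ultrafilter ℝ := Ultrafilter.of (𝓝[Ioo α β] t₀)
  have h𝒰 : (𝒰 : Filter ℝ) ≤ 𝓝[Ioo α β] t₀ := Ultrafilter.of_le _
  have h𝒰mem : ∀ᶠ t in (𝒰 : Filter ℝ), t ∈ Ioo α β := h𝒰 self_mem_nhdsWithin
  obtain ⟨⟨x, y⟩, hxy, hlim : Tendsto (fun t => (c t, X (c t))) (𝒰 : Filter ℝ) (𝓝 (x, y))⟩ :=
    hQ.ultrafilter_le_nhds (𝒰.map fun t => (c t, X (c t))) <| le_principal_iff.2 <|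
      h𝒰mem.mono fun t ht =>
        ⟨mem_image_of_mem c (Ioo_subset_Icc_self ht), h.norm_gradient _ (hcV ht)⟩
  obtain rfl : x = c t₀ := tendsto_nhds_unique ((continuous_fst.tendsto _).comp hlim)
    (((hc t₀ ht₀).mono Ioo_subset_Icc_self).mono_left h𝒰)
  have hy : y ≠ 0 := (h₀.norm _ (hcV₀ ht₀)).ne_zero_of_map_eq_one hxy.2
  have hmomentum := (h₀.contDiffOn_fibreDeriv.contDiffAt
    (h₀.isOpen_phase.mem_nhds (x := (c t₀, y)) ⟨hcV₀ ht₀, hy⟩)).continuousAt.tendsto.comp hlim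
  refine ⟨y, hy, tendsto_nhds_unique hmomentum <|
    ((hP.tendsto t₀).mono_left (h𝒰.trans nhdsWithin_le_nhds)).congr' ?_⟩
  filter_upwards [h𝒰mem] with t ht
  rw [Function.comp_apply, h.fibreDeriv_gradient (hcV ht), ← hPeq ht]

/- The eikonal function need not extend to the end points. Position and momentum do, however, and
they solve the Hamiltonian system, whose vector field is smooth on all of `V₀`. -/
theorem contDiffWithinAt_Icc (hαβ : α < β) (hcd : ∀ t ∈ Ioo α β, HasDerivAt c (X (c t)) t)
    {t₀ : ℝ} (ht₀ : t₀ ∈ Icc α β) : ContDiffWithinAt ℝ ∞ c (Icc α β) t₀ := by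
  have : CompleteSpace E := FiniteDimensional.complete ℝ E
  obtain ⟨P, hP, hPeq⟩ := h.exists_lipschitz_momentum h₀ hc hcV₀ hcV hcd
  obtain ⟨y₀, hy₀, hy₀P⟩ := h.exists_limit_velocity h₀ hc hcV₀ hcV hαβ hP hPeq ht₀
  obtain ⟨Y, G, hG, hmemG, hY, hYG⟩ := h₀.exists_smooth_legendre_inverse (hcV₀ ht₀) hy₀
  have hfield : ContDiffOn ℝ ∞ (fun w => (Y w, baseDeriv N (w.1, Y w))) G :=
    hY.prodMk (h₀.contDiffOn_baseDeriv.comp (contDiffOn_fst.prodMk hY) fun w hw =>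
      ⟨(hYG w hw).1, (hYG w hw).2.1⟩)
  have hphase : ContDiffWithinAt ℝ ∞ (fun t => (c t, P t)) (Icc α β) t₀ := by
    refine contDiffWithinAt_Icc_of_hasDerivAt_Ioo hfield hG hαβ (hc.prodMk hP.continuousOn)
      (fun t ht htG => ?_) ht₀ (hy₀P ▸ hmemG)
    have hPt : fderiv ℝ ρ (c t) = P t := hPeq ht
    have hXY : X (c t) = Y (c t, P t) := (hYG _ htG).2.2 _ fun v => by
      rw [h.legendre_gradient _ (hcV ht), hPt]
    have hPderiv : HasDerivAt P (baseDeriv N (c t, X (c t))) t :=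
      (h.hasDerivAt_fderiv_comp (hcV ht) (hcd t ht)).congr_of_eventuallyEq
        (eventually_of_mem (isOpen_Ioo.mem_nhds ht) fun s hs => (hPeq hs).symm)
    simpa only [hXY] using (hcd t ht).prodMk hPderiv
  exact contDiff_fst.comp_contDiffWithinAt hphase

end IsFinslerEikonal

/-! ### First variation -/

namespace FinslerStructure

variable {n : ℕ} {M : Type*} [TopologicalSpace M]
  [ChartedSpace (EuclideanSpace ℝ (Fin n)) M] [IsManifold (𝓡 n) ∞ M]
  {F : FinslerStructure n M}

namespace IsCalibratedCurve

variable {ρ : M → ℝ} {γ : ℝ → M} {α β : ℝ}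

theorem dist_lt (hγ : F.IsCalibratedCurve ρ γ α β) {s t δ : ℝ} (hs : α ≤ s) (hst : s ≤ t)
    (ht : t ≤ β) (hδ : t - s < δ) : F.dist (γ s) (γ t) < ENNReal.ofReal δ :=
  (hγ.dist_le s t hs hst ht).trans_lt ((ENNReal.ofReal_lt_ofReal_iff (by linarith)).2 hδ)

theorem continuousOn [T2Space M] (hγ : F.IsCalibratedCurve ρ γ α β) :
    ContinuousOn γ (Icc α β) := by
  intro t₀ ht₀ U hU
  obtain ⟨W, hW, δ, hδ, hclose⟩ := F.exists_nhds_of_dist_lt hU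
  have hγt₀ : γ t₀ ∈ W := mem_of_mem_nhds hW
  rw [mem_map]
  filter_upwards [nhdsWithin_le_nhds (Metric.ball_mem_nhds t₀ hδ), self_mem_nhdsWithin]
    with t ht htI
  rw [Metric.mem_ball, Real.dist_eq, abs_lt] at ht
  rcases le_total t₀ t with hle | hle
  · exact (hclose _ _ (.inl hγt₀) (hγ.dist_lt ht₀.1 hle htI.2 ht.2)).2
  · exact (hclose _ _ (.inr hγt₀) (hγ.dist_lt htI.1 hle ht₀.2 (by linarith))).1

theorem eventually_locNorm_slope_le [T2Space M] (hγ : F.IsCalibratedCurve ρ γ α β) {t₀ : ℝ}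
    (ht₀ : t₀ ∈ Ioo α β) {p : M} (hp : γ t₀ ∈ (extChartAt (𝓡 n) p).source) {η : ℝ}
    (hη : η ∈ Ioo (0 : ℝ) 1) :
    ∀ᶠ t in 𝓝[≠] t₀, (1 - η) * F.locNorm p (extChartAt (𝓡 n) p (γ t₀))
      (slope (fun s => extChartAt (𝓡 n) p (γ s)) t₀ t) ≤ 1 := by
  have hN := F.isMinkowskiNorm_locNorm hp
  obtain ⟨W, hW, δ, hδ, hclose⟩ := F.exists_locNorm_le_dist hp hη.1 hη.2 univ_mem
  have hγt₀ : γ t₀ ∈ W := mem_of_mem_nhds hW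
  have hslope : ∀ s t, α ≤ s → s < t → t ≤ β → t - s < δ → γ s ∈ W ∨ γ t ∈ W →
      (1 - η) * F.locNorm p (extChartAt (𝓡 n) p (γ t₀))
        (slope (fun s => extChartAt (𝓡 n) p (γ s)) s t) ≤ 1 := by
    intro s t hs hst ht hδ hW
    have hle := (hclose _ _ hW (hγ.dist_lt hs hst.le ht hδ)).2.2.trans (hγ.dist_le s t hs hst.le ht)
    rw [ENNReal.ofReal_le_ofReal_iff (sub_pos.2 hst).le] at hle
    rwa [slope_def_module, hN.homogeneous _ _ (inv_pos.2 (sub_pos.2 hst)), mul_left_comm,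
      inv_mul_le_iff₀ (sub_pos.2 hst), mul_one]
  filter_upwards [nhdsWithin_le_nhds (Metric.ball_mem_nhds t₀ hδ),
    nhdsWithin_le_nhds (Icc_mem_nhds ht₀.1 ht₀.2), self_mem_nhdsWithin] with t ht htI hne
  rw [Metric.mem_ball, Real.dist_eq, abs_lt] at ht
  rcases lt_or_gt_of_ne hne with hlt | hlt
  · rw [slope_comm]
    exact hslope t t₀ htI.1 hlt ht₀.2.le (by linarith) (.inr hγt₀)
  · exact hslope t₀ t ht₀.1.le hlt htI.2 ht.2 (.inl hγt₀)

end IsCalibratedCurve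

namespace IsRegularTransnormal

variable {f : M → ℝ} {𝔟 : ℝ → ℝ} {a b : ℝ} (h : F.IsRegularTransnormal f 𝔟 a b)
  [ConnectedSpace M] {γ : ℝ → M} {α β : ℝ}

include h

theorem dist_calibratedCurve (hγ : F.IsCalibratedCurve (arrival 𝔟 a f) γ α β) {s t : ℝ}
    (hs : α ≤ s) (hst : s ≤ t) (ht : t ≤ β) : F.dist (γ s) (γ t) = ENNReal.ofReal (t - s) := by
  refine le_antisymm (hγ.dist_le s t hs hst ht) ?_
  have hle := h.ofReal_arrival_sub_le_dist (γ s) (γ t)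
  rwa [hγ.apply_eq s ⟨hs, hst.trans ht⟩, hγ.apply_eq t ⟨hs.trans hst, ht⟩] at hle

theorem bounds_calibratedCurve (hγ : F.IsCalibratedCurve (arrival 𝔟 a f) γ α β) (hαβ : α ≤ β) :
    0 ≤ α ∧ β ≤ travelTime 𝔟 a b :=
  ⟨hγ.apply_eq α (left_mem_Icc.2 hαβ) ▸ h.arrival_nonneg (γ α),
    hγ.apply_eq β (right_mem_Icc.2 hαβ) ▸ h.arrival_le (γ β)⟩

theorem mem_regularRegion (hγ : F.IsCalibratedCurve (arrival 𝔟 a f) γ α β) {t : ℝ}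
    (ht : t ∈ Ioo α β) {p : M} (hp : γ t ∈ (extChartAt (𝓡 n) p).source) :
    extChartAt (𝓡 n) p (γ t) ∈ regularRegion n f a b p := by
  obtain ⟨hα, hβ⟩ := h.bounds_calibratedCurve hγ (ht.1.trans ht.2).le
  refine ⟨(extChartAt (𝓡 n) p).map_source hp, ?_⟩
  rw [mem_preimage, (extChartAt (𝓡 n) p).left_inv hp, h.mem_Ioo_iff,
    hγ.apply_eq t (Ioo_subset_Icc_self ht)]
  exact ⟨hα.trans_lt ht.1, ht.2.trans_le hβ⟩

variable [T2Space M]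

theorem hasDerivAt_calibratedCurve (hγ : F.IsCalibratedCurve (arrival 𝔟 a f) γ α β) {t₀ : ℝ}
    (ht₀ : t₀ ∈ Ioo α β) {p : M} (hp : γ t₀ ∈ (extChartAt (𝓡 n) p).source)
    {X : EuclideanSpace ℝ (Fin n) → EuclideanSpace ℝ (Fin n)}
    (hX : IsFinslerEikonal (F.locNorm p) (regularRegion n f a b p)
      (fun x => arrival 𝔟 a f ((extChartAt (𝓡 n) p).symm x)) X) :
    HasDerivAt (fun s => extChartAt (𝓡 n) p (γ s)) (X (extChartAt (𝓡 n) p (γ t₀))) t₀ := by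
  have hI := Icc_mem_nhds ht₀.1 ht₀.2
  have hc : ContinuousAt γ t₀ := hγ.continuousOn.continuousAt hI
  refine hX.hasDerivAt_of_calibrated (c := fun s => extChartAt (𝓡 n) p (γ s))
    (h.mem_regularRegion hγ ht₀ hp) ((continuousAt_extChartAt' hp).comp hc) ?_
    fun η hη => hγ.eventually_locNorm_slope_le ht₀ hp hη
  refine (hasDerivAt_id t₀).congr_of_eventuallyEq ?_
  filter_upwards [hI, hc (extChartAt_source_mem_nhds' hp)] with t ht hts
  rw [(extChartAt (𝓡 n) p).left_inv hts, hγ.apply_eq t ht, id]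

theorem contMDiffOn_calibratedCurve_of_mapsTo
    (hγ : F.IsCalibratedCurve (arrival 𝔟 a f) γ α β) (hαβ : α < β) {p : M}
    (hmaps : MapsTo γ (Icc α β) (extChartAt (𝓡 n) p).source) :
    ContMDiffOn 𝓘(ℝ, ℝ) (𝓡 n) ∞ γ (Icc α β) := by
  obtain ⟨X, hX⟩ := h.exists_isFinslerEikonal p
  have hchart : ContDiffOn ℝ ∞ (fun s => extChartAt (𝓡 n) p (γ s)) (Icc α β) := fun t ht =>
    hX.contDiffWithinAt_Icc (F.isMinkowskiFamily_locNorm p)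
      ((continuousOn_extChartAt (I := 𝓡 n) p).comp hγ.continuousOn hmaps)
      (fun s hs => (extChartAt (𝓡 n) p).map_source (hmaps hs))
      (fun s hs => h.mem_regularRegion hγ hs (hmaps (Ioo_subset_Icc_self hs))) hαβ
      (fun s hs => h.hasDerivAt_calibratedCurve hγ hs (hmaps (Ioo_subset_Icc_self hs)) hX) ht
  exact ((contMDiffOn_extChartAt_symm p).comp hchart.contMDiffOn
    fun t ht => (extChartAt (𝓡 n) p).map_source (hmaps ht)).congr
    fun t ht => ((extChartAt (𝓡 n) p).left_inv (hmaps ht)).symm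

theorem contMDiffOn_calibratedCurve (hγ : F.IsCalibratedCurve (arrival 𝔟 a f) γ α β)
    (hαβ : α < β) : ContMDiffOn 𝓘(ℝ, ℝ) (𝓡 n) ∞ γ (Icc α β) := by
  intro t₀ ht₀
  obtain ⟨α', β', hαα', hαβ', hββ', ht₀', hmaps, hnhds⟩ := exists_Icc_mem_nhdsWithin_Icc hαβ ht₀
    (hγ.continuousOn t₀ ht₀ (extChartAt_source_mem_nhds (I := 𝓡 n) (γ t₀)))
  exact (h.contMDiffOn_calibratedCurve_of_mapsTo (hγ.mono hαα' hββ') hαβ' hmaps t₀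
    ht₀').mono_of_mem_nhdsWithin hnhds

theorem toFun_velocity_calibratedCurve (hγ : F.IsCalibratedCurve (arrival 𝔟 a f) γ α β) {t : ℝ}
    (ht : t ∈ Ioo α β) : F.toFun (velocity γ t) = 1 := by
  obtain ⟨X, hX⟩ := h.exists_isFinslerEikonal (γ t)
  have hp : γ t ∈ (extChartAt (𝓡 n) (γ t)).source := mem_extChartAt_source (γ t)
  have hdiff : MDifferentiableAt 𝓘(ℝ, ℝ) (𝓡 n) γ t :=
    ((h.contMDiffOn_calibratedCurve hγ (ht.1.trans ht.2)).contMDiffAt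
      (Icc_mem_nhds ht.1 ht.2)).mdifferentiableAt (by simp)
  rw [F.toFun_velocity hp hdiff, (h.hasDerivAt_calibratedCurve hγ ht hp hX).deriv,
    hX.norm_gradient _ (h.mem_regularRegion hγ ht hp)]

end IsRegularTransnormal

end FinslerStructure

namespace Finsler

variable {n : ℕ} {M : Type*} [TopologicalSpace M] [ChartedSpace (EuclideanSpace ℝ (Fin n)) M]

/-- The curve `c` starts at `q` with right derivative `w` at time `0`, in the chart at `q`. -/
structure HasRightDeriv (c : ℝ → M) (q : M) (w : EuclideanSpace ℝ (Fin n)) : Prop where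
  apply_zero : c 0 = q
  continuousWithinAt : ContinuousWithinAt c (Ici 0) 0
  hasDerivWithinAt : HasDerivWithinAt (fun s => extChartAt (𝓡 n) q (c s)) w (Ici 0) 0

theorem hasRightDeriv_const (q : M) : HasRightDeriv (n := n) (fun _ => q) q 0 :=
  ⟨rfl, continuousWithinAt_const, hasDerivWithinAt_const _ _ _⟩

theorem hasRightDeriv_comp_add_mul {γ : ℝ → M} {I : Set ℝ} {t κ : ℝ}
    {w : EuclideanSpace ℝ (Fin n)} (hc : ContinuousWithinAt γ I t)
    (hw : HasDerivWithinAt (fun s => extChartAt (𝓡 n) (γ t) (γ s)) w I t)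
    (hI : ∀ᶠ s in 𝓝[≥] (0 : ℝ), t + κ * s ∈ I) :
    HasRightDeriv (fun s => γ (t + κ * s)) (γ t) (κ • w) := by
  have hline : HasDerivAt (fun s : ℝ => t + κ * s) κ 0 := by
    simpa using ((hasDerivAt_id (0 : ℝ)).const_mul κ).const_add t
  have hzero : t + κ * 0 = t := by rw [mul_zero, add_zero]
  have hJ : Ici 0 ∩ {s | t + κ * s ∈ I} ∈ 𝓝[≥] (0 : ℝ) := inter_mem self_mem_nhdsWithin hI
  have hmaps : MapsTo (fun s => t + κ * s) (Ici 0 ∩ {s | t + κ * s ∈ I}) I := fun s hs => hs.2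
  refine ⟨by rw [hzero], ?_, ?_⟩
  · refine ContinuousWithinAt.mono_of_mem_nhdsWithin ?_ hJ
    exact ContinuousWithinAt.comp (t := I) (by rwa [hzero]) hline.continuousAt.continuousWithinAt
      hmaps
  · refine HasDerivWithinAt.mono_of_mem_nhdsWithin ?_ hJ
    exact HasDerivWithinAt.scomp (t' := I) 0 (by rwa [hzero]) hline.hasDerivWithinAt hmaps

namespace HasRightDeriv

variable {c c₁ c₂ : ℝ → M} {q : M} {w w₁ w₂ : EuclideanSpace ℝ (Fin n)}

theorem tendsto (hc : HasRightDeriv c q w) : Tendsto c (𝓝[>] 0) (𝓝 q) :=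
  hc.apply_zero ▸ hc.continuousWithinAt.mono_left (nhdsWithin_mono 0 Ioi_subset_Ici_self)

theorem tendsto_chart (hc : HasRightDeriv c q w) :
    Tendsto (fun s => extChartAt (𝓡 n) q (c s)) (𝓝[>] 0) (𝓝 (extChartAt (𝓡 n) q q)) :=
  (continuousAt_extChartAt q).tendsto.comp hc.tendsto

theorem eventually_mem_source (hc : HasRightDeriv c q w) :
    ∀ᶠ s in 𝓝[>] (0 : ℝ), c s ∈ (extChartAt (𝓡 n) q).source :=
  hc.tendsto (extChartAt_source_mem_nhds q)

theorem tendsto_sub (h₁ : HasRightDeriv c₁ q w₁) (h₂ : HasRightDeriv c₂ q w₂) :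
    Tendsto (fun s : ℝ => s⁻¹ • (extChartAt (𝓡 n) q (c₂ s) - extChartAt (𝓡 n) q (c₁ s)))
      (𝓝[>] 0) (𝓝 (w₂ - w₁)) := by
  have hslope := (hasDerivWithinAt_iff_tendsto_slope' self_notMem_Ioi).1
    ((h₂.hasDerivWithinAt.sub h₁.hasDerivWithinAt).mono Ioi_subset_Ici_self)
  refine hslope.congr fun s => ?_
  simp only [slope_def_module, Pi.sub_apply, h₁.apply_zero, h₂.apply_zero, sub_self, sub_zero]

end HasRightDeriv

theorem exists_hasRightDeriv_of_mem_tangentVectors [IsManifold (𝓡 n) ∞ M] {S : Set M} {q : M}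
    {v : TangentSpace (𝓡 n) q} (hv : v ∈ tangentVectors S q) (r : ℝ) :
    ∃ c : ℝ → M, HasRightDeriv c q (r • vecCoord q ⟨q, v⟩) ∧ ∀ᶠ s in 𝓝[>] (0 : ℝ), c s ∈ S := by
  obtain ⟨σ, hσS, hσ, hσv⟩ := hv
  cases hσv
  have hsource : σ 0 ∈ (extChartAt (𝓡 n) (σ 0)).source := mem_extChartAt_source (σ 0)
  have hdiff : DifferentiableAt ℝ (fun s => extChartAt (𝓡 n) (σ 0) (σ s)) 0 :=
    mdifferentiableAt_iff_differentiableAt.1 ((mdifferentiableAt_chart hsource).comp 0 hσ)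
  have hline : Tendsto (fun s : ℝ => 0 + r * s) (𝓝[>] 0) (𝓝 0) := by
    have hcont : Continuous fun s : ℝ => 0 + r * s := by fun_prop
    simpa using (hcont.tendsto 0).mono_left (nhdsWithin_le_nhds (s := Ioi 0))
  refine ⟨fun s => σ (0 + r * s), ?_, hline hσS⟩
  rw [show vecCoord (σ 0) ⟨σ 0, _⟩ = _ from vecCoord_velocity hsource hσ]
  exact hasRightDeriv_comp_add_mul hσ.continuousAt.continuousWithinAt
    hdiff.hasDerivAt.hasDerivWithinAt (I := univ) (.of_forall fun _ => mem_univ _)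

section DerivOn

variable [IsManifold (𝓡 n) ∞ M] {γ : ℝ → M} {T t : ℝ}
  (hγ : MDifferentiableWithinAt 𝓘(ℝ, ℝ) (𝓡 n) γ (Icc 0 T) t)

include hγ

theorem hasDerivWithinAt_derivOn (hT : 0 < T) (ht : t ∈ Icc 0 T) :
    HasDerivWithinAt (fun s => extChartAt (𝓡 n) (γ t) (γ s))
      (vecCoord (γ t) ⟨γ t, derivOn (n := n) γ T t⟩) (Icc 0 T) t := by
  have hsource : γ t ∈ (extChartAt (𝓡 n) (γ t)).source := mem_extChartAt_source (γ t)
  rw [vecCoord_derivOn hsource hT ht hγ]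
  exact (mdifferentiableWithinAt_iff_differentiableWithinAt.1
    ((mdifferentiableAt_chart hsource).comp_mdifferentiableWithinAt t hγ)).hasDerivWithinAt

theorem hasRightDeriv_comp_sub (ht : t ∈ Ioc 0 T) :
    HasRightDeriv (fun s => γ (t - s)) (γ t) (-vecCoord (n := n) (γ t) ⟨γ t, derivOn γ T t⟩) := by
  have hI : ∀ᶠ s in 𝓝[≥] (0 : ℝ), t + -1 * s ∈ Icc 0 T := by
    filter_upwards [Ico_mem_nhdsGE ht.1] with s hs
    constructor <;> linarith [hs.1, hs.2, ht.2]
  simpa only [neg_one_mul, ← sub_eq_add_neg, neg_one_smul] using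
    hasRightDeriv_comp_add_mul hγ.continuousWithinAt
      (hasDerivWithinAt_derivOn hγ (ht.1.trans_le ht.2) ⟨ht.1.le, ht.2⟩) hI

theorem hasRightDeriv_comp_add (ht : t ∈ Ico 0 T) :
    HasRightDeriv (fun s => γ (t + s)) (γ t)
      (vecCoord (n := n) (γ t) ⟨γ t, derivOn γ T t⟩) := by
  have hI : ∀ᶠ s in 𝓝[≥] (0 : ℝ), t + 1 * s ∈ Icc 0 T := by
    filter_upwards [Ico_mem_nhdsGE (sub_pos.2 ht.2)] with s hs
    constructor <;> linarith [hs.1, hs.2, ht.1]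
  simpa only [one_mul, one_smul] using
    hasRightDeriv_comp_add_mul hγ.continuousWithinAt
      (hasDerivWithinAt_derivOn hγ (ht.1.trans_lt ht.2) ⟨ht.1, ht.2.le⟩) hI

end DerivOn

end Finsler

namespace FinslerStructure

variable {n : ℕ} {M : Type*} [TopologicalSpace M]
  [ChartedSpace (EuclideanSpace ℝ (Fin n)) M] [IsManifold (𝓡 n) ∞ M]
  {F : FinslerStructure n M} {q : M} {c c₁ c₂ : ℝ → M} {w₁ w₂ : EuclideanSpace ℝ (Fin n)}

theorem le_locNorm_of_hasRightDeriv (h₁ : HasRightDeriv c₁ q w₁) (h₂ : HasRightDeriv c₂ q w₂)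
    (hdist : ∀ᶠ s in 𝓝[>] (0 : ℝ), ENNReal.ofReal s ≤ F.dist (c₁ s) (c₂ s)) :
    1 ≤ F.locNorm q (extChartAt (𝓡 n) q q) (w₂ - w₁) := by
  have hq : q ∈ (extChartAt (𝓡 n) q).source := mem_extChartAt_source q
  have hN := F.isMinkowskiNorm_locNorm hq
  have hlim := h₁.tendsto_sub h₂
  have hle : ∀ η > 0, 1 ≤ F.locNorm q (extChartAt (𝓡 n) q q) (w₂ - w₁) + η * ‖w₂ - w₁‖ := by
    intro η hη
    obtain ⟨r, hr, -, hrd⟩ := F.exists_dist_le_locNorm hq hη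
    have hball := Metric.closedBall_mem_nhds (extChartAt (𝓡 n) q q) hr
    refine ge_of_tendsto (((hN.continuous.tendsto _).comp hlim).add (hlim.norm.const_mul η)) ?_
    filter_upwards [hdist, h₁.eventually_mem_source, h₂.eventually_mem_source,
      h₁.tendsto_chart hball, h₂.tendsto_chart hball, self_mem_nhdsWithin]
      with s hs hs₁ hs₂ hball₁ hball₂ (hs0 : 0 < s)
    have hupper := hrd _ hball₁ _ hball₂
    rw [(extChartAt (𝓡 n) q).left_inv hs₁, (extChartAt (𝓡 n) q).left_inv hs₂] at hupper
    have hsle := hs.trans hupper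
    rw [ENNReal.ofReal_le_ofReal_iff (add_nonneg (hN.nonneg _) (by positivity))] at hsle
    rwa [Function.comp_apply, hN.homogeneous _ _ (inv_pos.2 hs0), norm_smul,
      Real.norm_of_nonneg (inv_pos.2 hs0).le, mul_left_comm, ← mul_add, le_inv_mul_iff₀ hs0,
      mul_one]
  have hη : Tendsto (fun η : ℝ => F.locNorm q (extChartAt (𝓡 n) q q) (w₂ - w₁) + η * ‖w₂ - w₁‖)
      (𝓝[>] 0) (𝓝 (F.locNorm q (extChartAt (𝓡 n) q q) (w₂ - w₁) + 0 * ‖w₂ - w₁‖)) :=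
    ((continuous_const.add (continuous_id.mul continuous_const)).tendsto 0).mono_left
      nhdsWithin_le_nhds
  rw [zero_mul, add_zero] at hη
  exact ge_of_tendsto hη (eventually_of_mem self_mem_nhdsWithin hle)

/- A norm that is minimal at `y` along a line has `g_y(y, ·) = 0` in its direction. -/
theorem isOrthogonal_of_le_locNorm {y : TangentSpace (𝓡 n) q} (hy : F.toFun ⟨q, y⟩ = 1)
    {S : Set M} {κ : ℝ} (hκ : κ ≠ 0)
    (hS : ∀ c v, HasRightDeriv c q v → (∀ᶠ s in 𝓝[>] (0 : ℝ), c s ∈ S) →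
      1 ≤ F.locNorm q (extChartAt (𝓡 n) q q) (vecCoord q ⟨q, y⟩ + κ • v)) :
    F.IsOrthogonal q y S := by
  have hq : q ∈ (extChartAt (𝓡 n) q).source := mem_extChartAt_source q
  have hN := F.isMinkowskiNorm_locNorm hq
  have hy' : F.locNorm q (extChartAt (𝓡 n) q q) (vecCoord q ⟨q, y⟩) = 1 := by
    rw [F.locNorm_vecCoord hq, hy]
  refine ⟨fun hy0 => hN.ne_zero_of_map_eq_one hy' ?_, fun v hv => ?_⟩
  · rw [hy0, vecCoord_eq_coordEquiv hq, map_zero]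
  · rw [F.legendre_eq_minkowskiLegendre hq]
    refine hN.legendre_eq_zero_of_forall_le fun s => ?_
    obtain ⟨c, hc, hcS⟩ := exists_hasRightDeriv_of_mem_tangentVectors hv (κ⁻¹ * s)
    rw [hy']
    simpa only [smul_smul, mul_inv_cancel_left₀ hκ] using hS c _ hc hcS

variable [T2Space M]

theorem locNorm_le_of_hasRightDeriv (h₁ : HasRightDeriv c₁ q w₁) (h₂ : HasRightDeriv c₂ q w₂)
    (hdist : ∀ᶠ s in 𝓝[>] (0 : ℝ), F.dist (c₁ s) (c₂ s) ≤ ENNReal.ofReal s) :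
    F.locNorm q (extChartAt (𝓡 n) q q) (w₂ - w₁) ≤ 1 := by
  have hq : q ∈ (extChartAt (𝓡 n) q).source := mem_extChartAt_source q
  have hN := F.isMinkowskiNorm_locNorm hq
  refine le_of_forall_one_sub_mul_le fun η hη => ?_
  obtain ⟨W, hW, δ, hδ, hclose⟩ := F.exists_locNorm_le_dist hq hη.1 hη.2 univ_mem
  refine le_of_tendsto (((hN.continuous.tendsto _).comp (h₁.tendsto_sub h₂)).const_mul (1 - η)) ?_
  filter_upwards [hdist, h₁.tendsto hW, Ioo_mem_nhdsGT hδ] with s hs hsW hsδ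
  have hle := (hclose _ _ (.inl hsW)
    (hs.trans_lt ((ENNReal.ofReal_lt_ofReal_iff hδ).2 hsδ.2))).2.2.trans hs
  rw [ENNReal.ofReal_le_ofReal_iff hsδ.1.le] at hle
  rwa [Function.comp_apply, hN.homogeneous _ _ (inv_pos.2 hsδ.1), mul_left_comm,
    inv_mul_le_iff₀ hsδ.1, mul_one]

theorem locNorm_eq_one_of_hasRightDeriv (h₁ : HasRightDeriv c₁ q w₁) (h₂ : HasRightDeriv c₂ q w₂)
    (hdist : ∀ᶠ s in 𝓝[>] (0 : ℝ), F.dist (c₁ s) (c₂ s) = ENNReal.ofReal s) :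
    F.locNorm q (extChartAt (𝓡 n) q q) (w₂ - w₁) = 1 :=
  le_antisymm (locNorm_le_of_hasRightDeriv h₁ h₂ (hdist.mono fun _ hs => hs.le))
    (le_locNorm_of_hasRightDeriv h₁ h₂ (hdist.mono fun _ hs => hs.ge))

theorem isOrthogonal_of_arrival {y : TangentSpace (𝓡 n) q}
    (hc : HasRightDeriv c q (-vecCoord q ⟨q, y⟩))
    (hdist : ∀ᶠ s in 𝓝[>] (0 : ℝ), F.dist (c s) q = ENNReal.ofReal s) {S : Set M}
    (hS : ∀ᶠ s in 𝓝[>] (0 : ℝ), ∀ x ∈ S, ENNReal.ofReal s ≤ F.dist (c s) x) :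
    F.IsOrthogonal q y S := by
  have hunit := locNorm_eq_one_of_hasRightDeriv hc (hasRightDeriv_const q) hdist
  rw [zero_sub, neg_neg, F.locNorm_vecCoord (mem_extChartAt_source q)] at hunit
  refine isOrthogonal_of_le_locNorm hunit one_ne_zero fun c' v hc' hc'S => ?_
  have hle := le_locNorm_of_hasRightDeriv hc hc'
    (by filter_upwards [hS, hc'S] with s hs hs' using hs _ hs')
  rwa [sub_neg_eq_add, add_comm, ← one_smul ℝ v] at hle

theorem isOrthogonal_of_departure {y : TangentSpace (𝓡 n) q}
    (hc : HasRightDeriv c q (vecCoord q ⟨q, y⟩))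
    (hdist : ∀ᶠ s in 𝓝[>] (0 : ℝ), F.dist q (c s) = ENNReal.ofReal s) {S : Set M}
    (hS : ∀ᶠ s in 𝓝[>] (0 : ℝ), ∀ x ∈ S, ENNReal.ofReal s ≤ F.dist x (c s)) :
    F.IsOrthogonal q y S := by
  have hunit := locNorm_eq_one_of_hasRightDeriv (hasRightDeriv_const q) hc hdist
  rw [sub_zero, F.locNorm_vecCoord (mem_extChartAt_source q)] at hunit
  refine isOrthogonal_of_le_locNorm hunit (neg_ne_zero.2 one_ne_zero) fun c' v hc' hc'S => ?_
  have hle := le_locNorm_of_hasRightDeriv hc' hc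
    (by filter_upwards [hS, hc'S] with s hs hs' using hs _ hs')
  rwa [sub_eq_add_neg, ← neg_one_smul ℝ v] at hle

namespace IsRegularTransnormal

variable {f : M → ℝ} {𝔟 : ℝ → ℝ} {a b : ℝ} (h : F.IsRegularTransnormal f 𝔟 a b)
  [ConnectedSpace M] {γ : ℝ → M} {T t : ℝ} (hγ : F.IsCalibratedCurve (arrival 𝔟 a f) γ 0 T)
  {S : Set M}

include h hγ

theorem isOrthogonal_derivOn_of_arrival (ht : t ∈ Ioc 0 T)
    (hS : ∀ᶠ u in 𝓝[>] (0 : ℝ), ∀ x ∈ S, ENNReal.ofReal u ≤ F.dist (γ (t - u)) x) :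
    F.IsOrthogonal (γ t) (derivOn γ T t) S := by
  have hdiff := (h.contMDiffOn_calibratedCurve hγ (ht.1.trans_le ht.2) t
    ⟨ht.1.le, ht.2⟩).mdifferentiableWithinAt (by simp)
  refine isOrthogonal_of_arrival (hasRightDeriv_comp_sub hdiff ht) ?_ hS
  filter_upwards [Ioo_mem_nhdsGT ht.1] with u hu
  rw [h.dist_calibratedCurve hγ (sub_pos.2 hu.2).le (sub_le_self t hu.1.le) ht.2, sub_sub_cancel]

theorem isOrthogonal_derivOn_of_departure (ht : t ∈ Ico 0 T)
    (hS : ∀ᶠ u in 𝓝[>] (0 : ℝ), ∀ x ∈ S, ENNReal.ofReal u ≤ F.dist x (γ (t + u))) :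
    F.IsOrthogonal (γ t) (derivOn γ T t) S := by
  have hdiff := (h.contMDiffOn_calibratedCurve hγ (ht.1.trans_lt ht.2) t
    ⟨ht.1, ht.2.le⟩).mdifferentiableWithinAt (by simp)
  refine isOrthogonal_of_departure (hasRightDeriv_comp_add hdiff ht) ?_ hS
  filter_upwards [Ioo_mem_nhdsGT (sub_pos.2 ht.2)] with u hu
  rw [h.dist_calibratedCurve hγ ht.1 (le_add_of_nonneg_right hu.1.le) (by linarith [hu.2]),
    add_sub_cancel_left]

end IsRegularTransnormal

end FinslerStructure

/-! ### Wave rays and wavefronts -/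

namespace FinslerStructure

variable {n : ℕ} {M : Type*} [TopologicalSpace M]
  [ChartedSpace (EuclideanSpace ℝ (Fin n)) M] [IsManifold (𝓡 n) ∞ M]
  {F : FinslerStructure n M}

theorem mem_wavefront_singleton {p q : M} {t : ℝ} :
    p ∈ F.wavefront {q} t ↔ F.dist q p = ENNReal.ofReal t := by
  simp only [wavefront, distFrom, mem_ofPred_eq, mem_singleton_iff, iInf_iInf_eq_left]

theorem IsTransnormal.isRegularTransnormal [Nonempty M] {f : M → ℝ} {𝔟 : ℝ → ℝ} {a b : ℝ}
    (hf : F.IsTransnormal f 𝔟) (hrange : range f = Icc a b) (hpos : ∀ s ∈ Ioo a b, 0 < 𝔟 s)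
    (hb : interior (f ⁻¹' {b}) = ∅) : F.IsRegularTransnormal f 𝔟 a b := by
  refine ⟨hf, hrange, hpos, ?_⟩
  have hmem : ∀ x, f x ∈ Icc a b := fun x => hrange ▸ mem_range_self x
  by_contra! hba
  have huniv : f ⁻¹' {b} = univ :=
    eq_univ_of_forall fun x => le_antisymm (hmem x).2 (hba.trans (hmem x).1)
  rw [huniv, interior_univ] at hb
  exact univ_nonempty.ne_empty hb

namespace IsRegularTransnormal

variable {f : M → ℝ} {𝔟 : ℝ → ℝ} {a b : ℝ} (h : F.IsRegularTransnormal f 𝔟 a b)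
  [ConnectedSpace M] {γ : ℝ → M} {T c d : ℝ}

include h

theorem travelTime_mem_Icc (hc : c ∈ Icc a b) :
    travelTime 𝔟 a c ∈ Icc 0 (travelTime 𝔟 a b) := by
  obtain ⟨x, rfl⟩ := h.exists_eq hc
  exact ⟨h.arrival_nonneg x, h.arrival_le x⟩

theorem travelTime_eq_sub (hc : c ∈ Icc a b) (hd : d ∈ Icc a b) :
    travelTime 𝔟 c d = travelTime 𝔟 a d - travelTime 𝔟 a c := by
  rw [← h.travelTime_add hc hd, add_sub_cancel_left]

theorem calibratedCurve_mem_level_iff (hγ : F.IsCalibratedCurve (arrival 𝔟 a f) γ 0 T) {t : ℝ}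
    (ht : t ∈ Icc 0 T) (hc : c ∈ Icc a b) : f (γ t) = c ↔ t = travelTime 𝔟 a c := by
  rw [← h.arrival_eq_iff hc, hγ.apply_eq t ht]

theorem ofReal_arrival_sub_travelTime_le_dist (hc : c ∈ Icc a b) {q : M} (hq : f q = c) (p : M) :
    ENNReal.ofReal (arrival 𝔟 a f p - travelTime 𝔟 a c) ≤ F.dist q p := by
  rw [← (h.arrival_eq_iff hc).2 hq]
  exact h.ofReal_arrival_sub_le_dist q p

variable [T2Space M]

theorem isGeodesic_of_isCalibratedCurve (hγ : F.IsCalibratedCurve (arrival 𝔟 a f) γ 0 T)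
    (hT : 0 < T) : F.IsGeodesic γ T := by
  have hsmooth := h.contMDiffOn_calibratedCurve hγ hT
  refine ⟨hsmooth, fun s t hs hst ht => ?_⟩
  rw [h.dist_calibratedCurve hγ hs hst ht]
  exact F.length_eq_of_unitSpeed (.smooth hT.le hsmooth)
    (fun u hu _ => h.toFun_velocity_calibratedCurve hγ hu) hs ht

theorem isOrthogonal_level (hγ : F.IsCalibratedCurve (arrival 𝔟 a f) γ 0 T) (hT : 0 < T)
    {t : ℝ} (ht : t ∈ Icc 0 T) (hc : f (γ t) = c) :
    F.IsOrthogonal (γ t) (derivOn γ T t) (f ⁻¹' {c}) := by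
  have hlevel : ∀ x ∈ f ⁻¹' {c}, arrival 𝔟 a f x = t := by
    rintro x (hx : f x = c)
    rw [arrival, hx, ← hc]
    exact hγ.apply_eq t ht
  rcases ht.1.eq_or_lt with rfl | ht0
  · refine h.isOrthogonal_derivOn_of_departure hγ ⟨le_rfl, hT⟩ ?_
    filter_upwards [Ioo_mem_nhdsGT hT] with u hu x hx
    have hdist := h.ofReal_arrival_sub_le_dist x (γ (0 + u))
    rwa [hlevel x hx, hγ.apply_eq (0 + u) ((zero_add u).symm ▸ Ioo_subset_Icc_self hu),
      add_sub_cancel_left] at hdist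
  · refine h.isOrthogonal_derivOn_of_arrival hγ ⟨ht0, ht.2⟩ ?_
    filter_upwards [Ioo_mem_nhdsGT ht0] with u hu x hx
    have hdist := h.ofReal_arrival_sub_le_dist (γ (t - u)) x
    rwa [hlevel x hx, hγ.apply_eq (t - u) ⟨by linarith [hu.2], by linarith [hu.1, ht.2]⟩,
      sub_sub_cancel] at hdist

theorem isOrthogonal_wavefront (hγ : F.IsCalibratedCurve (arrival 𝔟 a f) γ 0 T) {s t : ℝ}
    (hs : 0 ≤ s) (hst : s < t) (ht : t ≤ T) :
    F.IsOrthogonal (γ t) (derivOn γ T t) (F.wavefront {γ s} (t - s)) := by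
  refine h.isOrthogonal_derivOn_of_arrival hγ ⟨hs.trans_lt hst, ht⟩ ?_
  filter_upwards [Ioo_mem_nhdsGT (sub_pos.2 hst)] with u hu x hx
  have htri := F.dist_triangle (γ s) (γ (t - u)) x
  rw [mem_wavefront_singleton.1 hx,
    h.dist_calibratedCurve hγ hs (by linarith [hu.2]) (by linarith [hu.1]),
    ← sub_add_cancel (t - s) u, sub_right_comm,
    ENNReal.ofReal_add (by linarith [hu.2]) hu.1.le] at htri
  exact (ENNReal.add_le_add_iff_left ENNReal.ofReal_ne_top).1 htri

theorem touchesAt_calibratedCurve (hγ : F.IsCalibratedCurve (arrival 𝔟 a f) γ 0 T) {s t : ℝ}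
    (hs : 0 ≤ s) (hst : s < t) (ht : t ≤ T) (hd : f (γ t) = d) :
    F.TouchesAt (γ s) (t - s) (f ⁻¹' {d}) (γ t) :=
  ⟨mem_wavefront_singleton.2 (h.dist_calibratedCurve hγ hs hst.le ht), derivOn γ T t,
    h.isOrthogonal_level hγ (by linarith) ⟨by linarith, ht⟩ hd,
    h.isOrthogonal_wavefront hγ hs hst ht⟩

theorem touchesAt_calibratedCurve_travelTime
    (hγ : F.IsCalibratedCurve (arrival 𝔟 a f) γ 0 (travelTime 𝔟 a b))
    (hc : c ∈ Icc a b) (hd : d ∈ Icc a b) (hcd : c < d) :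
    γ (travelTime 𝔟 a c) ∈ f ⁻¹' {c} ∧ γ (travelTime 𝔟 a d) ∈ f ⁻¹' {d} ∧
      F.TouchesAt (γ (travelTime 𝔟 a c)) (travelTime 𝔟 c d) (f ⁻¹' {d})
        (γ (travelTime 𝔟 a d)) := by
  have hcT := h.travelTime_mem_Icc hc
  have hdT := h.travelTime_mem_Icc hd
  have hfd := (h.calibratedCurve_mem_level_iff hγ hdT hd).2 rfl
  refine ⟨(h.calibratedCurve_mem_level_iff hγ hcT hc).2 rfl, hfd, ?_⟩
  rw [h.travelTime_eq_sub hc hd]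
  exact h.touchesAt_calibratedCurve hγ hcT.1 (h.strictMonoOn_travelTime hc hd hcd) hdT.2 hfd

section Complete

variable (hforward : F.ForwardComplete) (hbackward : F.BackwardComplete)

include hforward hbackward

theorem exists_calibratedCurve_extension (hγ : F.IsCalibratedCurve (arrival 𝔟 a f) γ 0 T)
    (hT : 0 < T) : ∃ γ' : ℝ → M, EqOn γ' γ (Icc 0 T) ∧
      F.IsCalibratedCurve (arrival 𝔟 a f) γ' 0 (travelTime 𝔟 a b) := by
  have hTb := (h.bounds_calibratedCurve hγ hT.le).2
  have hmid : T / 2 ∈ Icc 0 T := ⟨by linarith, by linarith⟩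
  have hreg : f (γ (T / 2)) ∈ Ioo a b := by
    rw [h.mem_Ioo_iff, hγ.apply_eq _ hmid]
    constructor <;> linarith
  obtain ⟨γ', hγ', hγγ'⟩ := h.exists_calibratedCurve (mem_image_of_mem γ hmid) hreg
    hforward hbackward hγ.isCalibrated_image
  refine ⟨γ', fun t ht => ?_, hγ'⟩
  have heq := hγγ' _ (mem_image_of_mem γ ht)
  rwa [hγ.apply_eq t ht] at heq

variable (hb : interior (f ⁻¹' {b}) = ∅)

include hb

theorem exists_calibratedCurve_of_lt {q : M} (hq : a < f q) :
    ∃ γ : ℝ → M, F.IsCalibratedCurve (arrival 𝔟 a f) γ 0 (travelTime 𝔟 a b) ∧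
      γ (arrival 𝔟 a f q) = q := by
  rcases (h.mem_Icc q).2.lt_or_eq with hqb | hqb
  · exact h.exists_calibratedCurve_through ⟨hq, hqb⟩ hforward hbackward
  · obtain ⟨γ, hγ, hγq⟩ := h.exists_calibratedCurve_last hforward hbackward hb hqb
    exact ⟨γ, hγ, by rw [arrival, hqb, hγq]⟩

theorem exists_level_dist_eq (hc : c ∈ Icc a b) {p : M} (hp : c < f p) :
    ∃ q ∈ f ⁻¹' {c},
      F.dist q p = ENNReal.ofReal (arrival 𝔟 a f p - travelTime 𝔟 a c) := by
  obtain ⟨γ, hγ, hγp⟩ := h.exists_calibratedCurve_of_lt hforward hbackward hb (hc.1.trans_lt hp)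
  have hcT := h.travelTime_mem_Icc hc
  refine ⟨γ (travelTime 𝔟 a c), (h.calibratedCurve_mem_level_iff hγ hcT hc).2 rfl, ?_⟩
  have hdist := h.dist_calibratedCurve hγ hcT.1
    (h.strictMonoOn_travelTime hc (h.mem_Icc p) hp).le (h.arrival_le p)
  rwa [← arrival, hγp] at hdist

theorem distFrom_eq (q : M) :
    F.distFrom (f ⁻¹' {a}) q = ENNReal.ofReal (arrival 𝔟 a f q) := by
  apply le_antisymm
  · rcases (h.mem_Icc q).1.eq_or_lt with hq | hq
    · refine (iInf₂_le q hq.symm).trans ?_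
      rw [F.dist_self]
      exact bot_le
    · obtain ⟨p, hp, hpq⟩ := h.exists_level_dist_eq hforward hbackward hb h.left_mem hq
      rw [travelTime_self, sub_zero] at hpq
      exact (iInf₂_le p hp).trans hpq.le
  · refine le_iInf₂ fun p hp => ?_
    have hle := h.ofReal_arrival_sub_travelTime_le_dist h.left_mem hp q
    rwa [travelTime_self, sub_zero] at hle

theorem wavefront_eq (hc : c ∈ Icc a b) :
    F.wavefront (f ⁻¹' {a}) (travelTime 𝔟 a c) = f ⁻¹' {c} := by
  ext q
  rw [wavefront, mem_ofPred_eq, h.distFrom_eq hforward hbackward hb,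
    ENNReal.ofReal_eq_ofReal_iff (h.arrival_nonneg q) (h.travelTime_mem_Icc hc).1,
    h.arrival_eq_iff hc, mem_preimage, mem_singleton_iff]

theorem mem_level_iff_envelope (hc : c ∈ Icc a b) (hd : d ∈ Icc a b) (hcd : c < d) (p : M) :
    p ∈ f ⁻¹' {d} ↔ travelTime 𝔟 a c < arrival 𝔟 a f p ∧
      (∃ q ∈ f ⁻¹' {c}, F.dist q p = ENNReal.ofReal (travelTime 𝔟 c d)) ∧
      ∀ q ∈ f ⁻¹' {c}, ENNReal.ofReal (travelTime 𝔟 c d) ≤ F.dist q p := by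
  have hmono := h.strictMonoOn_travelTime
  constructor
  · rintro (hp : f p = d)
    rw [h.travelTime_eq_sub hc hd, ← (h.arrival_eq_iff hd).2 hp]
    exact ⟨hmono hc (h.mem_Icc p) (hcd.trans_eq hp.symm),
      h.exists_level_dist_eq hforward hbackward hb hc (hcd.trans_eq hp.symm),
      fun q hq => h.ofReal_arrival_sub_travelTime_le_dist hc hq p⟩
  · rintro ⟨hlt, ⟨q, hq, hqp⟩, hle⟩
    have hcp : c < f p := (hmono.lt_iff_lt hc (h.mem_Icc p)).1 hlt
    have hupper := h.ofReal_arrival_sub_travelTime_le_dist hc hq p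
    rw [hqp, ENNReal.ofReal_le_ofReal_iff (h.travelTime_pos hc hd hcd).le] at hupper
    obtain ⟨q', hq', hq'p⟩ := h.exists_level_dist_eq hforward hbackward hb hc hcp
    have hlower := hle q' hq'
    rw [hq'p, ENNReal.ofReal_le_ofReal_iff (sub_pos.2 hlt).le] at hlower
    have hsub := h.travelTime_eq_sub hc hd
    exact (h.arrival_eq_iff hd).1 (by linarith)

theorem isHuygensEnvelope (hc : c ∈ Icc a b) (hd : d ∈ Icc a b) (hcd : c < d) :
    F.IsHuygensEnvelope (f ⁻¹' {a}) (travelTime 𝔟 a c) (travelTime 𝔟 c d) (f ⁻¹' {d}) where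
  mem_iff p := by
    rw [h.wavefront_eq hforward hbackward hb hc, h.distFrom_eq hforward hbackward hb,
      ENNReal.ofReal_lt_ofReal_iff_of_nonneg (h.travelTime_mem_Icc hc).1]
    simp only [mem_wavefront_singleton]
    exact h.mem_level_iff_envelope hforward hbackward hb hc hd hcd p
  tangent p hp := by
    rw [h.wavefront_eq hforward hbackward hb hc]
    obtain ⟨γ, hγ, hγp⟩ := h.exists_calibratedCurve_of_lt hforward hbackward hb
      (hc.1.trans_lt (hcd.trans_eq (Eq.symm hp)))
    rw [(h.arrival_eq_iff hd).2 hp] at hγp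
    obtain ⟨hγc, -, htouch⟩ := h.touchesAt_calibratedCurve_travelTime hγ hc hd hcd
    exact ⟨_, hγc, hγp ▸ htouch⟩
  touches hpos q hq := by
    rw [h.wavefront_eq hforward hbackward hb hc] at hq
    have hac : a < f q := by
      rw [← travelTime_self (𝔟 := 𝔟) a, h.strictMonoOn_travelTime.lt_iff_lt h.left_mem hc] at hpos
      exact hpos.trans_eq (Eq.symm hq)
    obtain ⟨γ, hγ, hγq⟩ := h.exists_calibratedCurve_of_lt hforward hbackward hb hac
    rw [(h.arrival_eq_iff hc).2 hq] at hγq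
    obtain ⟨-, hγd, htouch⟩ := h.touchesAt_calibratedCurve_travelTime hγ hc hd hcd
    exact ⟨_, hγd, hγq ▸ htouch⟩

theorem isWaveRay_of_isCalibratedCurve (hγ : F.IsCalibratedCurve (arrival 𝔟 a f) γ 0 T)
    (hT : 0 < T) : F.IsWaveRay (f ⁻¹' {a}) γ T where
  nonneg := hT.le
  piecewiseSmooth := .smooth hT.le (h.contMDiffOn_calibratedCurve hγ hT)
  unitSpeed _ ht _ := h.toFun_velocity_calibratedCurve hγ ht
  source := (h.calibratedCurve_mem_level_iff hγ (left_mem_Icc.2 hT.le) h.left_mem).2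
    (travelTime_self a).symm
  shortest := by
    rw [(h.isGeodesic_of_isCalibratedCurve hγ hT).2 0 T le_rfl hT.le le_rfl,
      h.dist_calibratedCurve hγ le_rfl hT.le le_rfl, h.distFrom_eq hforward hbackward hb,
      hγ.apply_eq T (right_mem_Icc.2 hT.le), sub_zero]

theorem isCalibratedCurve_of_isWaveRay (hγ : F.IsWaveRay (f ⁻¹' {a}) γ T) :
    F.IsCalibratedCurve (arrival 𝔟 a f) γ 0 T := by
  have hlength : ∀ s t, 0 ≤ s → t ≤ T → F.length γ s t = ENNReal.ofReal (t - s) :=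
    fun s t hs ht => F.length_eq_of_unitSpeed hγ.piecewiseSmooth hγ.unitSpeed hs ht
  have hdist : ∀ s t, 0 ≤ s → s ≤ t → t ≤ T → F.dist (γ s) (γ t) ≤ ENNReal.ofReal (t - s) :=
    fun s t hs hst ht => by
      rw [← hlength s t hs ht]
      exact F.dist_le_length (hγ.piecewiseSmooth.restrict hs hst ht)
  refine ⟨fun t ht => ?_, hdist⟩
  have hstart : arrival 𝔟 a f (γ 0) = 0 := by
    rw [(h.arrival_eq_iff h.left_mem).2 hγ.source, travelTime_self]
  have hend : T = arrival 𝔟 a f (γ T) := by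
    rw [← ENNReal.ofReal_eq_ofReal_iff hγ.nonneg (h.arrival_nonneg _),
      ← h.distFrom_eq hforward hbackward hb, ← hγ.shortest, hlength 0 T le_rfl le_rfl, sub_zero]
  have hbefore := h.arrival_sub_le (sub_nonneg.2 ht.1) (hdist 0 t le_rfl ht.1 ht.2)
  have hafter := h.arrival_sub_le (sub_nonneg.2 ht.2) (hdist t T ht.1 ht.2 le_rfl)
  linarith

theorem isWaveRay_const {q : M} (hq : f q = a) : F.IsWaveRay (f ⁻¹' {a}) (fun _ => q) 0 where
  nonneg := le_rfl
  piecewiseSmooth := .smooth le_rfl contMDiffOn_const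
  unitSpeed _ ht := absurd (ht.1.trans ht.2) (lt_irrefl _)
  source := hq
  shortest := by
    rw [h.distFrom_eq hforward hbackward hb, (h.arrival_eq_iff h.left_mem).2 hq, travelTime_self,
      length_eq_Ioo, Ioo_self, Measure.restrict_empty, lintegral_zero_measure, ENNReal.ofReal_zero]

theorem exists_isWaveRay (q : M) :
    ∃ γ : ℝ → M, F.IsWaveRay (f ⁻¹' {a}) γ (arrival 𝔟 a f q) ∧ γ (arrival 𝔟 a f q) = q := by
  rcases (h.mem_Icc q).1.eq_or_lt with hq | hq
  · rw [(h.arrival_eq_iff h.left_mem).2 hq.symm, travelTime_self]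
    exact ⟨fun _ => q, h.isWaveRay_const hforward hbackward hb hq.symm, rfl⟩
  · obtain ⟨γ, hγ, hγq⟩ := h.exists_calibratedCurve_of_lt hforward hbackward hb hq
    exact ⟨γ, h.isWaveRay_of_isCalibratedCurve hforward hbackward hb
      (hγ.mono le_rfl (h.arrival_le q)) (h.travelTime_pos h.left_mem (h.mem_Icc q) hq), hγq⟩

end Complete

end IsRegularTransnormal

end FinslerStructure

end

theorem proposition3p2 {n : ℕ} {M : Type*} [TopologicalSpace M] [T2Space M]
    [SecondCountableTopology M] [ConnectedSpace M]
    [ChartedSpace (EuclideanSpace ℝ (Fin n)) M] [IsManifold (𝓡 n) ∞ M]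
    (F : FinslerStructure n M) (hforward : F.ForwardComplete) (hbackward : F.BackwardComplete)
    (f : M → ℝ) (𝔟 : ℝ → ℝ) (a b : ℝ)
    (hf : F.IsTransnormal f 𝔟) (hrange : Set.range f = Set.Icc a b)
    (hpos : ∀ s ∈ Set.Ioo a b, 0 < 𝔟 s) (hb : interior (f ⁻¹' {b}) = ∅) :
    -- a) the level sets are the wavefronts
    (IntervalIntegrable (fun s => 1 / √(𝔟 s)) MeasureTheory.volume a b ∧
      ∀ c ∈ Set.Icc a b, f ⁻¹' {c} = F.wavefront (f ⁻¹' {a}) (Finsler.travelTime 𝔟 a c)) ∧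
    -- b) Huygens' envelope principle
    (∀ c ∈ Set.Icc a b, ∀ d ∈ Set.Icc a b, c < d →
      F.IsHuygensEnvelope (f ⁻¹' {a}) (Finsler.travelTime 𝔟 a c) (Finsler.travelTime 𝔟 c d) (f ⁻¹' {d})) ∧
    -- c) every point is reached by a wave ray
    (∀ q : M, ∃ γ : ℝ → M, F.IsWaveRay (f ⁻¹' {a}) γ (Finsler.travelTime 𝔟 a (f q)) ∧
      γ (Finsler.travelTime 𝔟 a (f q)) = q) ∧
    -- c) every wave ray of positive duration ...
    (∀ (γ : ℝ → M) (T : ℝ), 0 < T → F.IsWaveRay (f ⁻¹' {a}) γ T →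
      -- is a geodesic,
      F.IsGeodesic γ T ∧
      -- meets the wavefronts one after the other and orthogonally,
      (∀ c ∈ Set.Icc a b, ∀ t ∈ Set.Icc 0 T, f (γ t) = c ↔ t = Finsler.travelTime 𝔟 a c) ∧
      (∀ c ∈ Set.Icc a b, ∀ t ∈ Set.Icc 0 T, f (γ t) = c →
        F.IsOrthogonal (γ t) (Finsler.derivOn γ T t) (f ⁻¹' {c})) ∧
      -- and is part of a wave ray that joins the first level set to the last one
      ∃ γ' : ℝ → M, Set.EqOn γ' γ (Set.Icc 0 T) ∧ T ≤ Finsler.travelTime 𝔟 a b ∧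
        F.IsWaveRay (f ⁻¹' {a}) γ' (Finsler.travelTime 𝔟 a b) ∧ f (γ' (Finsler.travelTime 𝔟 a b)) = b) := by
  have h : F.IsRegularTransnormal f 𝔟 a b := hf.isRegularTransnormal hrange hpos hb
  refine ⟨⟨h.intervalIntegrable h.left_mem h.right_mem,
      fun c hc => (h.wavefront_eq hforward hbackward hb hc).symm⟩,
    fun c hc d hd hcd => h.isHuygensEnvelope hforward hbackward hb hc hd hcd,
    fun q => h.exists_isWaveRay hforward hbackward hb q, fun γ T hT hray => ?_⟩
  have hγ := h.isCalibratedCurve_of_isWaveRay hforward hbackward hb hray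
  obtain ⟨γ', hγγ', hγ'⟩ := h.exists_calibratedCurve_extension hforward hbackward hγ hT
  have hR : 0 < Finsler.travelTime 𝔟 a b := h.travelTime_pos h.left_mem h.right_mem h.lt
  exact ⟨h.isGeodesic_of_isCalibratedCurve hγ hT,
    fun c hc t ht => h.calibratedCurve_mem_level_iff hγ ht hc,
    fun c _ t ht hc => h.isOrthogonal_level hγ hT ht hc,
    γ', hγγ', (h.bounds_calibratedCurve hγ hT.le).2,
    h.isWaveRay_of_isCalibratedCurve hforward hbackward hb hγ' hR,
    (h.calibratedCurve_mem_level_iff hγ' (right_mem_Icc.2 hR.le) h.right_mem).2 rfl⟩
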